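/- Let $n\ge 2$ and $G=SL(n,\mathbb R)$, with Lie algebra $\mathfrak g=\mathfrak{sl}(n,\mathbb R)$; fix an inner product on $\mathfrak g$ and a basis $Y_1,\dots,Y_N$ of $\mathfrak g$. Let $P\subset G$ be the maximal parabolic subgroup of matrices $p=\begin{pmatrix}a&v\\0&\mathcal A\end{pmatrix}$ ($a\in\mathbb R\setminus\{0\}$, $\mathcal A\in GL(n-1,\mathbb R)$), and for $t\in\mathbb R$ let $\lambda_t^{\pm}(p)=\varepsilon^{\pm}(a)|a|^{it}$, where $\varepsilon^+=1$ and $\varepsilon^-=\operatorname{sgn}$. Let $\pi_t^{\pm}=\mathrm{Ind}_P^{G}(\lambda_t^{\pm})$ be the unitarily induced representation, realized on $L^2(\mathbb R^{n-1},dx)$ by left translation of the functions $F$ on $G$ with $F(hp)=\lambda_t^{\pm}(p)^{-1}|a|^{-n/2}F(h)$ for $p\in P$, where $F$ is identified with $x\mapsto F(\Lambda(x))$ and $\Lambda(x)$ is the lower unipotent matrix with first column $(1,x)$ that otherwise agrees with the identity. A vector $w$ is smooth if $g\mapsto\pi_t^{\pm}(g)w$ is $C^\infty$. For $X\in\mathfrak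 g$ write $Xw=\frac{d}{d\tau}\big|_{\tau=0}\pi_t^{\pm}(\exp\tau X)w$, and for $r\ge 0$ put $\|w\|_r=\big\|\big(I-\sum_k Y_k^2\big)^{r/2}w\big\|$, where the power is that of the self-adjoint closure of $I-\sum_k Y_k^2$ on smooth vectors. Likewise $(I-\mathfrak a^2)^{s/2}$ is a power of the self-adjoint closure of $I-\mathfrak a^2$. Roots and root spaces $\mathfrak u_\phi\subset\mathfrak g$ are taken with respect to the Cartan subalgebra of trace-zero diagonal matrices. For every $s\ge 0$, every $\sigma\in[0,s+\tfrac12)$ and every $C>0$ there is $\delta>0$ such that the following holds. For every root $\phi$, every unit vector $\mathfrak v\in\mathfrak u_\phi$, each choice of sign $\pm$ and every $t\in\mathbb R$ with $|t|\ge\delta$ there are smooth vectors $f,g$ of $\mathrm{Ind}_P^{G}(\lambda_t^{\pm})$ such that $$\pi_t^{\pm}(\exp\mathfrak v)f-f=g\qquad\text{and}\qquad \big\|(I-\mathfrak a^2)^{s/2}f\big\|>C\,\|g\|_{s+\sigma}$$ for every unit vector $\mathfrak a$ in the opposite root space $\mathfrak u_{-\phi}$. -/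

import Mathlib

namespace SLRep

open MeasureTheory Complex
open scoped ENNReal ContDiff Matrix

/-- The group `SL(n, ℝ)` with `n = d + 1`. -/
abbrev SL (d : ℕ) : Type := Matrix.SpecialLinearGroup (Fin (d + 1)) ℝ
/-- The Lie algebra `sl(n, ℝ)`, `n = d + 1`: real matrices of trace zero. -/
abbrev sl (d : ℕ) : Submodule ℝ (Matrix (Fin (d + 1)) (Fin (d + 1)) ℝ) :=
  LinearMap.ker (Matrix.traceLinearMap (Fin (d + 1)) ℝ ℝ)

section Exponential
attribute [local instance] Matrix.linftyOpNormedRing Matrix.linftyOpNormedAlgebra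

theorem hasDerivAt_det_exp_zero {m : ℕ} (X : Matrix (Fin m) (Fin m) ℝ) :
    HasDerivAt (fun τ : ℝ => (NormedSpace.exp (τ • X)).det) X.trace 0 := by
  have h1 : HasDerivAt (fun τ : ℝ => NormedSpace.exp (τ • X)) X 0 := by
    have := hasDerivAt_exp_smul_const (𝕂 := ℝ) X (0 : ℝ)
    rw [zero_smul, NormedSpace.exp_zero, one_mul] at this
    exact this
  let D : ContinuousMultilinearMap ℝ (fun _ : Fin m => Fin m → ℝ) ℝ :=
    { (Matrix.detRowAlternating (n := Fin m) (R := ℝ)).toMultilinearMap with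
      cont := by
        change Continuous (fun A : Fin m → Fin m → ℝ => Matrix.det (Matrix.of A))
        exact Continuous.matrix_det continuous_id }
  have h2 : HasDerivAt (fun τ : ℝ => fun i => (NormedSpace.exp (τ • X)) i) (fun i => X i) 0 := by
    rw [hasDerivAt_pi]
    intro i
    rw [hasDerivAt_pi]
    intro j
    let L : Matrix (Fin m) (Fin m) ℝ →L[ℝ] ℝ := LinearMap.toContinuousLinearMap
      (Matrix.entryLinearMap ℝ ℝ i j)
    exact L.hasFDerivAt.comp_hasDerivAt (0 : ℝ) h1
  have h3 := (D.hasFDerivAt (fun i => (NormedSpace.exp ((0 : ℝ) • X)) i)).comp_hasDerivAt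
    (0 : ℝ) h2
  refine HasDerivAt.congr_deriv h3 ?_
  symm
  rw [ContinuousMultilinearMap.linearDeriv_apply]
  simp only [zero_smul, NormedSpace.exp_zero]
  rw [Matrix.trace]
  refine Finset.sum_congr rfl fun i _ => ?_
  change X i i = Matrix.det (Matrix.updateRow 1 i (X i))
  rw [← Matrix.cramer_transpose_apply]
  simp

theorem det_exp_eq_one {m : ℕ} {X : Matrix (Fin m) (Fin m) ℝ} (hX : X.trace = 0) :
    (NormedSpace.exp X).det = 1 := by
  set F : ℝ → ℝ := fun τ => (NormedSpace.exp (τ • X)).det with hF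
  have hadd : ∀ a b, F (a + b) = F a * F b := by
    intro a b
    simp only [hF]
    rw [add_smul, Matrix.exp_add_of_commute _ _
      ((Commute.refl X).smul_left a |>.smul_right b), Matrix.det_mul]
  have h0 : HasDerivAt F 0 0 := by
    have := hasDerivAt_det_exp_zero X
    rwa [hX] at this
  have hd : ∀ a, HasDerivAt F 0 a := by
    intro a
    have h1 : HasDerivAt (fun τ => F a * F (τ - a)) (F a * 0) a := by
      refine HasDerivAt.const_mul _ ?_
      have h0' : HasDerivAt F 0 (a - a) := by simpa using h0
      simpa using h0'.comp_sub_const a a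
    rw [mul_zero] at h1
    convert h1 using 1
    funext τ
    rw [← hadd]; congr 1; ring
  have hc := is_const_of_deriv_eq_zero (fun a => (hd a).differentiableAt) (fun a => (hd a).deriv) 1 0
  simpa [hF] using hc

end Exponential

/-- The exponential map `sl(n, ℝ) → SL(n, ℝ)`. -/
noncomputable def expSL {d : ℕ} (X : sl d) : SL d :=
  ⟨NormedSpace.exp (X : Matrix (Fin (d + 1)) (Fin (d + 1)) ℝ),
    det_exp_eq_one (LinearMap.mem_ker.1 X.2)⟩

/-- The root space of the root `diag(h) ↦ h i - h j` (`i ≠ j`) of `sl(n, ℝ)` with respect to the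
Cartan subalgebra of trace-zero diagonal matrices. The opposite root space is `rootSpace j i`. -/
def rootSpace {d : ℕ} (i j : Fin (d + 1)) : Submodule ℝ (sl d) where
  carrier := {X | ∀ h : Fin (d + 1) → ℝ, ∑ k, h k = 0 →
    Matrix.diagonal h * X.1 - X.1 * Matrix.diagonal h = (h i - h j) • X.1}
  zero_mem' := by intro h _; simp
  add_mem' {X Y} hX hY := by
    intro h hh
    have e1 := hX h hh
    have e2 := hY h hh
    rw [Submodule.coe_add, smul_add, ← e1, ← e2, mul_add, add_mul]
    abel
  smul_mem' c X hX := by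
    intro h hh
    have e1 := hX h hh
    rw [Submodule.coe_smul, smul_comm, ← e1, smul_sub, mul_smul_comm, smul_mul_assoc]

section Induced

variable {d : ℕ}

/-- The maximal parabolic subgroup `P` stabilizing the line spanned by the first basis vector:
matrices whose first column vanishes below the top entry `a`. -/
def parabolic (d : ℕ) : Subgroup (SL d) where
  carrier := {p | ∀ i : Fin d, p i.succ 0 = 0}
  one_mem' i := by simp
  mul_mem' {p q} hp hq i := by
    simp only [Set.mem_ofPred_eq] at hp hq
    simp [Matrix.mul_apply, Fin.sum_univ_succ, hp, hq]
  inv_mem' {p} hp := by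
    simp only [Set.mem_ofPred_eq] at hp
    have h1 : ∀ i : Fin (d + 1), p 0 0 * (p⁻¹) i 0 = (1 : Matrix (Fin (d + 1)) (Fin (d + 1)) ℝ) i 0 := by
      intro i
      have h : (p⁻¹).1 * p.1 = 1 := by
        rw [← Matrix.SpecialLinearGroup.coe_mul, inv_mul_cancel]; rfl
      rw [← h, Matrix.mul_apply, Fin.sum_univ_succ]
      simp [hp, mul_comm]
    intro i
    have h0 : p 0 0 ≠ 0 := by
      intro h
      have := h1 0
      simp [h] at this
    have := h1 i.succ
    simp only [Matrix.one_apply, Fin.succ_ne_zero, if_false, mul_eq_zero] at this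
    exact this.resolve_left h0

theorem parabolic_mul_zero_zero (h : SL d) {p : SL d} (hp : p ∈ parabolic d) (i : Fin (d + 1)) :
    (h * p) i 0 = p 0 0 * h i 0 := by
  have hp' : ∀ i : Fin d, p i.succ 0 = 0 := hp
  simp [Matrix.SpecialLinearGroup.coe_mul, Matrix.mul_apply, Fin.sum_univ_succ, hp', mul_comm]

theorem parabolic_zero_zero_ne {p : SL d} (hp : p ∈ parabolic d) : p 0 0 ≠ 0 := by
  intro h0
  have h := parabolic_mul_zero_zero p⁻¹ hp 0
  rw [inv_mul_cancel, h0] at h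
  simp at h

/-- The value `ε(a) |a| ^ (i t)`, with `ε = sgn` if `odd` is true and `ε = 1` otherwise. -/
noncomputable def charValue (odd : Bool) (t a : ℝ) : ℂ :=
  ((if odd then Real.sign a else 1 : ℝ) : ℂ) * ((|a| : ℝ) : ℂ) ^ ((t : ℂ) * I)

theorem charValue_mul (odd : Bool) (t a b : ℝ) :
    charValue odd t (a * b) = charValue odd t a * charValue odd t b := by
  have h1 : ((|a * b| : ℝ) : ℂ) ^ ((t : ℂ) * I)
      = ((|a| : ℝ) : ℂ) ^ ((t : ℂ) * I) * ((|b| : ℝ) : ℂ) ^ ((t : ℂ) * I) := by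
    rw [abs_mul, Complex.ofReal_mul, Complex.mul_cpow_ofReal_nonneg (abs_nonneg _) (abs_nonneg _)]
  have h2 : (if odd then Real.sign (a * b) else 1 : ℝ)
      = (if odd then Real.sign a else 1) * (if odd then Real.sign b else 1) := by
    cases odd
    · simp
    · simp only [if_true]
      rcases lt_trichotomy a 0 with ha | ha | ha <;> rcases lt_trichotomy b 0 with hb | hb | hb
      · rw [Real.sign_of_neg ha, Real.sign_of_neg hb, Real.sign_of_pos (mul_pos_of_neg_of_neg ha hb)]
        norm_num
      · simp [hb]
      · rw [Real.sign_of_neg ha, Real.sign_of_pos hb, Real.sign_of_neg (mul_neg_of_neg_of_pos ha hb)]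
        norm_num
      · simp [ha]
      · simp [ha]
      · simp [ha]
      · rw [Real.sign_of_pos ha, Real.sign_of_neg hb, Real.sign_of_neg (mul_neg_of_pos_of_neg ha hb)]
        norm_num
      · simp [hb]
      · rw [Real.sign_of_pos ha, Real.sign_of_pos hb, Real.sign_of_pos (mul_pos ha hb)]
        norm_num
  rw [charValue, charValue, charValue, h1, h2]
  push_cast
  ring

theorem norm_charValue (odd : Bool) (t : ℝ) {a : ℝ} (ha : a ≠ 0) : ‖charValue odd t a‖ = 1 := by
  rw [charValue, norm_mul, Complex.norm_cpow_eq_rpow_re_of_pos (abs_pos.2 ha)]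
  have : ‖((if odd then Real.sign a else 1 : ℝ) : ℂ)‖ = 1 := by
    rcases lt_or_gt_of_ne ha with h | h
    · cases odd <;> simp [Real.sign_of_neg h]
    · cases odd <;> simp [Real.sign_of_pos h]
  rw [this]
  simp

/-- The unitary character `λ_t^±` of `P`: the sign `+` is `odd = false`, the sign `-` is
`odd = true`. -/
noncomputable def character (d : ℕ) (odd : Bool) (t : ℝ) : parabolic d →* ℂ where
  toFun p := charValue odd t (p.1 0 0)
  map_one' := by simp [charValue]
  map_mul' p q := by
    rw [← charValue_mul]
    congr 1
    have := parabolic_mul_zero_zero (p.1) q.2 0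
    rw [mul_comm (p.1 0 0), ← this]
    rfl

/-- The square root `|a| ^ (n / 2)`, `n = d + 1`, of the modular function of `P`, as a function of
the top left entry `a` (recall `|det A| = |a|⁻¹`). -/
noncomputable def modulus (d : ℕ) (a : ℝ) : ℝ := |a| ^ (((d : ℝ) + 1) / 2)

/-- The function `F` on `SL(n, ℝ)` with `F(h p) = (λ_t^±(p) |a(p)| ^ (n / 2))⁻¹ F(h)` for `p ∈ P`
and `F(Λ(x)) = f(x)` for the lower unipotent matrices `Λ(x)`, `x ∈ ℝ ^ d`; it is extended by zero
off the conull open set `{Λ(x) p}` of matrices with nonzero top left entry. See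
`equivariantExtension_mul` and `equivariantExtension_lowerUnipotent`. -/
noncomputable def equivariantExtension (odd : Bool) (t : ℝ) (f : (Fin d → ℝ) → ℂ) (h : SL d) : ℂ :=
  if h 0 0 = 0 then 0
  else (charValue odd t (h 0 0) * (modulus d (h 0 0) : ℂ))⁻¹ *
    f fun i => h i.succ 0 / h 0 0

theorem equivariantExtension_mul (odd : Bool) (t : ℝ) (f : (Fin d → ℝ) → ℂ) (h : SL d)
    (p : parabolic d) :
    equivariantExtension odd t f (h * p) =
      (character d odd t p * (modulus d (p.1 0 0) : ℂ))⁻¹ * equivariantExtension odd t f h := by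
  have hp := parabolic_zero_zero_ne p.2
  simp only [equivariantExtension, parabolic_mul_zero_zero h p.2, mul_eq_zero, hp, false_or]
  split_ifs with h0
  · simp
  · have : ∀ i : Fin d, p.1 0 0 * h i.succ 0 / (p.1 0 0 * h 0 0)
        = h i.succ 0 / h 0 0 := fun i => by field_simp
    simp only [this, charValue_mul]
    have h3 : modulus d (p.1 0 0 * h 0 0) = modulus d (p.1 0 0) * modulus d (h 0 0) := by
      simp only [modulus, abs_mul]
      rw [Real.mul_rpow (abs_nonneg _) (abs_nonneg _)]
    rw [h3]
    change _ = (charValue odd t (p.1 0 0) * _)⁻¹ * _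
    push_cast
    simp only [mul_inv]
    ring

/-- The unipotent matrix with first column `(1, x)` that agrees with the identity elsewhere. -/
def lowerUnipotentMatrix (x : Fin d → ℝ) : Matrix (Fin (d + 1)) (Fin (d + 1)) ℝ :=
  Matrix.of fun i j => if i = j then 1 else if j = 0 then (Fin.cons 1 x : Fin (d + 1) → ℝ) i else 0

/-- The section `x ↦ Λ(x)` of `SL(n, ℝ) → SL(n, ℝ) / P` over the open dense cell. -/
def lowerUnipotent (x : Fin d → ℝ) : SL d :=
  ⟨lowerUnipotentMatrix x, by
    have h : (lowerUnipotentMatrix x).BlockTriangular OrderDual.toDual := by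
      intro i j hij
      have hij' : i < j := hij
      have h0 : j ≠ 0 := Fin.ne_zero_of_lt hij'
      simp [lowerUnipotentMatrix, hij'.ne, h0]
    rw [Matrix.det_of_isLowerTriangular _ h]
    simp [lowerUnipotentMatrix]⟩

theorem lowerUnipotent_zero (x : Fin d → ℝ) : (lowerUnipotent x) 0 0 = 1 := by
  simp [lowerUnipotent, lowerUnipotentMatrix]

theorem lowerUnipotent_succ (x : Fin d → ℝ) (i : Fin d) :
    (lowerUnipotent x) i.succ 0 = x i := by
  simp [lowerUnipotent, lowerUnipotentMatrix]

theorem equivariantExtension_lowerUnipotent (odd : Bool) (t : ℝ) (f : (Fin d → ℝ) → ℂ)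
    (x : Fin d → ℝ) : equivariantExtension odd t f (lowerUnipotent x) = f x := by
  simp [equivariantExtension, lowerUnipotent_zero, lowerUnipotent_succ, charValue, modulus]

/-- Left translation by `g` of the equivariant function of `f`, read in the coordinates `Λ(x)`:
`(translate g f)(x) = F(g⁻¹ Λ(x))`. -/
noncomputable def translate (odd : Bool) (t : ℝ) (g : SL d) (f : (Fin d → ℝ) → ℂ) :
    (Fin d → ℝ) → ℂ :=
  fun x => equivariantExtension odd t f (g⁻¹ * lowerUnipotent x)


/-- The top left entry of `M Λ(x)`. -/
def denom (M : SL d) (x : Fin d → ℝ) : ℝ := (M * lowerUnipotent x) 0 0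

/-- The action of `M` in the coordinates: `M Λ(x) ∈ Λ(moved M x) P` where `denom M x ≠ 0`. -/
noncomputable def moved (M : SL d) (x : Fin d → ℝ) : Fin d → ℝ :=
  fun i => (M * lowerUnipotent x) i.succ 0 / denom M x

theorem mul_lowerUnipotent_col (M : SL d) (x : Fin d → ℝ) (i : Fin (d + 1)) :
    (M * lowerUnipotent x) i 0 = M i 0 + ∑ k : Fin d, M i k.succ * x k := by
  rw [Matrix.SpecialLinearGroup.coe_mul, Matrix.mul_apply, Fin.sum_univ_succ]
  simp only [lowerUnipotent_zero, lowerUnipotent_succ, mul_one]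

theorem translate_apply (odd : Bool) (t : ℝ) (g : SL d) (f : (Fin d → ℝ) → ℂ) (x : Fin d → ℝ)
    (hx : denom g⁻¹ x ≠ 0) :
    translate odd t g f x = (charValue odd t (denom g⁻¹ x) * (modulus d (denom g⁻¹ x) : ℂ))⁻¹ *
      f (moved g⁻¹ x) := by
  exact if_neg hx

theorem exists_parabolic (M : SL d) (x : Fin d → ℝ) (hx : denom M x ≠ 0) :
    ∃ p : parabolic d, M * lowerUnipotent x = lowerUnipotent (moved M x) * p ∧
      p.1 0 0 = denom M x := by
  set q : SL d := (lowerUnipotent (moved M x))⁻¹ * (M * lowerUnipotent x) with hq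
  have hcol : ∀ i : Fin (d + 1), (M * lowerUnipotent x) i 0
      = denom M x * (lowerUnipotent (moved M x)) i 0 := by
    intro i
    refine Fin.cases ?_ (fun i => ?_) i
    · rw [lowerUnipotent_zero, mul_one]; rfl
    · rw [lowerUnipotent_succ, moved]; field_simp
  have hq' : ∀ i, q i 0 = denom M x * (1 : SL d) i 0 := by
    intro i
    have hmul : ∀ A B : SL d, (A * B) i 0 = ∑ j, A i j * B j 0 := fun A B => by
      rw [Matrix.SpecialLinearGroup.coe_mul, Matrix.mul_apply]
    rw [hq, ← inv_mul_cancel (lowerUnipotent (moved M x)), hmul, hmul, Finset.mul_sum]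
    refine Finset.sum_congr rfl fun j _ => ?_
    rw [hcol]; ring
  refine ⟨⟨q, fun i => ?_⟩, ?_, ?_⟩
  · rw [hq']; simp
  · simp [hq]
  · rw [hq']; simp

theorem denom_mul (M N : SL d) (x : Fin d → ℝ) (hx : denom N x ≠ 0) :
    denom (M * N) x = denom M (moved N x) * denom N x := by
  obtain ⟨p, hp, hp0⟩ := exists_parabolic N x hx
  rw [denom, mul_assoc, hp, ← mul_assoc, parabolic_mul_zero_zero _ p.2, hp0, mul_comm]; rfl

theorem moved_mul (M N : SL d) (x : Fin d → ℝ) (hx : denom N x ≠ 0) :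
    moved (M * N) x = moved M (moved N x) := by
  obtain ⟨p, hp, hp0⟩ := exists_parabolic N x hx
  funext i
  rw [moved, denom_mul M N x hx, mul_assoc, hp, ← mul_assoc, parabolic_mul_zero_zero _ p.2, hp0,
    moved]
  field_simp

theorem denom_one (x : Fin d → ℝ) : denom 1 x = 1 := by
  rw [denom, one_mul, lowerUnipotent_zero]

theorem moved_one (x : Fin d → ℝ) : moved 1 x = x := by
  funext i; rw [moved, denom_one, one_mul, lowerUnipotent_succ, div_one]

theorem moved_inv_moved (M : SL d) (x : Fin d → ℝ) (hx : denom M x ≠ 0) :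
    moved M⁻¹ (moved M x) = x := by
  rw [← moved_mul _ _ _ hx, inv_mul_cancel, moved_one]

theorem denom_inv_moved (M : SL d) (x : Fin d → ℝ) (hx : denom M x ≠ 0) :
    denom M⁻¹ (moved M x) ≠ 0 := by
  have := denom_mul M⁻¹ M x hx
  rw [inv_mul_cancel, denom_one] at this
  intro h; simp [h] at this

theorem continuous_col (M : SL d) (i : Fin (d + 1)) :
    Continuous fun x : Fin d → ℝ => (M * lowerUnipotent x) i 0 := by
  simp only [mul_lowerUnipotent_col]; fun_prop

theorem continuous_denom (M : SL d) : Continuous (denom M) := continuous_col M 0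

theorem measurable_moved (M : SL d) : Measurable (moved M) :=
  measurable_pi_iff.2 fun i =>
    (continuous_col M i.succ).measurable.div (continuous_denom M).measurable

theorem isOpen_denom_ne (M : SL d) : IsOpen {x | denom M x ≠ 0} :=
  isOpen_ne.preimage (continuous_denom M)

theorem ae_denom_ne (M : SL d) : ∀ᵐ x : Fin d → ℝ, denom M x ≠ 0 := by
  let S : AffineSubspace ℝ (Fin d → ℝ) :=
    { carrier := {x | denom M x = 0}
      smul_vsub_vadd_mem' := by
        intro c p q r hp hq hr
        simp only [Set.mem_ofPred_eq, denom, mul_lowerUnipotent_col, vsub_eq_sub, vadd_eq_add,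
          Pi.add_apply, Pi.smul_apply, Pi.sub_apply, smul_eq_mul] at *
        have : ∑ k : Fin d, M 0 k.succ * (c * (p k - q k) + r k)
            = c * (∑ k : Fin d, M 0 k.succ * p k - ∑ k : Fin d, M 0 k.succ * q k)
              + ∑ k : Fin d, M 0 k.succ * r k := by
          rw [← Finset.sum_sub_distrib, Finset.mul_sum, ← Finset.sum_add_distrib]
          exact Finset.sum_congr rfl fun k _ => by ring
        rw [this]; linear_combination c * hp - c * hq + hr }
  have hS : S ≠ ⊤ := by
    intro h
    have hall : ∀ x : Fin d → ℝ, denom M x = 0 := fun x => by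
      have : x ∈ S := by rw [h]; trivial
      exact this
    have h0 : M 0 0 = 0 := by
      have := hall 0
      simpa [denom, mul_lowerUnipotent_col] using this
    have h1 : ∀ k : Fin d, M 0 k.succ = 0 := fun k => by
      have := hall (Pi.single k 1)
      simpa [denom, mul_lowerUnipotent_col, h0, Pi.single_apply] using this
    have hdet : M.1.det = 0 := Matrix.det_eq_zero_of_row_eq_zero 0
      (fun j => Fin.cases h0 h1 j)
    simp at hdet
  have := Measure.addHaar_affineSubspace (volume : Measure (Fin d → ℝ)) S hS
  rw [ae_iff]
  simp only [ne_eq, not_not]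
  exact this

theorem det_parabolic (p : parabolic d) :
    p.1 0 0 * (p.1.1.submatrix Fin.succ Fin.succ).det = 1 := by
  have h := p.1.2
  have hp : ∀ i : Fin d, p.1 i.succ 0 = 0 := p.2
  rw [Matrix.det_succ_column_zero, Fin.sum_univ_succ] at h
  simpa [hp] using h

/-- The Jacobian matrix of `moved M`. -/
noncomputable def jacobian (M : SL d) (x : Fin d → ℝ) : Matrix (Fin d) (Fin d) ℝ :=
  Matrix.of fun i k => (denom M x)⁻¹ * (M i.succ k.succ - moved M x i * M 0 k.succ)

theorem hasFDerivAt_moved (M : SL d) (x : Fin d → ℝ) (hx : denom M x ≠ 0) :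
    HasFDerivAt (moved M) (LinearMap.toContinuousLinearMap (Matrix.toLin' (jacobian M x))) x := by
  have hcol : ∀ i : Fin (d + 1), HasFDerivAt (fun x : Fin d → ℝ => (M * lowerUnipotent x) i 0)
      (∑ k : Fin d, M i k.succ • (ContinuousLinearMap.proj k : (Fin d → ℝ) →L[ℝ] ℝ)) x := by
    intro i
    simp only [mul_lowerUnipotent_col]
    refine HasFDerivAt.const_add _ (HasFDerivAt.fun_sum fun k _ => ?_)
    exact (ContinuousLinearMap.hasFDerivAt (ContinuousLinearMap.proj k : (Fin d → ℝ) →L[ℝ] ℝ)).const_mul _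
  rw [hasFDerivAt_pi']
  intro i
  have h := (hcol i.succ).mul ((hasDerivAt_inv hx).comp_hasFDerivAt x (hcol 0))
  refine HasFDerivAt.congr_fderiv h ?_
  ext w
  simp [jacobian, moved, Matrix.mulVec, dotProduct]
  rw [Finset.mul_sum, Finset.mul_sum, Finset.mul_sum, ← Finset.sum_neg_distrib,
    ← Finset.sum_add_distrib]
  refine Finset.sum_congr rfl fun k _ => ?_
  field_simp
  ring

theorem abs_det_jacobian (M : SL d) (x : Fin d → ℝ) (hx : denom M x ≠ 0) :
    |(jacobian M x).det| = (|denom M x| ^ (d + 1))⁻¹ := by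
  obtain ⟨p, hp, hp0⟩ := exists_parabolic M x hx
  have hJ : jacobian M x = (denom M x)⁻¹ • p.1.1.submatrix Fin.succ Fin.succ := by
    ext i k
    have hΛ : ∀ (A : SL d) (y : Fin d → ℝ) (i : Fin (d + 1)) (k : Fin d),
        (A * lowerUnipotent y) i k.succ = A i k.succ := by
      intro A y i k
      rw [Matrix.SpecialLinearGroup.coe_mul, Matrix.mul_apply, Finset.sum_eq_single k.succ]
      · simp [lowerUnipotent, lowerUnipotentMatrix]
      · intro b _ hb; simp [lowerUnipotent, lowerUnipotentMatrix, hb]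
      · simp
    have hrow : ∀ (y : Fin d → ℝ) (A : SL d) (i : Fin d) (k : Fin (d + 1)),
        (lowerUnipotent y * A) i.succ k = y i * A 0 k + A i.succ k := by
      intro y A i k
      rw [Matrix.SpecialLinearGroup.coe_mul, Matrix.mul_apply, Fin.sum_univ_succ,
        lowerUnipotent_succ, Finset.sum_eq_single i]
      · simp [lowerUnipotent, lowerUnipotentMatrix]
      · intro b _ hb
        simp [lowerUnipotent, lowerUnipotentMatrix, hb.symm]
      · simp
    have hrow0 : ∀ (y : Fin d → ℝ) (A : SL d) (k : Fin (d + 1)),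
        (lowerUnipotent y * A) 0 k = A 0 k := by
      intro y A k
      rw [Matrix.SpecialLinearGroup.coe_mul, Matrix.mul_apply, Fin.sum_univ_succ,
        lowerUnipotent_zero]
      simp [lowerUnipotent, lowerUnipotentMatrix, (Fin.succ_ne_zero _).symm]
    have e1 := hΛ M x i.succ k
    have e0 := hΛ M x 0 k
    rw [hp, hrow] at e1
    rw [hp, hrow0] at e0
    simp only [jacobian, Matrix.of_apply, Matrix.smul_apply, Matrix.submatrix_apply, smul_eq_mul]
    rw [← e1, ← e0]; ring
  have hdet := det_parabolic p
  rw [hp0] at hdet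
  have : (p.1.1.submatrix Fin.succ Fin.succ).det = (denom M x)⁻¹ := by
    field_simp; linarith
  rw [hJ, Matrix.det_smul, this, Fintype.card_fin, abs_mul, abs_pow, abs_inv, pow_succ, mul_inv,
    inv_pow]

theorem lintegral_moved (M : SL d) (φ : (Fin d → ℝ) → ℝ≥0∞) :
    ∫⁻ x, ENNReal.ofReal ((|denom M x| ^ (d + 1))⁻¹) * φ (moved M x) = ∫⁻ x, φ x := by
  set U : Set (Fin d → ℝ) := {x | denom M x ≠ 0} with hU
  have hUm : MeasurableSet U := (isOpen_denom_ne M).measurableSet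
  have key := lintegral_image_eq_lintegral_abs_det_fderiv_mul volume hUm
    (f := moved M) (f' := fun x => LinearMap.toContinuousLinearMap (Matrix.toLin' (jacobian M x)))
    (fun x hx => (hasFDerivAt_moved M x hx).hasFDerivWithinAt)
    (fun x hx y hy hxy => by
      rw [← moved_inv_moved M x hx, hxy, moved_inv_moved M y hy]) φ
  have hUae : U =ᵐ[volume] Set.univ := by
    rw [Filter.eventuallyEq_univ]; exact ae_denom_ne M
  have himage : moved M '' U =ᵐ[volume] Set.univ := by
    rw [Filter.eventuallyEq_univ]
    filter_upwards [ae_denom_ne M⁻¹] with y hy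
    refine ⟨moved M⁻¹ y, ?_, ?_⟩
    · have := denom_inv_moved M⁻¹ y hy
      rwa [inv_inv] at this
    · have := moved_inv_moved M⁻¹ y hy
      rwa [inv_inv] at this
  rw [setLIntegral_congr himage, setLIntegral_univ] at key
  rw [key, ← setLIntegral_univ, ← setLIntegral_congr hUae]
  refine setLIntegral_congr_fun hUm fun x hx => ?_
  rw [← abs_det_jacobian M x hx, LinearMap.det_toContinuousLinearMap, LinearMap.det_toLin']

theorem ae_moved (M : SL d) {q : (Fin d → ℝ) → Prop} (hq : ∀ᵐ x, q x) :
    ∀ᵐ x, q (moved M x) := by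
  obtain ⟨s, hs, hsm, hs0⟩ := exists_measurable_superset_of_null (ae_iff.1 hq)
  have h := lintegral_moved M (s.indicator 1)
  rw [lintegral_indicator_one hsm, hs0, lintegral_eq_zero_iff'] at h
  · filter_upwards [h, ae_denom_ne M] with x hx hd
    by_contra hcon
    have hmem : moved M x ∈ s := hs hcon
    simp only [Set.indicator_of_mem hmem, Pi.one_apply, mul_one, Pi.zero_apply,
      ENNReal.ofReal_eq_zero] at hx
    have : 0 < (|denom M x| ^ (d + 1))⁻¹ := by positivity
    linarith
  · refine Measurable.aemeasurable ?_
    refine Measurable.mul ?_ ?_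
    · exact (((continuous_denom M).measurable.abs.pow_const _).inv).ennreal_ofReal
    · exact (measurable_one.indicator hsm).comp (measurable_moved M)

theorem translate_congr (odd : Bool) (t : ℝ) (g : SL d) {f f' : (Fin d → ℝ) → ℂ}
    (h : f =ᵐ[volume] f') : translate odd t g f =ᵐ[volume] translate odd t g f' := by
  filter_upwards [ae_moved g⁻¹ h, ae_denom_ne g⁻¹] with x hx hd
  rw [translate_apply _ _ _ _ _ hd, translate_apply _ _ _ _ _ hd, hx]

theorem translate_one (odd : Bool) (t : ℝ) (f : (Fin d → ℝ) → ℂ) : translate odd t 1 f = f := by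
  funext x
  rw [translate, inv_one, one_mul, equivariantExtension_lowerUnipotent]

theorem translate_mul (odd : Bool) (t : ℝ) (g h : SL d) (f : (Fin d → ℝ) → ℂ) :
    translate odd t g (translate odd t h f) =ᵐ[volume] translate odd t (g * h) f := by
  filter_upwards [ae_denom_ne g⁻¹] with x hx
  obtain ⟨p, hp, hp0⟩ := exists_parabolic g⁻¹ x hx
  have e : (g * h)⁻¹ * lowerUnipotent x = h⁻¹ * lowerUnipotent (moved g⁻¹ x) * p := by
    rw [mul_inv_rev, mul_assoc, hp, ← mul_assoc]
  have ec : character d odd t p = charValue odd t (denom g⁻¹ x) := by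
    rw [← hp0]; rfl
  rw [translate_apply _ _ _ _ _ hx, translate, translate, e, equivariantExtension_mul, hp0, ec]

theorem measurable_translate (odd : Bool) (t : ℝ) (g : SL d) {f : (Fin d → ℝ) → ℂ}
    (hf : Measurable f) : Measurable (translate odd t g f) := by
  have hc := (continuous_denom (g⁻¹)).measurable
  have hm : Measurable fun x => (charValue odd t (denom g⁻¹ x) *
      (modulus d (denom g⁻¹ x) : ℂ))⁻¹ * f (moved g⁻¹ x) := by
    have hsign : Measurable Real.sign := by
      unfold Real.sign
      exact Measurable.ite measurableSet_Iio measurable_const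
        (Measurable.ite measurableSet_Ioi measurable_const measurable_const)
    have h1 : Measurable (charValue odd t) := by
      unfold charValue
      refine Measurable.mul (Complex.measurable_ofReal.comp ?_) ?_
      · cases odd
        · simp
        · simpa using hsign
      · exact (Complex.measurable_ofReal.comp measurable_id.abs).pow_const _
    have h2 : Measurable (modulus d) := by
      unfold modulus
      exact measurable_id.abs.pow_const _
    exact ((h1.comp hc).mul (Complex.measurable_ofReal.comp (h2.comp hc))).inv.mul
      (hf.comp (measurable_moved g⁻¹))
  have : translate odd t g f = fun x => if denom g⁻¹ x = 0 then 0 else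
      (charValue odd t (denom g⁻¹ x) * (modulus d (denom g⁻¹ x) : ℂ))⁻¹ * f (moved g⁻¹ x) := by
    funext x
    split_ifs with h
    · exact if_pos h
    · exact translate_apply _ _ _ _ _ h
  rw [this]
  exact Measurable.ite (hc (measurableSet_singleton 0)) measurable_const hm

theorem eLpNorm_translate (odd : Bool) (t : ℝ) (g : SL d) (f : (Fin d → ℝ) → ℂ) :
    eLpNorm (translate odd t g f) 2 volume = eLpNorm f 2 volume := by
  rw [eLpNorm_eq_lintegral_rpow_enorm_toReal (by simp) (by simp),
    eLpNorm_eq_lintegral_rpow_enorm_toReal (by simp) (by simp),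
    ← lintegral_moved g⁻¹ (fun x => ‖f x‖ₑ ^ ENNReal.toReal 2)]
  congr 1
  refine lintegral_congr_ae ?_
  filter_upwards [ae_denom_ne g⁻¹] with x hx
  rw [translate_apply _ _ _ _ _ hx, enorm_mul, ENNReal.mul_rpow_of_nonneg _ _ (by simp)]
  congr 1
  have hpos : 0 < |denom g⁻¹ x| := abs_pos.2 hx
  rw [← ofReal_norm, norm_inv, norm_mul, norm_charValue _ _ hx, one_mul, Complex.norm_real,
    Real.norm_eq_abs, modulus, abs_of_pos (Real.rpow_pos_of_pos hpos _),
    ENNReal.ofReal_rpow_of_nonneg (by positivity) (by simp)]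
  congr 1
  rw [ENNReal.toReal_ofNat, Real.inv_rpow (by positivity), ← Real.rpow_mul hpos.le,
    ← Real.rpow_natCast]
  congr 2
  push_cast; ring

/-- The Hilbert space `L²(ℝ ^ (n - 1), dx)`, `n = d + 1`. -/
abbrev LineModel (d : ℕ) : Type := Lp ℂ 2 (volume : Measure (Fin d → ℝ))

theorem memLp_translate (odd : Bool) (t : ℝ) (g : SL d) (f : LineModel d) :
    MemLp (translate odd t g f) 2 volume := by
  refine ⟨?_, ?_⟩
  · obtain ⟨f', hf', hff'⟩ := Lp.aestronglyMeasurable f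
    exact ⟨_, (measurable_translate odd t g hf'.measurable).stronglyMeasurable,
      translate_congr odd t g hff'⟩
  · rw [eLpNorm_translate]; exact Lp.eLpNorm_lt_top f

/-- `translate` on classes of square integrable functions. -/
noncomputable def translateLp (odd : Bool) (t : ℝ) (g : SL d) (f : LineModel d) : LineModel d :=
  (memLp_translate odd t g f).toLp _

theorem coeFn_translateLp (odd : Bool) (t : ℝ) (g : SL d) (f : LineModel d) :
    translateLp odd t g f =ᵐ[volume] translate odd t g f := MemLp.coeFn_toLp _

theorem translateLp_mul (odd : Bool) (t : ℝ) (g h : SL d) (f : LineModel d) :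
    translateLp odd t g (translateLp odd t h f) = translateLp odd t (g * h) f := by
  apply Lp.ext
  exact (coeFn_translateLp _ _ _ _).trans <|
    (translate_congr odd t g (coeFn_translateLp odd t h f)).trans <|
    (translate_mul odd t g h f).trans (coeFn_translateLp _ _ _ _).symm

theorem translateLp_one (odd : Bool) (t : ℝ) (f : LineModel d) : translateLp odd t 1 f = f := by
  apply Lp.ext
  refine (coeFn_translateLp _ _ _ _).trans ?_
  rw [translate_one]

/-- `translate` as a unitary operator of the Hilbert space `LineModel d`. -/
noncomputable def translateEquiv (odd : Bool) (t : ℝ) (g : SL d) : LineModel d ≃ₗᵢ[ℂ] LineModel d where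
  toFun := translateLp odd t g
  invFun := translateLp odd t g⁻¹
  left_inv f := by rw [translateLp_mul, inv_mul_cancel, translateLp_one]
  right_inv f := by rw [translateLp_mul, mul_inv_cancel, translateLp_one]
  map_add' f f' := by
    apply Lp.ext
    refine (coeFn_translateLp _ _ _ _).trans ?_
    refine (translate_congr odd t g (Lp.coeFn_add f f')).trans ?_
    refine Filter.EventuallyEq.trans ?_ (Lp.coeFn_add _ _).symm
    filter_upwards [coeFn_translateLp odd t g f, coeFn_translateLp odd t g f', ae_denom_ne g⁻¹]
      with x h1 h2 hd
    rw [Pi.add_apply, h1, h2]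
    simp only [translate_apply _ _ _ _ _ hd, Pi.add_apply, mul_add]
  map_smul' c f := by
    apply Lp.ext
    refine (coeFn_translateLp _ _ _ _).trans ?_
    refine (translate_congr odd t g (Lp.coeFn_smul c f)).trans ?_
    refine Filter.EventuallyEq.trans ?_ (Lp.coeFn_smul _ _).symm
    filter_upwards [coeFn_translateLp odd t g f, ae_denom_ne g⁻¹] with x h1 hd
    rw [Pi.smul_apply, RingHom.id_apply, h1]
    simp only [translate_apply _ _ _ _ _ hd, Pi.smul_apply, smul_eq_mul]
    ring
  norm_map' f := by
    change ‖translateLp odd t g f‖ = ‖f‖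
    rw [translateLp, Lp.norm_toLp, eLpNorm_translate, Lp.norm_def]

/-- The unitarily induced representation of `SL(n, ℝ)`, `n = d + 1`, from the character `λ_t^±`
of `P`, realized on `L²(ℝ ^ (n - 1))`: left translation of `P`-equivariant functions `F` on the
group, with norm `(∫ |F(Λ(x))|² dx) ^ (1 / 2)`. -/
noncomputable def inducedRep (d : ℕ) (odd : Bool) (t : ℝ) :
    SL d →* (LineModel d ≃ₗᵢ[ℂ] LineModel d) where
  toFun := translateEquiv odd t
  map_one' := by ext1 f; exact translateLp_one odd t f
  map_mul' g h := by ext1 f; exact (translateLp_mul odd t g h f).symm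

end Induced

section UnitaryRep

variable {d : ℕ} {H : Type*} [NormedAddCommGroup H] [InnerProductSpace ℂ H]

/-- Smooth vectors: the orbit map `g ↦ π(g) v` is of class `C^∞`. Smoothness is expressed in
exponential coordinates `x ↦ exp(∑ x_k Z_k)`; for a basis `Z` these are a chart at the identity,
and left translation by `π(g)` carries smoothness there to every point of the group. -/
def IsSmoothVector (π : SL d →* (H ≃ₗᵢ[ℂ] H)) (v : H) : Prop :=
  ∀ (N : ℕ) (Z : Fin N → sl d),
    ContDiff ℝ ∞ fun x : Fin N → ℝ => π (expSL (∑ k, x k • Z k)) v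

/-- The derived representation `dπ(X) v`, the derivative at `0` of `τ ↦ π(exp(τ X)) v`. -/
noncomputable def generator (π : SL d →* (H ≃ₗᵢ[ℂ] H)) (X : sl d) (v : H) : H :=
  deriv (fun τ : ℝ => π (expSL (τ • X)) v) 0

/-- The closure in `H × H^ι` of the graph `{(v, (dπ(Z_k) v)_k)}` of the gradient on smooth
vectors. -/
noncomputable def gradientGraph {ι : Type*} [Fintype ι] (π : SL d →* (H ≃ₗᵢ[ℂ] H)) (Z : ι → sl d) :
    Submodule ℂ (PiLp 2 fun _ : Option ι => H) :=
  (Submodule.span ℂ {w | ∃ v, IsSmoothVector π v ∧ w none = v ∧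
    ∀ k, w (some k) = generator π (Z k) v}).topologicalClosure

variable [CompleteSpace H]

/-- The bounded operator `(I - ∑ dπ(Z_k)²)⁻¹`. With `D` the closed gradient of `gradientGraph`
and `pr` the projection of its graph to `H`, it is `pr ∘ pr* = (I + D* D)⁻¹`, where `I + D* D` is a
self-adjoint operator that extends `I - ∑ dπ(Z_k)²` from smooth vectors
(see `besselInverse_apply`). For a single `Z` and for a basis `Z` of the Lie algebra this operator
on smooth vectors is essentially self-adjoint, so that `I + D* D` is its closure. -/
noncomputable def besselInverse {ι : Type*} [Fintype ι] (π : SL d →* (H ≃ₗᵢ[ℂ] H)) (Z : ι → sl d) :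
    H →L[ℂ] H :=
  let pr : gradientGraph π Z →L[ℂ] H :=
    (PiLp.proj 2 (fun _ : Option ι => H) none).comp (gradientGraph π Z).subtypeL
  haveI : CompleteSpace (gradientGraph π Z) := Submodule.topologicalClosure.completeSpace _
  pr.comp (ContinuousLinearMap.adjoint pr)

/-- `w = (I - ∑ dπ(Z_k)²) ^ (r / 2) v`, for `r ≥ 0`: `v` is the image of `w` under the power
`r / 2` of the positive injective operator `(I - ∑ dπ(Z_k)²)⁻¹`. -/
def IsBesselPower {ι : Type*} [Fintype ι] (π : SL d →* (H ≃ₗᵢ[ℂ] H)) (Z : ι → sl d)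
    (r : ℝ) (v w : H) : Prop :=
  CFC.rpow (besselInverse π Z) (r / 2) w = v

end UnitaryRep

section Facts

variable {d : ℕ} {H : Type*} [NormedAddCommGroup H] [InnerProductSpace ℂ H]

theorem IsSmoothVector.differentiableAt {π : SL d →* (H ≃ₗᵢ[ℂ] H)} {v : H}
    (hv : IsSmoothVector π v) (X : sl d) :
    DifferentiableAt ℝ (fun τ : ℝ => π (expSL (τ • X)) v) 0 := by
  have h := (hv 1 fun _ => X).comp (contDiff_pi (𝕜 := ℝ) (n := ∞) |>.2
    fun _ : Fin 1 => contDiff_id (𝕜 := ℝ) (E := ℝ))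
  have h' := h.differentiable (by simp) 0
  simpa [Function.comp_def] using h'

theorem expSL_zero : expSL (0 : sl d) = 1 := by
  apply Subtype.ext
  simp [expSL]

theorem inner_generator (π : SL d →* (H ≃ₗᵢ[ℂ] H)) (X : sl d) {v w : H}
    (hv : DifferentiableAt ℝ (fun τ : ℝ => π (expSL (τ • X)) v) 0)
    (hw : DifferentiableAt ℝ (fun τ : ℝ => π (expSL (τ • X)) w) 0) :
    inner ℂ (generator π X v) w = -inner ℂ v (generator π X w) := by
  have h := hv.hasDerivAt.inner ℂ hw.hasDerivAt
  have hc : (fun τ : ℝ => inner ℂ (π (expSL (τ • X)) v) (π (expSL (τ • X)) w))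
      = fun _ => inner ℂ v w := by
    funext τ; exact LinearIsometryEquiv.inner_map_map _ _ _
  rw [hc] at h
  have h0 := h.unique (hasDerivAt_const _ _)
  simp only [zero_smul, expSL_zero, map_one, LinearIsometryEquiv.coe_one, id_eq] at h0
  rw [generator, generator]
  linear_combination h0

variable [CompleteSpace H]

theorem besselInverse_apply {ι : Type*} [Fintype ι] (π : SL d →* (H ≃ₗᵢ[ℂ] H)) (Z : ι → sl d)
    {v : H} (hv : IsSmoothVector π v)
    (hZ : ∀ k, DifferentiableAt ℝ (fun τ : ℝ => π (expSL (τ • Z k)) (generator π (Z k) v)) 0) :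
    besselInverse π Z (v - ∑ k, generator π (Z k) (generator π (Z k) v)) = v := by
  have : CompleteSpace (gradientGraph π Z) := Submodule.topologicalClosure.completeSpace _
  set η : PiLp 2 fun _ : Option ι => H :=
    WithLp.toLp 2 (fun o => o.elim v fun k => generator π (Z k) v) with hη
  have hmem : η ∈ gradientGraph π Z :=
    Submodule.le_topologicalClosure _ (Submodule.subset_span ⟨v, hv, rfl, fun _ => rfl⟩)
  let pr : gradientGraph π Z →L[ℂ] H :=
    (PiLp.proj 2 (fun _ : Option ι => H) none).comp (gradientGraph π Z).subtypeL
  set u := v - ∑ k, generator π (Z k) (generator π (Z k) v) with hu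
  have key : ∀ w ∈ gradientGraph π Z, inner ℂ η w = inner ℂ u (w none) := by
    intro w hw
    have hcl : IsClosed {w : PiLp 2 fun _ : Option ι => H | inner ℂ η w = inner ℂ u (w none)} := by
      refine isClosed_eq (by fun_prop) ?_
      exact continuous_const.inner (PiLp.proj (𝕜 := ℂ) 2 (fun _ : Option ι => H) none).continuous
    refine closure_minimal ?_ hcl hw
    intro w hw
    induction hw using Submodule.span_induction with
    | mem w hw =>
      obtain ⟨y, hy, h0, hk⟩ := hw
      simp only [Set.mem_ofPred_eq, PiLp.inner_apply, Fintype.sum_option, h0, hk, hu, inner_sub_left,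
        sum_inner]
      simp only [hη, Option.elim]
      rw [sub_eq_add_neg, ← Finset.sum_neg_distrib]
      congr 1
      refine Finset.sum_congr rfl fun k _ => ?_
      rw [inner_generator π (Z k) (hZ k) (hy.differentiableAt _), neg_neg]
    | zero => simp
    | add a b _ _ ha hb =>
      simp only [Set.mem_ofPred_eq] at *
      rw [inner_add_right, ha, hb, PiLp.add_apply, inner_add_right]
    | smul c a _ ha =>
      simp only [Set.mem_ofPred_eq] at *
      rw [inner_smul_right, ha, PiLp.smul_apply, inner_smul_right]
  have : ContinuousLinearMap.adjoint pr u = ⟨η, hmem⟩ := by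
    refine ext_inner_right ℂ fun w => ?_
    rw [ContinuousLinearMap.adjoint_inner_left]
    exact (key w w.2).symm
  change pr (ContinuousLinearMap.adjoint pr u) = v
  rw [this]; rfl

theorem besselInverse_nonneg {ι : Type*} [Fintype ι] (π : SL d →* (H ≃ₗᵢ[ℂ] H)) (Z : ι → sl d) :
    0 ≤ besselInverse π Z := by
  have : CompleteSpace (gradientGraph π Z) := Submodule.topologicalClosure.completeSpace _
  rw [ContinuousLinearMap.nonneg_iff_isPositive]
  exact ContinuousLinearMap.isPositive_self_comp_adjoint _
end Facts

end SLRep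

/-! A Weyl element carries the root vector `v` to a multiple of the matrix unit with entry in row
`k₀ + 1` and column `0`, and the opposite vector `a` to a multiple of its transpose. The first acts
on `ℝ ^ d` by a translation, hence on the Fourier side by the multiplier `e^(-2πicξ)`, with `ξ` the
`k₀`-th frequency. The second acts as a multiple of `x_k (∑ x_j ∂_j + n/2 + it)`. On a wave `e^(iτt
log ξ) χ` the factor `x_k` produces `-tτ/(2πξ)` to leading order, and the Euler factor produces
`it(1 - τ)`. The only part of the derived representation that is quadratic in `t` is therefore a
multiple of `t² τ(1 - τ)`: the Lie algebra has order two on general waves but order one on those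
with `τ = 0` or `τ = 1`.

The equation for `f, g` reads `(e^(-2πicξ) - 1) f̂ = ĝ`. It is singular at the resonance `ξ =
e^(-b)` with `|c| = e^b`. Let `ĝ` be a smooth multiple of `e^(it(log ξ + b)) - 1`: it vanishes at
the resonance and is a difference of two waves of order one, so `‖g‖_r² ≲ |t|^(2r)`
(`exists_besselPower_coboundary`). Division by the multiplier yields `f̂ = t ∫₀¹ e^(iτt(log ξ + b))
dτ χ`, a superposition of all intermediate `τ` (`coboundary_eq`).

The function `f̂` has size about `|t|` on a layer of width about `1/|t|` around the resonance. This
gives `‖f‖² ≲ |t|`, `‖(I - a²)f‖² ≲ |t|⁹`, and, as `∫₀¹ τ(1 - τ) dτ ≠ 0`, also `‖af‖² ≳ |t|⁵`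
(`exists_le_norm_freqGenerator_solution`). These bounds force the spectral measure of `I - a²` at
`f` to have mass of order `|t|` at heights of order `t⁴`, so `‖(I - a²)^(s/2) f‖² ≳ |t|^(4s+1)` for
every `s ≥ 0` (`exists_le_moment`). The quotient of squared norms is at least a constant times
`|t|^(4s+1-2(s+σ))`, with positive exponent when `σ < s + 1/2`.

Smoothness holds because the vectors come from smooth homogeneous functions on `ℝⁿ ∖ 0`, a space
stable under the group and its Lie algebra. -/

namespace SLRep
open MeasureTheory Complex
open scoped ENNReal ContDiff Matrix NNReal SchwartzMap LineDeriv FourierTransform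

/-! ### Interpolation between powers of a positive bounded operator. -/

section Powers
variable {H : Type*} [NormedAddCommGroup H] [InnerProductSpace ℂ H] [CompleteSpace H]

/-- The spectrum may contain `0`, so the functions `x ↦ x ^ p` are continuous on it only for
nonnegative exponents. All negative powers of `B` are avoided below for this reason. -/
theorem rpow_add_of_nonneg (B : H →L[ℂ] H) {p q : ℝ} (hp : 0 ≤ p) (hq : 0 ≤ q) :
    CFC.rpow B (p + q) = CFC.rpow B p * CFC.rpow B q := by
  have h (y : ℝ) : CFC.rpow B y = cfc (fun x : ℝ≥0 => x ^ y) B := rfl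
  have hc : ∀ y : ℝ, 0 ≤ y → ContinuousOn (fun x : ℝ≥0 => x ^ y) (spectrum ℝ≥0 B) := fun y hy =>
    (NNReal.continuous_rpow_const hy).continuousOn
  rw [h, h, h, ← cfc_mul _ _ _ (hc p hp) (hc q hq)]
  refine cfc_congr fun x _ => ?_
  exact NNReal.rpow_add_of_nonneg x hp hq

theorem rpow_natCast_eq {B : H →L[ℂ] H} (hB : 0 ≤ B) (k : ℕ) : CFC.rpow B (k : ℝ) = B ^ k :=
  CFC.rpow_natCast B k hB

/-- `‖B ^ (p / 2) w‖²`. -/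
noncomputable def moment (B : H →L[ℂ] H) (w : H) (p : ℝ) : ℝ := ‖CFC.rpow B (p / 2) w‖ ^ 2

theorem moment_eq_inner (B : H →L[ℂ] H) (w : H) {p : ℝ} (hp : 0 ≤ p) :
    moment B w p = (inner ℂ (CFC.rpow B p w) w).re := by
  have hpos : 0 ≤ CFC.rpow B (p / 2) := CFC.rpow_nonneg
  have hsa : (CFC.rpow B (p / 2)).IsSymmetric :=
    ((ContinuousLinearMap.nonneg_iff_isPositive _).1 hpos).isSymmetric
  have h : CFC.rpow B p = CFC.rpow B (p / 2) * CFC.rpow B (p / 2) := by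
    rw [← rpow_add_of_nonneg B (by positivity) (by positivity)]; congr 1; ring
  rw [h, mul_apply_eq_comp]
  have := hsa (CFC.rpow B (p / 2) w) w
  change _ = inner ℂ (CFC.rpow B (p / 2) w) (CFC.rpow B (p / 2) w) at this
  rw [inner_self_eq_norm_sq_to_K] at this
  erw [this]
  rw [moment]
  norm_cast

/-- Functional calculus is monotone, so a scalar inequality between powers on `[0, ∞)` becomes an
inequality of quadratic forms at `w`. This replaces integration against the spectral measure. -/
theorem sum_moment_le (B : H →L[ℂ] H) (w : H) {κ : Type*} (I : Finset κ)
    (c : κ → ℝ≥0) (p : κ → ℝ) (hp : ∀ i ∈ I, 0 ≤ p i) {p₀ : ℝ} (hp₀ : 0 ≤ p₀)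
    (h : ∀ x : ℝ≥0, x ^ p₀ ≤ ∑ i ∈ I, c i * x ^ p i) :
    moment B w p₀ ≤ ∑ i ∈ I, c i * moment B w (p i) := by
  have hc : ∀ y : ℝ, 0 ≤ y → ContinuousOn (fun x : ℝ≥0 => x ^ y) (spectrum ℝ≥0 B) := fun y hy =>
    (NNReal.continuous_rpow_const hy).continuousOn
  have h1 : CFC.rpow B p₀ ≤ ∑ i ∈ I, (c i : ℂ) • CFC.rpow B (p i) := by
    have e : ∑ i ∈ I, (c i : ℂ) • CFC.rpow B (p i)
        = cfc (fun x : ℝ≥0 => ∑ i ∈ I, c i * x ^ p i) B := by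
      have := cfc_sum (fun i (x : ℝ≥0) => c i * x ^ p i) B I
        (fun i hi => (hc _ (hp i hi)).const_smul (c i))
      have e2 : (fun x : ℝ≥0 => ∑ i ∈ I, c i * x ^ p i) = ∑ i ∈ I, fun x : ℝ≥0 => c i * x ^ p i := by
        funext x; simp
      rw [e2, this]
      refine Finset.sum_congr rfl fun i hi => ?_
      rw [cfc_const_mul _ _ _ (hc _ (hp i hi))]
      rfl
    rw [e]
    refine cfc_mono (fun x _ => h x) (hc _ hp₀) ?_
    exact continuousOn_finsetSum _ fun i hi => (hc _ (hp i hi)).const_smul (c i)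
  have h2 := ((ContinuousLinearMap.nonneg_iff_isPositive _).1 (sub_nonneg.2 h1)).re_inner_nonneg_left w
  rw [moment_eq_inner B w hp₀]
  have e : ∑ i ∈ I, (c i : ℝ) * moment B w (p i)
      = (inner ℂ ((∑ i ∈ I, (c i : ℂ) • CFC.rpow B (p i)) w) w).re := by
    rw [sum_apply, sum_inner, Complex.re_sum]
    refine Finset.sum_congr rfl fun i hi => ?_
    rw [moment_eq_inner B w (hp i hi), smul_apply, inner_smul_left]
    simp
  rw [e]
  rw [sub_apply, inner_sub_left, map_sub, sub_nonneg] at h2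
  exact h2

theorem moment_zero {B : H →L[ℂ] H} (hB : 0 ≤ B) (w : H) : moment B w 0 = ‖w‖ ^ 2 := by
  have := rpow_natCast_eq hB 0
  rw [Nat.cast_zero] at this
  rw [moment, zero_div, this, pow_zero, one_apply_eq_self]

theorem moment_two_mul_nat {B : H →L[ℂ] H} (hB : 0 ≤ B) (w : H) (k : ℕ) :
    moment B w (2 * k) = ‖(B ^ k) w‖ ^ 2 := by
  rw [moment, mul_div_cancel_left₀ _ two_ne_zero, rpow_natCast_eq hB]

/-- Upper bound for `‖B ^ ((2k-r)/2) w‖` by the two ends of the scale. -/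
theorem moment_le_add {B : H →L[ℂ] H} (hB : 0 ≤ B) (w : H) (k : ℕ) {r T : ℝ} (hr : 0 ≤ r)
    (hrk : r ≤ 2 * k) (hT : 0 < T) :
    moment B w (2 * k - r) ≤ T ^ r * ‖(B ^ k) w‖ ^ 2 + T ^ (r - 2 * k) * ‖w‖ ^ 2 := by
  lift T to ℝ≥0 using hT.le
  have hT' : 0 < T := by exact_mod_cast hT
  have h := sum_moment_le B w (Finset.univ : Finset Bool)
    (fun b => if b then T ^ r else T ^ (r - 2 * k)) (fun b => if b then 2 * k else 0)
    (by intro b _; cases b <;> simp) (p₀ := 2 * k - r) (by linarith) ?_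
  · simpa [moment_zero hB, moment_two_mul_nat hB] using h
  · intro x
    simp only [Fintype.sum_bool, if_true]
    simp only [Bool.false_eq_true, if_false, NNReal.rpow_zero, mul_one]
    -- Split at `x = 1/T`: below it the constant term dominates, above it the factor `(xT) ^ r ≥ 1`
    -- can be inserted.
    rcases le_total (x * T) 1 with hx | hx
    · have : x ≤ T⁻¹ := by rwa [← one_div, le_div_iff₀ hT']
      calc x ^ (2 * k - r : ℝ) ≤ T⁻¹ ^ (2 * k - r : ℝ) := NNReal.rpow_le_rpow this (by linarith)
        _ = T ^ (r - 2 * k) := by rw [NNReal.inv_rpow, ← NNReal.rpow_neg]; congr 1; ring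
        _ ≤ _ := le_add_self
    · have hx0 : 0 < x := by
        rcases eq_zero_or_pos x with h | h
        · simp [h] at hx
        · exact h
      calc x ^ (2 * k - r : ℝ) = 1 * x ^ (2 * k - r : ℝ) := (one_mul _).symm
        _ ≤ (x * T) ^ r * x ^ (2 * k - r : ℝ) := by
            gcongr; exact NNReal.one_le_rpow hx hr
        _ = T ^ r * x ^ (2 * k : ℝ) := by
            rw [NNReal.mul_rpow, mul_comm (x ^ r), mul_assoc, ← NNReal.rpow_add hx0.ne']
            congr 2; ring
        _ ≤ _ := le_self_add

/-- The moment of order `2k - 1` is controlled by that of any lower order `2k - s`, up to a small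
multiple of the moments of the orders `2k - 2` and `2k`. -/
theorem moment_le_add_small {B : H →L[ℂ] H} (hB : 0 ≤ B) (w : H) (k : ℕ) (hk : 1 ≤ k) {s T ε : ℝ}
    (hs : 0 ≤ s) (hsk : s ≤ 2 * k) (hT : 0 < T) (hε : 0 < ε) (hε1 : ε ≤ 1) :
    moment B w (2 * k - 1) / T ≤ (ε ^ s * ε)⁻¹ / T ^ s * moment B w (2 * k - s)
      + ε / T ^ 2 * moment B w (2 * (k - 1 : ℕ)) + ε * ‖(B ^ k) w‖ ^ 2 := by
  lift T to ℝ≥0 using hT.le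
  lift ε to ℝ≥0 using hε.le
  have hT' : 0 < T := by exact_mod_cast hT
  have hε' : 0 < ε := by exact_mod_cast hε
  have hε1' : ε ≤ 1 := by exact_mod_cast hε1
  have hk' : (1 : ℝ) ≤ k := by exact_mod_cast hk
  have hkc : ((k - 1 : ℕ) : ℝ) = k - 1 := by rw [Nat.cast_sub hk]; simp
  have h := sum_moment_le B w (Finset.univ : Finset (Fin 3))
    ![T * ((ε ^ s * ε)⁻¹ / T ^ s), T * (ε / T ^ 2), T * ε]
    ![2 * k - s, 2 * (k - 1 : ℕ), 2 * k]
    (by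
      intro b _
      fin_cases b
      · simp; linarith
      · simp
      · simp) (p₀ := 2 * k - 1) (by linarith) ?_
  · rw [div_le_iff₀ hT]
    simp only [Fin.sum_univ_three, Matrix.cons_val_zero, Matrix.cons_val_one, Matrix.cons_val_two,
      Matrix.head_cons, Matrix.tail_cons, moment_two_mul_nat hB _ k] at h
    refine h.trans (le_of_eq ?_)
    push_cast
    ring
  · intro x
    simp only [Fin.sum_univ_three, Matrix.cons_val_zero, Matrix.cons_val_one, Matrix.cons_val_two,
      Matrix.head_cons, Matrix.tail_cons]
    rcases eq_or_ne x 0 with rfl | hx0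
    · rw [NNReal.zero_rpow (by linarith)]; exact zero_le
    have hx : 0 < x := pos_iff_ne_zero.2 hx0
    rw [hkc]
    -- With `λ = 1/x` the spectral parameter of the inverse operator, `y⁻¹ = λ/T`. Dividing by `T x
    -- ^ (2k)` leaves an inequality in `y` alone.
    set y := x * T with hy
    have hypos : 0 < y := mul_pos hx hT'
    have e : ∀ p : ℝ, x ^ (2 * k - p : ℝ) = x ^ (2 * k : ℝ) * (T ^ p / y ^ p) := by
      intro p
      rw [NNReal.rpow_sub hx0, hy, NNReal.mul_rpow]
      have h1 : x ^ p ≠ 0 := (NNReal.rpow_pos hx).ne'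
      have h2 : T ^ p ≠ 0 := (NNReal.rpow_pos hT').ne'
      field_simp
    have e2 : (2 * (k - 1) : ℝ) = 2 * k - 2 := by ring
    rw [e2, e, e s, e 2]
    have hTs : T ^ s ≠ 0 := (NNReal.rpow_pos hT').ne'
    have hys : 0 < y ^ s := NNReal.rpow_pos hypos
    -- The terms on the right dominate in turn: the second for `y ≤ ε`, the first for `ε ≤ y ≤ ε⁻¹`,
    -- the third for `y ≥ ε⁻¹`.
    have key : y⁻¹ ≤ (ε ^ s * ε)⁻¹ * (y ^ s)⁻¹ + ε * (y ^ 2)⁻¹ + ε := by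
      rcases le_total y ε with h1 | h1
      · calc y⁻¹ = y * (y ^ 2)⁻¹ := by field_simp
          _ ≤ ε * (y ^ 2)⁻¹ := by gcongr
          _ ≤ _ := by rw [add_right_comm]; exact le_add_self
      · rcases le_total y ε⁻¹ with h2 | h2
        · calc y⁻¹ ≤ ε⁻¹ := by gcongr
            _ = (ε ^ s * ε)⁻¹ * ((ε⁻¹) ^ s)⁻¹ := by
              rw [NNReal.inv_rpow, inv_inv, mul_inv]
              have : ε ^ s ≠ 0 := (NNReal.rpow_pos hε').ne'
              field_simp
            _ ≤ (ε ^ s * ε)⁻¹ * (y ^ s)⁻¹ := by gcongr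
            _ ≤ _ := by rw [add_assoc]; exact le_self_add
        · calc y⁻¹ ≤ ε := by rw [inv_le_comm₀ hypos hε']; exact h2
            _ ≤ _ := le_add_self
    calc x ^ (2 * k : ℝ) * (T ^ (1:ℝ) / y ^ (1:ℝ)) = x ^ (2 * k : ℝ) * T * y⁻¹ := by
          simp [div_eq_mul_inv, mul_assoc]
      _ ≤ x ^ (2 * k : ℝ) * T * ((ε ^ s * ε)⁻¹ * (y ^ s)⁻¹ + ε * (y ^ 2)⁻¹ + ε) := by gcongr
      _ = _ := by
          have : y ^ (2 : ℝ) = y ^ 2 := by exact_mod_cast NNReal.rpow_natCast y 2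
          have h3 : T ^ (2 : ℝ) = T ^ 2 := by exact_mod_cast NNReal.rpow_natCast T 2
          rw [this, h3]
          field_simp

end Powers

/-! ### A criterion for smooth vectors. -/

section SmoothCriterion
attribute [local instance] Matrix.linftyOpNormedRing Matrix.linftyOpNormedAlgebra

variable {d : ℕ}

theorem coe_expSL_inv (X : sl d) :
    ((expSL X)⁻¹).1 = NormedSpace.exp (-(X : Matrix (Fin (d + 1)) (Fin (d + 1)) ℝ)) := by
  have h : expSL X * expSL (-X) = 1 := by
    apply Subtype.ext
    rw [Matrix.SpecialLinearGroup.coe_mul]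
    change NormedSpace.exp (X.1) * NormedSpace.exp (-X.1) = 1
    rw [← Matrix.exp_add_of_commute _ _ (Commute.refl X.1).neg_right, add_neg_cancel,
      NormedSpace.exp_zero]
  rw [inv_eq_of_mul_eq_one_right h]
  rfl

variable {H : Type*} [NormedAddCommGroup H] [InnerProductSpace ℂ H]

/-- A map into a complex space that is linear over the reals. -/
def realLinear {M : Type*} [AddCommGroup M] [Module ℝ M] (f : M → H)
    (hadd : ∀ x y, f (x + y) = f x + f y) (hsmul : ∀ (c : ℝ) x, f (c • x) = (c : ℂ) • f x) :
    M →ₗ[ℝ] H where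
  toFun := f
  map_add' := hadd
  map_smul' := hsmul

/-- `L` is a linear approximation of second order of `g ↦ π(g) v` at the identity, as a function of
the matrix `g⁻¹ - 1`. -/
def HasOrbitExpansion (π : SL d →* (H ≃ₗᵢ[ℂ] H)) (v : H)
    (L : Matrix (Fin (d + 1)) (Fin (d + 1)) ℝ →ₗ[ℝ] H) : Prop :=
  ∃ C : ℝ, ∀ g : SL d, ‖(g⁻¹).1 - 1‖ ≤ 1 / 2 →
    ‖π g v - v - L ((g⁻¹).1 - 1)‖ ≤ C * ‖(g⁻¹).1 - 1‖ ^ 2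

/-- Translation carries the expansion from the identity to the point `γ x`: write `γ y = γ x · h`,
so that `h⁻¹ - 1 = (γ y)⁻¹ γ x - 1`. The remainder is quadratic in this matrix, which is `O(‖y -
x‖)`, and `π (γ x)` is an isometry. -/
theorem HasOrbitExpansion.hasFDerivAt {π : SL d →* (H ≃ₗᵢ[ℂ] H)} {v : H}
    {L : Matrix (Fin (d + 1)) (Fin (d + 1)) ℝ →ₗ[ℝ] H} (hL : HasOrbitExpansion π v L)
    {E : Type*} [NormedAddCommGroup E] [NormedSpace ℝ E] {γ : E → SL d} {x : E}
    {A' : E →L[ℝ] Matrix (Fin (d + 1)) (Fin (d + 1)) ℝ}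
    (hA : HasFDerivAt (fun y => ((γ y)⁻¹).1) A' x) :
    HasFDerivAt (fun y => π (γ y) v) ((π (γ x)).toContinuousLinearEquiv.toContinuousLinearMap.restrictScalars ℝ ∘L
      (LinearMap.toContinuousLinearMap L ∘L
        ((ContinuousLinearMap.mul ℝ (Matrix (Fin (d + 1)) (Fin (d + 1)) ℝ)).flip (γ x).1 ∘L A'))) x := by
  obtain ⟨C, hC⟩ := hL
  set Lc := LinearMap.toContinuousLinearMap L with hLc
  set Rm := (ContinuousLinearMap.mul ℝ (Matrix (Fin (d + 1)) (Fin (d + 1)) ℝ)).flip (γ x).1 with hRm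
  have hB : HasFDerivAt (fun y => ((γ y)⁻¹).1 * (γ x).1) (Rm ∘L A') x :=
    Rm.hasFDerivAt.comp x hA
  have hBx : ((γ x)⁻¹).1 * (γ x).1 = 1 := by
    rw [← Matrix.SpecialLinearGroup.coe_mul, inv_mul_cancel]; rfl
  have hbig : (fun y => ((γ y)⁻¹).1 * (γ x).1 - 1) =O[nhds x] fun y => y - x := by
    have := hB.isBigO_sub
    rwa [hBx] at this
  have hlim : Filter.Tendsto (fun y => ((γ y)⁻¹).1 * (γ x).1 - 1) (nhds x) (nhds 0) := by
    have := hB.continuousAt.sub (continuousAt_const (y := (1 : Matrix (Fin (d + 1)) (Fin (d + 1)) ℝ)))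
    have h2 := this.tendsto
    rw [Pi.sub_apply, hBx, sub_self] at h2
    exact h2
  have hev : ∀ᶠ y in nhds x, ‖((γ y)⁻¹).1 * (γ x).1 - 1‖ ≤ 1 / 2 := by
    have := hlim.norm
    rw [norm_zero] at this
    exact this.eventually_le_const (by norm_num)
  have h1 : (fun y => π ((γ x)⁻¹ * γ y) v - v - Lc (((γ y)⁻¹).1 * (γ x).1 - 1)) =o[nhds x]
      fun y => y - x := by
    have hO : (fun y => π ((γ x)⁻¹ * γ y) v - v - Lc (((γ y)⁻¹).1 * (γ x).1 - 1)) =O[nhds x]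
        fun y => ‖y - x‖ ^ 2 := by
      refine (Asymptotics.IsBigO.of_bound C ?_).trans (hbig.norm_norm.pow 2)
      filter_upwards [hev] with y hy
      have e : (((γ x)⁻¹ * γ y)⁻¹).1 = ((γ y)⁻¹).1 * (γ x).1 := by
        rw [mul_inv_rev, inv_inv, Matrix.SpecialLinearGroup.coe_mul]
      have := hC ((γ x)⁻¹ * γ y) (by rwa [e])
      rw [e] at this
      rw [norm_pow, norm_norm]
      exact this
    refine hO.trans_isLittleO ?_
    have := (Asymptotics.isLittleO_norm_pow_norm_pow (E' := E) (one_lt_two)).comp_tendsto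
      (k := fun y => y - x) (l' := nhds x) (by
        have : ContinuousAt (fun y => y - x) x := by fun_prop
        simpa using this.tendsto)
    simpa [Function.comp_def] using this
  have h2 : (fun y => Lc (((γ y)⁻¹).1 * (γ x).1 - 1) - Lc ((Rm ∘L A') (y - x))) =o[nhds x]
      fun y => y - x := by
    have := hasFDerivAt_iff_isLittleO.1 hB
    rw [hBx] at this
    refine ((Lc.isBigO_comp _ _).trans_isLittleO this).congr_left fun y => ?_
    exact map_sub Lc _ _
  rw [hasFDerivAt_iff_isLittleO]
  refine Asymptotics.IsLittleO.of_norm_left ?_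
  refine (h1.add h2).norm_left.congr_left fun y => ?_
  rw [← LinearIsometryEquiv.norm_map (π (γ x))]
  congr 1
  have : π (γ x) (π ((γ x)⁻¹ * γ y) v) = π (γ y) v := by
    change (π (γ x) * π ((γ x)⁻¹ * γ y)) v = _
    rw [← map_mul, mul_inv_cancel_left]
  change _ = π (γ y) v - π (γ x) v - π (γ x) (Lc ((Rm ∘L A') (y - x)))
  generalize Lc (((γ y)⁻¹).1 * (γ x).1 - 1) = p
  rw [map_add, map_sub, map_sub, map_sub, this]
  abel

/-- The minus sign appears because the expansion is in `g⁻¹`, and `exp(-τX)` has derivative `-X`. -/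
theorem HasOrbitExpansion.generator_eq {π : SL d →* (H ≃ₗᵢ[ℂ] H)} {v : H}
    {L : Matrix (Fin (d + 1)) (Fin (d + 1)) ℝ →ₗ[ℝ] H} (hL : HasOrbitExpansion π v L) (X : sl d) :
    HasDerivAt (fun τ : ℝ => π (expSL (τ • X)) v) (-L X) 0 := by
  have h0 : HasDerivAt (fun τ : ℝ => ((expSL (τ • X))⁻¹).1) (-X.1) 0 := by
    have := hasDerivAt_exp_smul_const (𝕂 := ℝ) (-X.1) (0 : ℝ)
    rw [zero_smul, NormedSpace.exp_zero, one_mul] at this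
    refine this.congr_of_eventuallyEq (Filter.Eventually.of_forall fun τ => ?_)
    simp only [coe_expSL_inv]
    rw [Submodule.coe_smul, smul_neg]
    rfl
  have h := (hL.hasFDerivAt h0.hasFDerivAt).hasDerivAt
  refine h.congr_deriv ?_
  change π (expSL ((0 : ℝ) • X)) (L ((1 : ℝ) • (-X.1) * (expSL ((0 : ℝ) • X)).1)) = _
  rw [zero_smul, expSL_zero, map_one, one_smul, Matrix.SpecialLinearGroup.coe_one, mul_one, map_neg]
  rfl

/-- The derivative of the orbit map of `v` is a sum of orbit maps of the vectors `L (E_ab)`, which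
lie in `S` again, with smooth coefficients. Hence `C^n` for all of `S` implies `C^(n+1)` for all of
`S`. -/
theorem isSmoothVector_of_orbitExpansion {π : SL d →* (H ≃ₗᵢ[ℂ] H)} {S : Set H}
    (hS : ∀ v ∈ S, ∃ L : Matrix (Fin (d + 1)) (Fin (d + 1)) ℝ →ₗ[ℝ] H,
      HasOrbitExpansion π v L ∧ ∀ A, L A ∈ S) {v : H} (hv : v ∈ S) : IsSmoothVector π v := by
  intro N Z
  let Zl :=
    LinearMap.toContinuousLinearMap (𝕜 := ℝ)
      { toFun := fun x : Fin N → ℝ => -(∑ k, x k • (Z k).1)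
        map_add' := by
          intro x y; simp only [Pi.add_apply, add_smul, Finset.sum_add_distrib, neg_add]
        map_smul' := by
          intro c x
          simp only [Pi.smul_apply, smul_eq_mul, mul_smul, ← Finset.smul_sum, smul_neg, RingHom.id_apply] }
  have hexp : ContDiff ℝ ∞ (NormedSpace.exp : Matrix (Fin (d + 1)) (Fin (d + 1)) ℝ → _) := by
    rw [contDiff_iff_contDiffAt]
    intro x
    exact (NormedSpace.exp_analytic (𝕂 := ℝ) x).contDiffAt
  have hM : ContDiff ℝ ∞ (fun x => NormedSpace.exp (Zl x)) := hexp.comp Zl.contDiff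
  have hP : ContDiff ℝ ∞ (fun x => NormedSpace.exp (-Zl x)) := hexp.comp Zl.contDiff.neg
  have hZl : ∀ x, -Zl x = (∑ k, x k • Z k : sl d).1 := by
    intro x; simp [Zl]
  have hinv : ∀ x : Fin N → ℝ, ((expSL (∑ k, x k • Z k))⁻¹).1 = NormedSpace.exp (Zl x) := by
    intro x; rw [coe_expSL_inv, ← hZl, neg_neg]
  have hcoe : ∀ x : Fin N → ℝ, (expSL (∑ k, x k • Z k)).1 = NormedSpace.exp (-Zl x) := by
    intro x; rw [hZl]; rfl
  have main : ∀ n : ℕ, ∀ v ∈ S, ContDiff ℝ n fun x : Fin N → ℝ => π (expSL (∑ k, x k • Z k)) v := by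
    intro n
    induction n with
    | zero =>
      intro v hv
      obtain ⟨L, hL, -⟩ := hS v hv
      rw [Nat.cast_zero, contDiff_zero, continuous_iff_continuousAt]
      intro x
      refine (hL.hasFDerivAt (γ := fun x : Fin N → ℝ => expSL (∑ k, x k • Z k)) (x := x)
        (A' := fderiv ℝ (fun x => NormedSpace.exp (Zl x)) x) ?_).continuousAt
      simp only [hinv]
      exact (hM.differentiable (by simp) x).hasFDerivAt
    | succ n ih =>
      intro v hv
      obtain ⟨L, hL, hLS⟩ := hS v hv
      rw [Nat.cast_add, Nat.cast_one, contDiff_succ_iff_hasFDerivAt]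
      let A := fun x : Fin N → ℝ =>
        (ContinuousLinearMap.mul ℝ (Matrix (Fin (d + 1)) (Fin (d + 1)) ℝ)).flip
          (NormedSpace.exp (-Zl x)) ∘L fderiv ℝ (fun x => NormedSpace.exp (Zl x)) x
      have hA : ContDiff ℝ n A := by
        refine ContDiff.clm_comp ?_ ?_
        · exact (ContinuousLinearMap.contDiff _).comp (hP.of_le (by exact_mod_cast le_top))
        · exact hM.fderiv_right (by exact_mod_cast le_top)
      let pr := fun a b : Fin (d + 1) =>
        LinearMap.toContinuousLinearMap (Matrix.entryLinearMap ℝ ℝ a b)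
      refine ⟨fun x => ∑ a, ∑ b, (pr a b ∘L A x).smulRight
        (π (expSL (∑ k, x k • Z k)) (L (Matrix.single a b 1))), ?_, fun x => ?_⟩
      · refine ContDiff.sum fun a _ => ContDiff.sum fun b _ => ?_
        exact (contDiff_const.clm_comp hA).smulRight (ih _ (hLS _))
      · have h := hL.hasFDerivAt (γ := fun x : Fin N → ℝ => expSL (∑ k, x k • Z k)) (x := x)
          (A' := fderiv ℝ (fun x => NormedSpace.exp (Zl x)) x) (by
            simp only [hinv]
            exact (hM.differentiable (by simp) x).hasFDerivAt)
        refine h.congr_fderiv ?_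
        ext1 k
        rw [hcoe]
        change π _ (L (A x k)) = _
        conv_lhs => rw [Matrix.matrix_eq_sum_single (A x k)]
        simp only [sum_apply, map_sum]
        refine Finset.sum_congr rfl fun a _ => Finset.sum_congr rfl fun b _ => ?_
        have e : Matrix.single a b (A x k a b) = (A x k a b) • Matrix.single a b (1 : ℝ) := by
          rw [Matrix.smul_single, smul_eq_mul, mul_one]
        rw [e, map_smul]
        exact (π _).toContinuousLinearEquiv.toContinuousLinearMap.map_smul_of_tower _ _
  exact contDiff_infty.2 fun n => main n v hv

end SmoothCriterion

/-! ### Homogeneous functions on `ℝⁿ ∖ 0` as smooth vectors. -/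

section Homogeneous

variable {d : ℕ} {odd : Bool} {t : ℝ}

/-- The factor `(λ_t^±(a) |a| ^ (n / 2))⁻¹` by which homogeneous functions transform. -/
noncomputable def homFactor (d : ℕ) (odd : Bool) (t a : ℝ) : ℂ :=
  (charValue odd t a * (modulus d a : ℂ))⁻¹

theorem norm_homFactor {a : ℝ} (ha : a ≠ 0) :
    ‖homFactor d odd t a‖ = |a| ^ (-(((d : ℝ) + 1) / 2)) := by
  have hpos : 0 < |a| := abs_pos.2 ha
  rw [homFactor, norm_inv, norm_mul, norm_charValue _ _ ha, one_mul, Complex.norm_real,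
    Real.norm_eq_abs, modulus, abs_of_pos (Real.rpow_pos_of_pos hpos _), Real.rpow_neg hpos.le]

/-- Smooth functions on `ℝⁿ ∖ 0` that are homogeneous with respect to the character of `P`. They
are the equivariant smooth functions on the group, as functions of the first column. -/
def homFun (d : ℕ) (odd : Bool) (t : ℝ) : Submodule ℂ ((Fin (d + 1) → ℝ) → ℂ) where
  carrier := {F | ContDiffOn ℝ ∞ F {0}ᶜ ∧
    ∀ a : ℝ, a ≠ 0 → ∀ y, F (a • y) = homFactor d odd t a * F y}
  zero_mem' := ⟨contDiffOn_const, by simp⟩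
  add_mem' := by
    rintro F G ⟨hF, hF'⟩ ⟨hG, hG'⟩
    refine ⟨hF.add hG, fun a ha y => ?_⟩
    rw [Pi.add_apply, hF' a ha, hG' a ha, Pi.add_apply, mul_add]
  smul_mem' := by
    rintro c F ⟨hF, hF'⟩
    refine ⟨contDiffOn_const.smul hF, fun a ha y => ?_⟩
    rw [Pi.smul_apply, hF' a ha, Pi.smul_apply, smul_eq_mul, smul_eq_mul]
    ring

theorem differentiableAt_of_mem_homFun {F : (Fin (d + 1) → ℝ) → ℂ} (hF : F ∈ homFun d odd t)
    {y : Fin (d + 1) → ℝ} (hy : y ≠ 0) : DifferentiableAt ℝ F y :=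
  (hF.1.contDiffAt (isOpen_compl_singleton.mem_nhds hy)).differentiableAt (by simp)

theorem contDiffOn_fderiv_of_mem_homFun {F : (Fin (d + 1) → ℝ) → ℂ} (hF : F ∈ homFun d odd t) :
    ContDiffOn ℝ ∞ (fderiv ℝ F) {0}ᶜ :=
  hF.1.fderiv_of_isOpen isOpen_compl_singleton (by simp)

/-- Differentiate the homogeneity relation. Scaling the direction along with the point keeps the
factor unchanged, so derivatives along linear vector fields have the same homogeneity. -/
theorem fderiv_smul_of_mem_homFun {F : (Fin (d + 1) → ℝ) → ℂ} (hF : F ∈ homFun d odd t)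
    {a : ℝ} (ha : a ≠ 0) {y : Fin (d + 1) → ℝ} (hy : y ≠ 0) (u : Fin (d + 1) → ℝ) :
    fderiv ℝ F (a • y) (a • u) = homFactor d odd t a * fderiv ℝ F y u := by
  have h1 : HasFDerivAt (fun z => F (a • z))
      ((fderiv ℝ F (a • y)) ∘L (a • ContinuousLinearMap.id ℝ (Fin (d + 1) → ℝ))) y :=
    (differentiableAt_of_mem_homFun hF (smul_ne_zero ha hy)).hasFDerivAt.comp y
      ((hasFDerivAt_id y).const_smul a)
  have h2 : HasFDerivAt (fun z => F (a • z)) (homFactor d odd t a • fderiv ℝ F y) y := by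
    have := (differentiableAt_of_mem_homFun hF hy).hasFDerivAt.const_mul (homFactor d odd t a)
    exact this.congr_of_eventuallyEq (Filter.Eventually.of_forall fun z => hF.2 a ha z)
  have := congrArg (fun L => L u) (h1.unique h2)
  simpa using this

/-- The derivative of `F` along the linear vector field of the matrix `A`. -/
noncomputable def linDeriv (A : Matrix (Fin (d + 1)) (Fin (d + 1)) ℝ)
    (F : (Fin (d + 1) → ℝ) → ℂ) : (Fin (d + 1) → ℝ) → ℂ := fun y => fderiv ℝ F y (A *ᵥ y)

theorem linDeriv_mem_homFun (A : Matrix (Fin (d + 1)) (Fin (d + 1)) ℝ)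
    {F : (Fin (d + 1) → ℝ) → ℂ} (hF : F ∈ homFun d odd t) : linDeriv A F ∈ homFun d odd t := by
  refine ⟨?_, fun a ha y => ?_⟩
  · refine (contDiffOn_fderiv_of_mem_homFun hF).clm_apply ?_
    exact (LinearMap.toContinuousLinearMap (Matrix.mulVecLin A)).contDiff.contDiffOn
  · rcases eq_or_ne y 0 with rfl | hy
    · simp [linDeriv]
    · rw [linDeriv, Matrix.mulVec_smul, fderiv_smul_of_mem_homFun hF ha hy]; rfl

theorem comp_mem_homFun (g : SL d) {F : (Fin (d + 1) → ℝ) → ℂ} (hF : F ∈ homFun d odd t) :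
    (fun y => F (g.1 *ᵥ y)) ∈ homFun d odd t := by
  refine ⟨?_, fun a ha y => ?_⟩
  · refine hF.1.comp (LinearMap.toContinuousLinearMap (Matrix.mulVecLin g.1)).contDiff.contDiffOn ?_
    intro y hy h
    apply hy
    have h' : g.1 *ᵥ y = 0 := h
    have : (g⁻¹).1 *ᵥ (g.1 *ᵥ y) = y := by
      rw [Matrix.mulVec_mulVec, ← Matrix.SpecialLinearGroup.coe_mul, inv_mul_cancel]; simp
    rw [Set.mem_singleton_iff, ← this, h', Matrix.mulVec_zero]
  · change F (g.1 *ᵥ (a • y)) = _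
    rw [Matrix.mulVec_smul, hF.2 a ha]

theorem exists_norm_smul_eq {y : Fin (d + 1) → ℝ} (hy : y ≠ 0) :
    ∃ z : Fin (d + 1) → ℝ, ‖z‖ = 1 ∧ ‖y‖ • z = y := by
  have : ‖y‖ ≠ 0 := norm_ne_zero_iff.2 hy
  exact ⟨‖y‖⁻¹ • y, by rw [norm_smul, norm_inv, norm_norm, inv_mul_cancel₀ this],
    by rw [smul_smul, mul_inv_cancel₀ this, one_smul]⟩

theorem exists_bound_of_mem_homFun {F : (Fin (d + 1) → ℝ) → ℂ} (hF : F ∈ homFun d odd t) :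
    ∃ C : ℝ, ∀ y, y ≠ 0 → ‖F y‖ ≤ C * ‖y‖ ^ (-(((d : ℝ) + 1) / 2)) := by
  have hK : IsCompact (Metric.sphere (0 : Fin (d + 1) → ℝ) 1) := isCompact_sphere _ _
  obtain ⟨C, hC⟩ := hK.exists_bound_of_continuousOn (hF.1.continuousOn.mono (by
    intro z hz h
    rw [Set.mem_singleton_iff] at h
    simp [h] at hz))
  refine ⟨C, fun y hy => ?_⟩
  obtain ⟨z, hz, hzy⟩ := exists_norm_smul_eq hy
  have hy' : ‖y‖ ≠ 0 := norm_ne_zero_iff.2 hy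
  conv_lhs => rw [← hzy, hF.2 _ hy', norm_mul, norm_homFactor hy', abs_norm]
  rw [mul_comm]
  gcongr
  exact hC z (by simpa using hz)

/-- Homogeneity reduces to `‖y‖ = 1`. Then increments of norm at most `1/2` stay in a compact
annulus away from the origin, where the second derivative is bounded. -/
theorem exists_taylor_bound_of_mem_homFun {F : (Fin (d + 1) → ℝ) → ℂ} (hF : F ∈ homFun d odd t) :
    ∃ C : ℝ, ∀ y u : Fin (d + 1) → ℝ, ∀ ε : ℝ, y ≠ 0 → ε ≤ 1 / 2 → ‖u‖ ≤ ε * ‖y‖ →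
      ‖F (y + u) - F y - fderiv ℝ F y u‖ ≤ C * ε ^ 2 * ‖y‖ ^ (-(((d : ℝ) + 1) / 2)) := by
  have hK : IsCompact (Metric.closedBall (0 : Fin (d + 1) → ℝ) (3 / 2) \ Metric.ball 0 (1 / 2)) :=
    (isCompact_closedBall _ _).diff Metric.isOpen_ball
  have hF2 := (contDiffOn_fderiv_of_mem_homFun hF).fderiv_of_isOpen (m := ∞)
    isOpen_compl_singleton (by simp)
  obtain ⟨C, hC⟩ := hK.exists_bound_of_continuousOn (hF2.continuousOn.mono (by
    intro z hz h
    rw [Set.mem_singleton_iff] at h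
    simp [h] at hz))
  have key : ∀ z u : Fin (d + 1) → ℝ, ‖z‖ = 1 → ‖u‖ ≤ 1 / 2 →
      ‖F (z + u) - F z - fderiv ℝ F z u‖ ≤ C * ‖u‖ * ‖u‖ := by
    intro z u hz hu
    have hsub : ∀ w ∈ Metric.closedBall z ‖u‖,
        w ∈ Metric.closedBall (0 : Fin (d + 1) → ℝ) (3 / 2) \ Metric.ball 0 (1 / 2) := by
      intro w hw
      rw [mem_closedBall_iff_norm] at hw
      have h1 := norm_sub_norm_le z w
      have h2 := norm_sub_norm_le w z
      rw [norm_sub_rev] at h1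
      simp only [Set.mem_sdiff, mem_closedBall_zero_iff, mem_ball_zero_iff, not_lt]
      constructor <;> linarith
    have hne : ∀ w ∈ Metric.closedBall z ‖u‖, w ≠ 0 := by
      rintro w hw rfl
      simpa using (hsub 0 hw).2
    have hconv : Convex ℝ (Metric.closedBall z ‖u‖) := convex_closedBall _ _
    have hz0 : z ∈ Metric.closedBall z ‖u‖ := Metric.mem_closedBall_self (norm_nonneg _)
    have h1 : ∀ w ∈ Metric.closedBall z ‖u‖, ‖fderiv ℝ F w - fderiv ℝ F z‖ ≤ C * ‖u‖ := by
      intro w hw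
      have hC0 : 0 ≤ C := (norm_nonneg _).trans (hC w (hsub w hw))
      refine (hconv.norm_image_sub_le_of_norm_fderiv_le (f := fderiv ℝ F) (fun x hx => ?_)
        (fun x hx => hC x (hsub x hx)) hz0 hw).trans ?_
      · exact ((contDiffOn_fderiv_of_mem_homFun hF).contDiffAt
          (isOpen_compl_singleton.mem_nhds (hne x hx))).differentiableAt (by simp)
      · gcongr
        rwa [mem_closedBall_iff_norm] at hw
    have h2 := hconv.norm_image_sub_le_of_norm_hasFDerivWithin_le' (f := F) (f' := fderiv ℝ F)
      (φ := fderiv ℝ F z) (fun x hx =>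
        (differentiableAt_of_mem_homFun hF (hne x hx)).hasFDerivAt.hasFDerivWithinAt) h1 hz0
      (y := z + u) (by simp)
    simpa using h2
  refine ⟨|C|, fun y u ε hy hε hu => ?_⟩
  obtain ⟨z, hz, hzy⟩ := exists_norm_smul_eq hy
  have hy' : ‖y‖ ≠ 0 := norm_ne_zero_iff.2 hy
  have hypos : 0 < ‖y‖ := norm_pos_iff.2 hy
  have hz0 : z ≠ 0 := by rintro rfl; simp at hz
  set w := ‖y‖⁻¹ • u with hw
  have hwu : ‖y‖ • w = u := by rw [hw, smul_smul, mul_inv_cancel₀ hy', one_smul]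
  have hwn : ‖w‖ ≤ ε := by
    rw [hw, norm_smul, norm_inv, norm_norm, inv_mul_le_iff₀ hypos, mul_comm]; exact hu
  have e : F (y + u) - F y - fderiv ℝ F y u
      = homFactor d odd t ‖y‖ * (F (z + w) - F z - fderiv ℝ F z w) := by
    conv_lhs => rw [← hzy, ← hwu]
    rw [← smul_add, hF.2 _ hy', hF.2 _ hy',
      fderiv_smul_of_mem_homFun hF hy' hz0]
    ring
  rw [e, norm_mul, norm_homFactor hy', abs_norm, mul_comm]
  gcongr
  refine (key z w hz (hwn.trans hε)).trans ?_
  rw [mul_assoc, ← sq]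
  gcongr
  exact le_abs_self C

/-- The first column `(1, x)` of `Λ(x)`. -/
def column (x : Fin d → ℝ) : Fin (d + 1) → ℝ := Fin.cons 1 x

theorem column_ne_zero (x : Fin d → ℝ) : column x ≠ 0 := by
  intro h
  simpa [column] using congrFun h 0

theorem continuous_column : Continuous (column : (Fin d → ℝ) → _) :=
  continuous_pi fun i => by
    refine Fin.cases ?_ (fun j => ?_) i
    · simp only [column, Fin.cons_zero]; fun_prop
    · simp only [column, Fin.cons_succ]; fun_prop

theorem mulVec_column (g : SL d) (x : Fin d → ℝ) (i : Fin (d + 1)) :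
    (g.1 *ᵥ column x) i = (g * lowerUnipotent x) i 0 := by
  rw [mul_lowerUnipotent_col, Matrix.mulVec, dotProduct, Fin.sum_univ_succ]
  simp [column]

theorem mulVec_column_eq_smul (g : SL d) (x : Fin d → ℝ) (hx : denom g x ≠ 0) :
    g.1 *ᵥ column x = denom g x • column (moved g x) := by
  funext i
  rw [mulVec_column]
  refine Fin.cases ?_ (fun j => ?_) i
  · simp [column, denom]
  · simp only [column, Pi.smul_apply, Fin.cons_succ, moved, smul_eq_mul]
    field_simp

theorem one_add_norm_le_norm_column (x : Fin d → ℝ) : 1 + ‖x‖ ≤ 2 * ‖column x‖ := by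
  have h1 : 1 ≤ ‖column x‖ := by simpa [column] using norm_le_pi_norm (column x) 0
  have h2 : ‖x‖ ≤ ‖column x‖ := (pi_norm_le_iff_of_nonneg (norm_nonneg _)).2 fun i => by
    simpa [column] using norm_le_pi_norm (column x) i.succ
  linarith

/-- The square is comparable to `(1 + ‖x‖) ^ (-(d + 1))`, whose exponent exceeds the dimension `d`.
This function is the common majorant of all homogeneous functions on the cell. -/
theorem memLp_norm_column_rpow :
    MemLp (fun x : Fin d → ℝ => ‖column x‖ ^ (-(((d : ℝ) + 1) / 2))) 2 volume := by
  have hpos : ∀ x : Fin d → ℝ, 0 < ‖column x‖ := fun x => norm_pos_iff.2 (column_ne_zero x)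
  have hc : Continuous fun x : Fin d → ℝ => ‖column x‖ ^ (-(((d : ℝ) + 1) / 2)) :=
    continuous_column.norm.rpow_const fun x => Or.inl (hpos x).ne'
  rw [memLp_two_iff_integrable_sq hc.aestronglyMeasurable]
  have hi : Integrable (fun x : Fin d → ℝ => (1 + ‖x‖) ^ (-((d : ℝ) + 1))) volume :=
    integrable_one_add_norm (by simp)
  refine (hi.const_mul (2 ^ ((d : ℝ) + 1))).mono' (hc.pow 2).aestronglyMeasurable ?_
  refine Filter.Eventually.of_forall fun x => ?_
  have e : (‖column x‖ ^ (-(((d : ℝ) + 1) / 2))) ^ 2 = ‖column x‖ ^ (-((d : ℝ) + 1)) := by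
    rw [← Real.rpow_natCast, ← Real.rpow_mul (hpos x).le]; congr 1; push_cast; ring
  rw [e, Real.norm_of_nonneg (Real.rpow_nonneg (hpos x).le _)]
  have h2 : (1 + ‖x‖) / 2 ≤ ‖column x‖ := by linarith [one_add_norm_le_norm_column x]
  calc ‖column x‖ ^ (-((d : ℝ) + 1)) ≤ ((1 + ‖x‖) / 2) ^ (-((d : ℝ) + 1)) :=
        Real.rpow_le_rpow_of_nonpos (by positivity) h2 (by linarith [(Nat.cast_nonneg d : (0:ℝ) ≤ d)])
    _ = _ := by
        rw [Real.div_rpow (by positivity) (by norm_num), Real.rpow_neg (x := 2) (by norm_num),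
          div_inv_eq_mul, mul_comm]

theorem continuous_comp_column {F : (Fin (d + 1) → ℝ) → ℂ} (hF : F ∈ homFun d odd t) :
    Continuous fun x => F (column x) :=
  hF.1.continuousOn.comp_continuous continuous_column fun x => column_ne_zero x

theorem memLp_comp_column {F : (Fin (d + 1) → ℝ) → ℂ} (hF : F ∈ homFun d odd t) :
    MemLp (fun x => F (column x)) 2 (volume : Measure (Fin d → ℝ)) := by
  obtain ⟨C, hC⟩ := exists_bound_of_mem_homFun hF
  refine (memLp_norm_column_rpow.const_mul C).mono'
    (continuous_comp_column hF).aestronglyMeasurable ?_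
  exact Filter.Eventually.of_forall fun x => hC _ (column_ne_zero x)

/-- The restriction of a homogeneous function to the open cell, as a vector of `LineModel d`. -/
noncomputable def lineVec : homFun d odd t →ₗ[ℂ] LineModel d where
  toFun F := (memLp_comp_column F.2).toLp _
  map_add' F G := (MemLp.toLp_add (memLp_comp_column F.2) (memLp_comp_column G.2))
  map_smul' c F := (MemLp.toLp_const_smul c (memLp_comp_column F.2))

theorem coeFn_lineVec (F : homFun d odd t) :
    lineVec F =ᵐ[volume] fun x => F.1 (column x) := MemLp.coeFn_toLp (memLp_comp_column F.2)

theorem norm_lineVec_le (F : homFun d odd t) {C : ℝ}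
    (hC : ∀ x : Fin d → ℝ, ‖F.1 (column x)‖ ≤ C * ‖column x‖ ^ (-(((d : ℝ) + 1) / 2))) :
    ‖lineVec F‖ ≤ C * ‖(memLp_norm_column_rpow (d := d)).toLp _‖ := by
  refine Lp.norm_le_mul_norm_of_ae_le_mul ?_
  filter_upwards [coeFn_lineVec F, (memLp_norm_column_rpow (d := d)).coeFn_toLp] with x h1 h2
  rw [h1, h2, Real.norm_of_nonneg (by positivity)]
  exact hC x

/-- Homogeneity of `F` absorbs the multiplier of the representation, so on `ℝⁿ ∖ 0` the group acts
by plain linear substitution. -/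
theorem inducedRep_lineVec (g : SL d) (F : homFun d odd t) :
    inducedRep d odd t g (lineVec F) = lineVec ⟨_, comp_mem_homFun g⁻¹ F.2⟩ := by
  apply Lp.ext
  refine (coeFn_translateLp odd t g _).trans ?_
  refine (translate_congr odd t g (coeFn_lineVec F)).trans ?_
  refine Filter.EventuallyEq.trans ?_ (coeFn_lineVec _).symm
  filter_upwards [ae_denom_ne g⁻¹] with x hx
  rw [translate_apply _ _ _ _ _ hx]
  rw [mulVec_column_eq_smul _ _ hx, F.2.2 _ hx]
  rfl

/-- The linear map `A ↦ (x ↦ dF(y)(A y))`, `y = (1, x)`. -/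
noncomputable def lineDeriv (F : homFun d odd t) :=
  realLinear (H := LineModel d) (M := Matrix (Fin (d + 1)) (Fin (d + 1)) ℝ)
    (fun A => lineVec ⟨linDeriv A F.1, linDeriv_mem_homFun A F.2⟩)
    (fun A B => by
      rw [← map_add]
      congr 1
      apply Subtype.ext
      funext y
      simp [linDeriv, Matrix.add_mulVec])
    (fun c A => by
      rw [← map_smul]
      congr 1
      apply Subtype.ext
      funext y
      simp [linDeriv, Matrix.smul_mulVec])

section
attribute [local instance] Matrix.linftyOpNormedRing Matrix.linftyOpNormedAlgebra

/-- Apply the Taylor bound at `y = (1, x)` with increment `A y`, where `‖A y‖ ≤ ‖A‖ ‖y‖`. The error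
is pointwise at most a multiple of `‖A‖²` times a fixed `L²` function. -/
theorem hasOrbitExpansion_lineVec (F : homFun d odd t) :
    HasOrbitExpansion (inducedRep d odd t) (lineVec F) (lineDeriv F) := by
  obtain ⟨C, hC⟩ := exists_taylor_bound_of_mem_homFun F.2
  refine ⟨C * ‖(memLp_norm_column_rpow (d := d)).toLp _‖, fun g hg => ?_⟩
  set A := (g⁻¹).1 - 1 with hA
  have e : inducedRep d odd t g (lineVec F) - lineVec F - lineDeriv F A
      = lineVec (⟨_, comp_mem_homFun g⁻¹ F.2⟩ - F - ⟨linDeriv A F.1, linDeriv_mem_homFun A F.2⟩) := by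
    rw [inducedRep_lineVec, map_sub lineVec, map_sub lineVec]; rfl
  rw [e, mul_right_comm]
  refine norm_lineVec_le _ fun x => ?_
  have h := hC (column x) (A *ᵥ column x) ‖A‖ (column_ne_zero x) hg
    (Matrix.linfty_opNorm_mulVec _ _)
  have e2 : column x + A *ᵥ column x = (g⁻¹).1 *ᵥ column x := by
    rw [hA, Matrix.sub_mulVec, Matrix.one_mulVec, add_sub_cancel]
  rw [e2] at h
  exact h

end

theorem isSmoothVector_lineVec (F : homFun d odd t) :
    IsSmoothVector (inducedRep d odd t) (lineVec F) := by
  refine isSmoothVector_of_orbitExpansion (S := Set.range (lineVec (d := d) (odd := odd) (t := t)))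
    ?_ ⟨F, rfl⟩
  rintro _ ⟨G, rfl⟩
  exact ⟨lineDeriv G, hasOrbitExpansion_lineVec G, fun A => ⟨_, rfl⟩⟩

theorem generator_lineVec (X : sl d) (F : homFun d odd t) :
    generator (inducedRep d odd t) X (lineVec F)
      = -lineVec ⟨linDeriv X.1 F.1, linDeriv_mem_homFun X.1 F.2⟩ :=
  ((hasOrbitExpansion_lineVec F).generator_eq X).deriv

theorem besselInverse_lineVec {ι : Type*} [Fintype ι] (Z : ι → sl d) (F : homFun d odd t) :
    besselInverse (inducedRep d odd t) Z (lineVec F - ∑ k, generator (inducedRep d odd t) (Z k)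
      (generator (inducedRep d odd t) (Z k) (lineVec F))) = lineVec F := by
  refine besselInverse_apply _ Z (isSmoothVector_lineVec F) fun k => ?_
  rw [generator_lineVec, ← map_neg]
  exact (isSmoothVector_lineVec _).differentiableAt _

end Homogeneous

/-! ### Powers with a sign character. -/

section SignedPower

/-- `ε(a) |a| ^ c`, with `ε = sgn` if `odd` is true and `ε = 1` otherwise. -/
noncomputable def signedPow (odd : Bool) (c : ℂ) (a : ℝ) : ℂ :=
  ((if odd then Real.sign a else 1 : ℝ) : ℂ) * ((|a| : ℝ) : ℂ) ^ c

theorem signedPow_one (odd : Bool) (c : ℂ) : signedPow odd c 1 = 1 := by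
  simp [signedPow]

theorem signedPow_mul (odd : Bool) (c : ℂ) (a b : ℝ) :
    signedPow odd c (a * b) = signedPow odd c a * signedPow odd c b := by
  have h1 := charValue_mul odd 0 a b
  simp only [charValue, Complex.ofReal_zero, zero_mul, Complex.cpow_zero, mul_one] at h1
  rw [signedPow, signedPow, signedPow, h1, abs_mul, Complex.ofReal_mul,
    Complex.mul_cpow_ofReal_nonneg (abs_nonneg _) (abs_nonneg _)]
  ring

theorem signedPow_of_pos (odd : Bool) (c : ℂ) {a : ℝ} (ha : 0 < a) :
    signedPow odd c a = (a : ℂ) ^ c := by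
  simp [signedPow, abs_of_pos ha, Real.sign_of_pos ha]

theorem signedPow_neg (odd : Bool) (c : ℂ) (a : ℝ) :
    signedPow odd c (-a) = (if odd then -1 else 1) * signedPow odd c a := by
  cases odd <;> simp [signedPow, Real.sign_neg]

theorem norm_signedPow_le (odd : Bool) (c : ℂ) {a : ℝ} (ha : a ≠ 0) :
    ‖signedPow odd c a‖ = |a| ^ c.re := by
  have hp := abs_pos.2 ha
  rw [signedPow, norm_mul, Complex.norm_cpow_eq_rpow_re_of_pos hp]
  have : ‖((if odd then Real.sign a else 1 : ℝ) : ℂ)‖ = 1 := by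
    rcases lt_or_gt_of_ne ha with h | h
    · cases odd <;> simp [Real.sign_of_neg h]
    · cases odd <;> simp [Real.sign_of_pos h]
  rw [this, one_mul]

/-- As `a = sgn(a) |a|`, each division lowers the exponent by one and switches the parity. Signed
powers are therefore closed under differentiation up to scalars. -/
theorem signedPow_div (odd : Bool) (c : ℂ) {a : ℝ} (ha : a ≠ 0) :
    signedPow odd c a / a = signedPow (!odd) (c - 1) a := by
  have hp : ((|a| : ℝ) : ℂ) ≠ 0 := by exact_mod_cast (abs_pos.2 ha).ne'
  have ha' : (a : ℂ) ≠ 0 := by exact_mod_cast ha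
  rw [signedPow, signedPow, Complex.cpow_sub _ _ hp, Complex.cpow_one]
  have e : (a : ℂ) = (Real.sign a : ℂ) * ((|a| : ℝ) : ℂ) := by
    rw [← Complex.ofReal_mul]
    congr 1
    rcases lt_or_gt_of_ne ha with h | h
    · rw [Real.sign_of_neg h, abs_of_neg h]; ring
    · rw [Real.sign_of_pos h, abs_of_pos h]; ring
  have hs : (Real.sign a : ℂ) * (Real.sign a : ℂ) = 1 := by
    rcases lt_or_gt_of_ne ha with h | h
    · simp [Real.sign_of_neg h]
    · simp [Real.sign_of_pos h]
  have hs0 : (Real.sign a : ℂ) ≠ 0 := left_ne_zero_of_mul_eq_one hs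
  conv_lhs => rw [e]
  cases odd
  · simp only [Bool.false_eq_true, if_false, Bool.not_false, if_true]
    field_simp
    rw [sq, hs]; simp
  · simp only [if_true, Bool.not_true, Bool.false_eq_true, if_false]
    field_simp
    simp

theorem hasDerivAt_signedPow (odd : Bool) (c : ℂ) {a : ℝ} (ha : a ≠ 0) :
    HasDerivAt (signedPow odd c) (c * signedPow (!odd) (c - 1) a) a := by
  have pos : ∀ {b : ℝ}, 0 < b → HasDerivAt (signedPow odd c) (c * signedPow (!odd) (c - 1) b) b := by
    intro b hb
    rw [signedPow_of_pos _ _ hb]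
    rcases eq_or_ne c 0 with rfl | hc
    · rw [zero_mul]
      refine (hasDerivAt_const b (1 : ℂ)).congr_of_eventuallyEq ?_
      filter_upwards [lt_mem_nhds hb] with x hx
      rw [signedPow_of_pos _ _ hx, Complex.cpow_zero]
    · have h := hasDerivAt_ofReal_cpow_const hb.ne' hc
      refine (h.congr_of_eventuallyEq ?_)
      filter_upwards [lt_mem_nhds hb] with x hx
      rw [signedPow_of_pos _ _ hx]
  rcases lt_or_gt_of_ne ha with h | h
  · have h1 := (pos (neg_pos.2 h)).scomp a (hasDerivAt_neg a)
    have h2 := h1.const_mul (if odd then -1 else 1 : ℂ)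
    refine (h2.congr_of_eventuallyEq (Filter.Eventually.of_forall fun x => ?_)).congr_deriv ?_
    · simp only [Function.comp_apply]
      rw [← signedPow_neg, neg_neg]
    · rw [signedPow_neg]
      cases odd <;> simp
  · exact pos h

end SignedPower


/-! ### Schwartz functions on the open cell and the derived representation. -/

section Schwartz

variable {d : ℕ}

/-- The `k`-th coordinate vector of `ℝ ^ d`. -/
noncomputable abbrev coordVec (k : Fin d) : EuclideanSpace ℝ (Fin d) := EuclideanSpace.single k 1

/-- Multiplication by the `k`-th coordinate. -/
noncomputable def mulCoord (k : Fin d) :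
    𝓢(EuclideanSpace ℝ (Fin d), ℂ) →ₗ[ℂ] 𝓢(EuclideanSpace ℝ (Fin d), ℂ) :=
  (SchwartzMap.smulLeftCLM ℂ fun x : EuclideanSpace ℝ (Fin d) => ((x k : ℝ) : ℂ)).toLinearMap

/-- The `k`-th partial derivative. -/
noncomputable def partialDeriv (k : Fin d) :
    𝓢(EuclideanSpace ℝ (Fin d), ℂ) →ₗ[ℂ] 𝓢(EuclideanSpace ℝ (Fin d), ℂ) :=
  (LineDeriv.lineDerivOpCLM ℂ 𝓢(EuclideanSpace ℝ (Fin d), ℂ) (coordVec k)).toLinearMap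

theorem hasTemperateGrowth_coord (k : Fin d) :
    (fun x : EuclideanSpace ℝ (Fin d) => ((x k : ℝ) : ℂ)).HasTemperateGrowth :=
  (Complex.ofRealCLM ∘L (EuclideanSpace.proj k : EuclideanSpace ℝ (Fin d) →L[ℝ] ℝ)).hasTemperateGrowth

theorem mulCoord_apply (k : Fin d) (f : 𝓢(EuclideanSpace ℝ (Fin d), ℂ))
    (x : EuclideanSpace ℝ (Fin d)) : mulCoord k f x = (x k : ℂ) * f x :=
  SchwartzMap.smulLeftCLM_apply_apply (hasTemperateGrowth_coord k) f x

theorem partialDeriv_apply (k : Fin d) (f : 𝓢(EuclideanSpace ℝ (Fin d), ℂ))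
    (x : EuclideanSpace ℝ (Fin d)) : partialDeriv k f x = fderiv ℝ f x (coordVec k) := rfl

theorem fderiv_eq_sum_partialDeriv (f : 𝓢(EuclideanSpace ℝ (Fin d), ℂ))
    (x u : EuclideanSpace ℝ (Fin d)) :
    fderiv ℝ f x u = ∑ k, (u k : ℂ) * partialDeriv k f x := by
  have hu : u = ∑ k, u k • coordVec k := by
    ext i
    simp [coordVec, Finset.sum_apply, Pi.single_apply]
  conv_lhs => rw [hu]
  rw [map_sum]
  refine Finset.sum_congr rfl fun k _ => ?_
  rw [map_smul, partialDeriv_apply, Complex.real_smul]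

/-- `∑ x_k ∂_k + c`. -/
noncomputable def eulerOp (c : ℂ) :
    𝓢(EuclideanSpace ℝ (Fin d), ℂ) →ₗ[ℂ] 𝓢(EuclideanSpace ℝ (Fin d), ℂ) :=
  ∑ k, mulCoord k ∘ₗ partialDeriv k + c • LinearMap.id

theorem eulerOp_apply (c : ℂ) (f : 𝓢(EuclideanSpace ℝ (Fin d), ℂ))
    (x : EuclideanSpace ℝ (Fin d)) :
    eulerOp c f x = ∑ k, (x k : ℂ) * partialDeriv k f x + c * f x := by
  simp only [eulerOp, LinearMap.add_apply, LinearMap.sum_apply, LinearMap.comp_apply,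
    LinearMap.smul_apply, LinearMap.id_apply, add_apply, sum_apply,
    smul_apply, mulCoord_apply, smul_eq_mul]

/-- The homogeneous function `y ↦ ε(y₀) |y₀| ^ c f(y' / y₀)`, extended by zero to `y₀ = 0`. -/
noncomputable def homExt (odd : Bool) (c : ℂ) (f : 𝓢(EuclideanSpace ℝ (Fin d), ℂ))
    (y : Fin (d + 1) → ℝ) : ℂ :=
  if y 0 = 0 then 0 else signedPow odd c (y 0) * f (WithLp.toLp 2 fun i => y i.succ / y 0)

theorem homExt_smul (odd : Bool) (c : ℂ) (f : 𝓢(EuclideanSpace ℝ (Fin d), ℂ)) {a : ℝ} (ha : a ≠ 0)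
    (y : Fin (d + 1) → ℝ) : homExt odd c f (a • y) = signedPow odd c a * homExt odd c f y := by
  simp only [homExt, Pi.smul_apply, smul_eq_mul, mul_eq_zero, ha, false_or]
  split_ifs with h
  · simp
  · rw [signedPow_mul, mul_assoc]
    simp only [mul_div_mul_left _ _ ha]

theorem homExt_column (odd : Bool) (c : ℂ) (f : 𝓢(EuclideanSpace ℝ (Fin d), ℂ)) (x : Fin d → ℝ) :
    homExt odd c f (column x) = f (WithLp.toLp 2 x) := by
  simp [homExt, column, signedPow_one]

/-- The derivative of `homExt odd c f`. -/
noncomputable def homExtDeriv (odd : Bool) (c : ℂ) (f : 𝓢(EuclideanSpace ℝ (Fin d), ℂ))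
    (y : Fin (d + 1) → ℝ) : (Fin (d + 1) → ℝ) →L[ℝ] ℂ :=
  (ContinuousLinearMap.proj (R := ℝ) (φ := fun _ : Fin (d + 1) => ℝ) 0).smulRight
      (homExt (!odd) (c - 1) (-eulerOp (-c) f) y)
    + ∑ k, (ContinuousLinearMap.proj (R := ℝ) (φ := fun _ : Fin (d + 1) => ℝ) k.succ).smulRight
      (homExt (!odd) (c - 1) (partialDeriv k f) y)

/-- By the chain rule the coefficients of the derivative are again extensions of Schwartz functions,
of degree `c - 1` and opposite parity. This closure drives the induction on smoothness. -/
theorem hasFDerivAt_homExt_of_ne (odd : Bool) (c : ℂ) (f : 𝓢(EuclideanSpace ℝ (Fin d), ℂ))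
    {y : Fin (d + 1) → ℝ} (hy : y 0 ≠ 0) :
    HasFDerivAt (homExt odd c f) (homExtDeriv odd c f y) y := by
  have hp (j : Fin (d + 1)) : HasFDerivAt (fun z : Fin (d + 1) → ℝ => z j)
      (ContinuousLinearMap.proj (R := ℝ) (φ := fun _ : Fin (d + 1) => ℝ) j) y :=
    (ContinuousLinearMap.proj (R := ℝ) (φ := fun _ : Fin (d + 1) => ℝ) j).hasFDerivAt
  have h1 := (hasDerivAt_signedPow odd c hy).hasFDerivAt.comp y (hp 0)
  have h2 : HasFDerivAt (fun z : Fin (d + 1) → ℝ => fun i : Fin d => z i.succ / z 0)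
      (ContinuousLinearMap.pi fun i : Fin d =>
        (y 0)⁻¹ • ContinuousLinearMap.proj (R := ℝ) (φ := fun _ : Fin (d + 1) => ℝ) i.succ
        + (-(y i.succ / y 0 ^ 2)) • ContinuousLinearMap.proj (R := ℝ) (φ := fun _ : Fin (d + 1) => ℝ) 0) y := by
    rw [hasFDerivAt_pi]
    intro i
    have := (hp i.succ).mul ((hasDerivAt_inv hy).comp_hasFDerivAt y (hp 0))
    refine (this.congr_of_eventuallyEq
      (Filter.Eventually.of_forall fun z => div_eq_mul_inv _ _)).congr_fderiv ?_
    ext u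
    simp
    ring
  have h3 := ((PiLp.continuousLinearEquiv 2 ℝ (fun _ : Fin d => ℝ)).symm.hasFDerivAt).comp y h2
  have h4 := (f.differentiableAt (x := WithLp.toLp 2 fun i => y i.succ / y 0)).hasFDerivAt.comp y h3
  have h5 := h1.mul h4
  have hne : ∀ᶠ z : Fin (d + 1) → ℝ in nhds y, z 0 ≠ 0 :=
    (continuous_apply 0).continuousAt.eventually_ne hy
  refine (h5.congr_of_eventuallyEq ?_).congr_fderiv ?_
  · filter_upwards [hne] with z hz
    rw [homExt, if_neg hz]
    rfl
  · ext u
    have e : ((PiLp.continuousLinearEquiv 2 ℝ (fun _ : Fin d => ℝ)).symm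
        ((ContinuousLinearMap.pi fun i : Fin d =>
        (y 0)⁻¹ • ContinuousLinearMap.proj (R := ℝ) (φ := fun _ : Fin (d + 1) => ℝ) i.succ
        + (-(y i.succ / y 0 ^ 2)) • ContinuousLinearMap.proj (R := ℝ) (φ := fun _ : Fin (d + 1) => ℝ) 0) u))
        = WithLp.toLp 2 fun i : Fin d => (u i.succ - y i.succ / y 0 * u 0) / y 0 := by
      ext i
      simp
      field_simp
      ring
    have hy' : (y 0 : ℂ) ≠ 0 := by exact_mod_cast hy
    simp only [homExtDeriv, homExt, if_neg hy, add_apply, smul_apply, ContinuousLinearMap.comp_apply,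
      ContinuousLinearMap.smulRight_apply, ContinuousLinearMap.proj_apply, sum_apply]
    erw [e]
    rw [fderiv_eq_sum_partialDeriv]
    simp only [← signedPow_div _ _ hy, neg_apply, eulerOp_apply, Function.comp_apply]
    simp only [ContinuousLinearMap.toSpanSingleton_apply, smul_eq_mul, Complex.real_smul]
    change _ + f (WithLp.toLp 2 fun i : Fin d => y i.succ / y 0) * _ = _
    generalize signedPow odd c (y 0) = p
    generalize (WithLp.toLp 2 fun i : Fin d => y i.succ / y 0) = q
    have e2 : ∑ k, (((u k.succ - y k.succ / y 0 * u 0) / y 0 : ℝ) : ℂ) * partialDeriv k f q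
        = (y 0 : ℂ)⁻¹ * ∑ k, (u k.succ : ℂ) * partialDeriv k f q
          - (y 0 : ℂ)⁻¹ * u 0 * ∑ k, ((y k.succ / y 0 : ℝ) : ℂ) * partialDeriv k f q := by
      rw [Finset.mul_sum, Finset.mul_sum, ← Finset.sum_sub_distrib]
      refine Finset.sum_congr rfl fun k _ => ?_
      push_cast
      ring
    have e3 : ∑ k, (u k.succ : ℂ) * (p / y 0 * partialDeriv k f q)
        = p / y 0 * ∑ k, (u k.succ : ℂ) * partialDeriv k f q := by
      rw [Finset.mul_sum]
      exact Finset.sum_congr rfl fun k _ => by ring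
    rw [e2, e3]
    ring

/-- As `y 0` tends to `0` away from the origin, the argument `y'/y₀` goes to infinity at rate at
least `r/|y₀|`, and the rapid decay of `f` beats any power of `|y₀|`. -/
theorem exists_bound_homExt (odd : Bool) (c : ℂ) (f : 𝓢(EuclideanSpace ℝ (Fin d), ℂ)) {r : ℝ}
    (hr : 0 < r) : ∃ C : ℝ, ∀ y : Fin (d + 1) → ℝ, ∀ i : Fin d, |y 0| ≤ 1 → r ≤ |y i.succ| →
      ‖homExt odd c f y‖ ≤ C * |y 0| ^ 2 := by
  -- Decay of order `N` compensates `|y₀| ^ Re c` and leaves at least the square of `|y₀|`.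
  obtain ⟨N, hN⟩ := exists_nat_ge (2 - c.re)
  obtain ⟨C, hC0, hC⟩ := f.decay N 0
  refine ⟨C / r ^ N, fun y i h1 hi => ?_⟩
  rcases eq_or_ne (y 0) 0 with h0 | h0
  · simp [homExt, h0]
  have hp : 0 < |y 0| := abs_pos.2 h0
  rw [homExt, if_neg h0, norm_mul, norm_signedPow_le _ _ h0]
  set x : EuclideanSpace ℝ (Fin d) := WithLp.toLp 2 fun i => y i.succ / y 0 with hx
  have hxn : r / |y 0| ≤ ‖x‖ := by
    have := PiLp.norm_apply_le x i
    rw [hx, Real.norm_eq_abs] at this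
    simp only [abs_div] at this
    refine le_trans ?_ this
    gcongr
  have h2 := hC x
  rw [norm_iteratedFDeriv_zero] at h2
  have h3 : ‖f x‖ ≤ C / r ^ N * |y 0| ^ N := by
    have : (r / |y 0|) ^ N * ‖f x‖ ≤ C := le_trans (by gcongr) h2
    rw [div_pow, div_mul_eq_mul_div, div_le_iff₀ (by positivity)] at this
    rw [div_mul_eq_mul_div, le_div_iff₀ (by positivity)]
    linarith
  calc |y 0| ^ c.re * ‖f x‖ ≤ |y 0| ^ c.re * (C / r ^ N * |y 0| ^ N) := by gcongr
    _ = C / r ^ N * |y 0| ^ (c.re + N) := by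
        rw [Real.rpow_add hp, Real.rpow_natCast]; ring
    _ ≤ C / r ^ N * |y 0| ^ (2 : ℝ) := by
        have hle : |y 0| ^ (c.re + N) ≤ |y 0| ^ (2 : ℝ) :=
          Real.rpow_le_rpow_of_exponent_ge hp h1 (by linarith)
        gcongr
    _ = _ := by rw [Real.rpow_two]

/-- On the hyperplane `y 0 = 0` the formula for the derivative gives `0` by the default value of
`homExt`, and the quadratic bound nearby confirms it. -/
theorem hasFDerivAt_homExt (odd : Bool) (c : ℂ) (f : 𝓢(EuclideanSpace ℝ (Fin d), ℂ))
    {y : Fin (d + 1) → ℝ} (hy : y ≠ 0) :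
    HasFDerivAt (homExt odd c f) (homExtDeriv odd c f y) y := by
  rcases ne_or_eq (y 0) 0 with h0 | h0
  · exact hasFDerivAt_homExt_of_ne odd c f h0
  obtain ⟨i, hi⟩ : ∃ i : Fin d, y i.succ ≠ 0 := by
    by_contra hcon
    push Not at hcon
    exact hy (funext fun j => Fin.cases h0 hcon j)
  have hd : homExtDeriv odd c f y = 0 := by
    ext u
    simp [homExtDeriv, homExt, h0]
  have hr : 0 < |y i.succ| / 2 := by positivity
  obtain ⟨C, hC⟩ := exists_bound_homExt odd c f hr
  rw [hd, hasFDerivAt_iff_isLittleO]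
  have hO : (fun z => homExt odd c f z) =O[nhds y] fun z => ‖z - y‖ ^ 2 := by
    refine Asymptotics.IsBigO.of_bound |C| ?_
    have e1 : ∀ᶠ z : Fin (d + 1) → ℝ in nhds y, |z 0| < 1 :=
      (continuous_apply 0).abs.continuousAt.eventually_lt_const (by simp [h0])
    have e2 : ∀ᶠ z : Fin (d + 1) → ℝ in nhds y, |y i.succ| / 2 < |z i.succ| :=
      (continuous_apply i.succ).abs.continuousAt.eventually_const_lt (by
        have := abs_pos.2 hi; linarith)
    filter_upwards [e1, e2] with z h1 h2
    refine (hC z i h1.le h2.le).trans ?_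
    have h3 : |z 0| ≤ ‖z - y‖ := by
      have := norm_le_pi_norm (z - y) 0
      rwa [Pi.sub_apply, h0, sub_zero, Real.norm_eq_abs] at this
    rw [norm_pow, norm_norm]
    calc C * |z 0| ^ 2 ≤ |C| * |z 0| ^ 2 := by gcongr; exact le_abs_self C
      _ ≤ _ := by gcongr
  have h4 : (fun z : Fin (d + 1) → ℝ => ‖z - y‖ ^ 2) =o[nhds y] fun z => z - y := by
    have := (Asymptotics.isLittleO_norm_pow_norm_pow (E' := Fin (d + 1) → ℝ)
      (one_lt_two)).comp_tendsto (k := fun z => z - y) (l' := nhds y) (by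
        have : ContinuousAt (fun z => z - y) y := by fun_prop
        simpa using this.tendsto)
    simpa [Function.comp_def] using this
  refine (hO.trans_isLittleO h4).congr_left fun z => ?_
  simp [homExt, h0]

theorem contDiffAt_homExt (odd : Bool) (c : ℂ) (f : 𝓢(EuclideanSpace ℝ (Fin d), ℂ))
    {y : Fin (d + 1) → ℝ} (hy : y ≠ 0) : ContDiffAt ℝ ∞ (homExt odd c f) y := by
  rw [contDiffAt_infty]
  intro n
  induction n generalizing odd c f with
  | zero =>
    rw [Nat.cast_zero, contDiffAt_zero]
    refine ⟨{0}ᶜ, isOpen_compl_singleton.mem_nhds hy, fun z hz => ?_⟩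
    exact (hasFDerivAt_homExt odd c f hz).continuousAt.continuousWithinAt
  | succ n ih =>
    rw [Nat.cast_add, Nat.cast_one, contDiffAt_succ_iff_hasFDerivAt]
    refine ⟨homExtDeriv odd c f, ⟨{0}ᶜ, isOpen_compl_singleton.mem_nhds hy, fun z hz =>
      hasFDerivAt_homExt odd c f hz⟩, ?_⟩
    unfold homExtDeriv
    refine ContDiffAt.add (contDiffAt_const.smulRight (ih _ _ _)) ?_
    exact ContDiffAt.sum fun k _ => contDiffAt_const.smulRight (ih _ _ _)

/-- The exponent `-(n / 2 + i t)`, `n = d + 1`. -/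
noncomputable def homExponent (d : ℕ) (t : ℝ) : ℂ := -((((d : ℝ) + 1) / 2 : ℝ) + t * I)

theorem signedPow_homExponent (odd : Bool) (t : ℝ) {a : ℝ} (ha : a ≠ 0) :
    signedPow odd (homExponent d t) a = homFactor d odd t a := by
  have hp : 0 < |a| := abs_pos.2 ha
  have hp' : ((|a| : ℝ) : ℂ) ≠ 0 := by exact_mod_cast hp.ne'
  rw [homFactor, charValue, modulus, signedPow, homExponent, Complex.cpow_neg, Complex.cpow_add _ _ hp',
    Complex.ofReal_cpow hp.le, mul_inv, mul_inv, mul_inv]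
  have : ((if odd then Real.sign a else 1 : ℝ) : ℂ)⁻¹ = ((if odd then Real.sign a else 1 : ℝ) : ℂ) := by
    rcases lt_or_gt_of_ne ha with h | h
    · cases odd <;> simp [Real.sign_of_neg h]
    · cases odd <;> simp [Real.sign_of_pos h]
  rw [this]
  ring

theorem homExt_mem_homFun (odd : Bool) (t : ℝ) (f : 𝓢(EuclideanSpace ℝ (Fin d), ℂ)) :
    homExt odd (homExponent d t) f ∈ homFun d odd t :=
  ⟨fun y hy => (contDiffAt_homExt odd _ f hy).contDiffWithinAt, fun a ha y => by
    rw [homExt_smul _ _ _ ha, signedPow_homExponent _ _ ha]⟩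

/-- A Schwartz function on `ℝ ^ d` as an element of the space of the induced representation. -/
noncomputable def schwartzVec (odd : Bool) (t : ℝ) (f : 𝓢(EuclideanSpace ℝ (Fin d), ℂ)) :
    LineModel d := lineVec ⟨homExt odd (homExponent d t) f, homExt_mem_homFun odd t f⟩

theorem coeFn_schwartzVec (odd : Bool) (t : ℝ) (f : 𝓢(EuclideanSpace ℝ (Fin d), ℂ)) :
    schwartzVec odd t f =ᵐ[volume] fun x => f (WithLp.toLp 2 x) := by
  filter_upwards [coeFn_lineVec ⟨_, homExt_mem_homFun odd t f⟩] with x hx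
  rw [schwartzVec, hx, homExt_column]

/-- The derived representation on Schwartz functions. -/
noncomputable def schwartzGenerator (t : ℝ) (X : Matrix (Fin (d + 1)) (Fin (d + 1)) ℝ) :
    𝓢(EuclideanSpace ℝ (Fin d), ℂ) →ₗ[ℂ] 𝓢(EuclideanSpace ℝ (Fin d), ℂ) :=
  (X 0 0 : ℂ) • eulerOp (-homExponent d t)
    + ∑ k, (X 0 k.succ : ℂ) • (mulCoord k ∘ₗ eulerOp (-homExponent d t))
    - ∑ i, (X i.succ 0 : ℂ) • partialDeriv i
    - ∑ i, ∑ k, (X i.succ k.succ : ℂ) • (mulCoord k ∘ₗ partialDeriv i)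

/-- Differentiate the homogeneous extension at `(1, x)` in the direction `-X (1, x)`. The top row of
`X` meets `-(∑ x_j ∂_j + n/2 + it)`, the lower rows meet the `∂_i`. -/
theorem generator_schwartzVec (odd : Bool) (t : ℝ) (X : sl d)
    (f : 𝓢(EuclideanSpace ℝ (Fin d), ℂ)) :
    generator (inducedRep d odd t) X (schwartzVec odd t f)
      = schwartzVec odd t (schwartzGenerator t X.1 f) := by
  rw [schwartzVec, generator_lineVec, ← map_neg]
  apply Lp.ext
  filter_upwards [coeFn_lineVec (-⟨linDeriv X.1 (homExt odd (homExponent d t) f),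
      linDeriv_mem_homFun X.1 (homExt_mem_homFun odd t f)⟩ : homFun d odd t),
    coeFn_schwartzVec odd t (schwartzGenerator t X.1 f)] with x h1 h2
  rw [h1, h2]
  change -(fderiv ℝ (homExt odd (homExponent d t) f) (column x) (X.1 *ᵥ column x)) = _
  rw [(hasFDerivAt_homExt odd _ f (column_ne_zero x)).fderiv]
  have hcol : ∀ i : Fin (d + 1), (X.1 *ᵥ column x) i = X.1 i 0 + ∑ k : Fin d, X.1 i k.succ * x k := by
    intro i
    rw [Matrix.mulVec, dotProduct, Fin.sum_univ_succ]
    simp [column]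
  simp only [homExtDeriv, add_apply, sum_apply, ContinuousLinearMap.smulRight_apply,
    ContinuousLinearMap.proj_apply, homExt_column, hcol, schwartzGenerator, LinearMap.add_apply,
    LinearMap.sub_apply, LinearMap.sum_apply, LinearMap.smul_apply, LinearMap.comp_apply,
    sub_apply, smul_apply, neg_apply, mulCoord_apply, smul_eq_mul, Complex.real_smul]
  push_cast
  generalize eulerOp (-homExponent d t) f (WithLp.toLp 2 x) = R
  simp only [add_mul, Finset.sum_add_distrib, Finset.sum_mul]
  simp only [mul_neg, Finset.sum_neg_distrib, mul_assoc]
  ring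

end Schwartz

/-! ### The representation on the Fourier side. -/

section Fourier

variable {d : ℕ}

/-- The operator that corresponds to multiplication by the `k`-th coordinate under the inverse
Fourier transform. -/
noncomputable def freqCoord (k : Fin d) :
    𝓢(EuclideanSpace ℝ (Fin d), ℂ) →ₗ[ℂ] 𝓢(EuclideanSpace ℝ (Fin d), ℂ) :=
  (I / (2 * Real.pi)) • partialDeriv k

/-- The operator that corresponds to the `k`-th partial derivative under the inverse Fourier
transform. -/
noncomputable def freqDeriv (k : Fin d) :
    𝓢(EuclideanSpace ℝ (Fin d), ℂ) →ₗ[ℂ] 𝓢(EuclideanSpace ℝ (Fin d), ℂ) :=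
  (2 * Real.pi * I) • mulCoord k

/-- The operator that corresponds to `eulerOp c` under the inverse Fourier transform. -/
noncomputable def freqEuler (c : ℂ) :
    𝓢(EuclideanSpace ℝ (Fin d), ℂ) →ₗ[ℂ] 𝓢(EuclideanSpace ℝ (Fin d), ℂ) :=
  ∑ k, freqCoord k ∘ₗ freqDeriv k + c • LinearMap.id

theorem smulLeftCLM_inner_apply (k : Fin d) (f : 𝓢(EuclideanSpace ℝ (Fin d), ℂ)) :
    SchwartzMap.smulLeftCLM ℂ (inner ℝ · (coordVec k)) f = mulCoord k f := by
  have h : (inner ℝ · (coordVec k) : EuclideanSpace ℝ (Fin d) → ℝ).HasTemperateGrowth := by fun_prop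
  ext x
  rw [SchwartzMap.smulLeftCLM_apply_apply h, mulCoord_apply, Complex.real_smul]
  congr 2
  simp [coordVec, EuclideanSpace.inner_single_right]

theorem mulCoord_fourierInv (k : Fin d) (ψ : 𝓢(EuclideanSpace ℝ (Fin d), ℂ)) :
    mulCoord k (𝓕⁻ ψ) = 𝓕⁻ (freqCoord k ψ) := by
  have h := SchwartzMap.fourierInv_lineDerivOp_eq ψ (coordVec k)
  rw [smulLeftCLM_inner_apply] at h
  have e : freqCoord k ψ = (I / (2 * Real.pi)) • (∂_{coordVec k} ψ) := rfl
  rw [e, FourierTransform.fourierInv_smul, h, smul_smul]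
  have : I / (2 * Real.pi) * -(2 * Real.pi * I) = 1 := by
    have hpi : (Real.pi : ℂ) ≠ 0 := by exact_mod_cast Real.pi_ne_zero
    field_simp
    rw [I_sq, neg_neg]
  rw [this, one_smul]

theorem partialDeriv_fourierInv (k : Fin d) (ψ : 𝓢(EuclideanSpace ℝ (Fin d), ℂ)) :
    partialDeriv k (𝓕⁻ ψ) = 𝓕⁻ (freqDeriv k ψ) := by
  have h := SchwartzMap.lineDerivOp_fourierInv_eq ψ (coordVec k)
  rw [smulLeftCLM_inner_apply] at h
  exact h

theorem eulerOp_fourierInv (c : ℂ) (ψ : 𝓢(EuclideanSpace ℝ (Fin d), ℂ)) :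
    eulerOp c (𝓕⁻ ψ) = 𝓕⁻ (freqEuler c ψ) := by
  simp only [eulerOp, freqEuler, LinearMap.add_apply, LinearMap.sum_apply, LinearMap.comp_apply,
    LinearMap.smul_apply, LinearMap.id_apply, partialDeriv_fourierInv, mulCoord_fourierInv,
    FourierTransform.fourierInv_add, FourierTransform.fourierInv_sum, FourierTransform.fourierInv_smul]

/-- The derived representation on the Fourier side. -/
noncomputable def freqGenerator (t : ℝ) (X : Matrix (Fin (d + 1)) (Fin (d + 1)) ℝ) :
    𝓢(EuclideanSpace ℝ (Fin d), ℂ) →ₗ[ℂ] 𝓢(EuclideanSpace ℝ (Fin d), ℂ) :=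
  (X 0 0 : ℂ) • freqEuler (-homExponent d t)
    + ∑ k, (X 0 k.succ : ℂ) • (freqCoord k ∘ₗ freqEuler (-homExponent d t))
    - ∑ i, (X i.succ 0 : ℂ) • freqDeriv i
    - ∑ i, ∑ k, (X i.succ k.succ : ℂ) • (freqCoord k ∘ₗ freqDeriv i)

theorem schwartzGenerator_fourierInv (t : ℝ) (X : Matrix (Fin (d + 1)) (Fin (d + 1)) ℝ)
    (ψ : 𝓢(EuclideanSpace ℝ (Fin d), ℂ)) :
    schwartzGenerator t X (𝓕⁻ ψ) = 𝓕⁻ (freqGenerator t X ψ) := by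
  simp only [schwartzGenerator, freqGenerator, LinearMap.add_apply, LinearMap.neg_apply,
    LinearMap.sum_apply, LinearMap.comp_apply, LinearMap.smul_apply, partialDeriv_fourierInv,
    mulCoord_fourierInv, eulerOp_fourierInv, sub_eq_add_neg, FourierTransform.fourierInv_neg,
    FourierTransform.fourierInv_add, FourierTransform.fourierInv_sum, FourierTransform.fourierInv_smul]

/-- The vector of the induced representation with Fourier transform `ψ`. -/
noncomputable def fourierVec (odd : Bool) (t : ℝ) :
    𝓢(EuclideanSpace ℝ (Fin d), ℂ) →ₗ[ℂ] LineModel d where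
  toFun ψ := schwartzVec odd t (𝓕⁻ ψ)
  map_add' ψ φ := by
    apply Lp.ext
    refine Filter.EventuallyEq.trans ?_ (Lp.coeFn_add _ _).symm
    filter_upwards [coeFn_schwartzVec odd t (𝓕⁻ (ψ + φ)), coeFn_schwartzVec odd t (𝓕⁻ ψ),
      coeFn_schwartzVec odd t (𝓕⁻ φ)] with x h1 h2 h3
    rw [Pi.add_apply, h1, h2, h3, FourierTransform.fourierInv_add, add_apply]
  map_smul' c ψ := by
    apply Lp.ext
    refine Filter.EventuallyEq.trans ?_ (Lp.coeFn_smul _ _).symm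
    filter_upwards [coeFn_schwartzVec odd t (𝓕⁻ (c • ψ)), coeFn_schwartzVec odd t (𝓕⁻ ψ)]
      with x h1 h2
    rw [Pi.smul_apply, h1, RingHom.id_apply, h2, FourierTransform.fourierInv_smul, smul_apply]

theorem fourierVec_eq_lineVec (odd : Bool) (t : ℝ) (ψ : 𝓢(EuclideanSpace ℝ (Fin d), ℂ)) :
    ∃ F : homFun d odd t, fourierVec odd t ψ = lineVec F := ⟨_, rfl⟩

theorem coeFn_fourierVec (odd : Bool) (t : ℝ) (ψ : 𝓢(EuclideanSpace ℝ (Fin d), ℂ)) :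
    fourierVec odd t ψ =ᵐ[volume] fun x => (𝓕⁻ ψ) (WithLp.toLp 2 x) := coeFn_schwartzVec odd t _

theorem generator_fourierVec (odd : Bool) (t : ℝ) (X : sl d)
    (ψ : 𝓢(EuclideanSpace ℝ (Fin d), ℂ)) :
    generator (inducedRep d odd t) X (fourierVec odd t ψ)
      = fourierVec odd t (freqGenerator t X.1 ψ) := by
  change generator _ _ (schwartzVec odd t (𝓕⁻ ψ)) = schwartzVec odd t _
  rw [generator_schwartzVec, schwartzGenerator_fourierInv]

/-- Plancherel, after passing from `Fin d → ℝ` to the Euclidean space by a volume-preserving map. -/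
theorem norm_fourierVec (odd : Bool) (t : ℝ) (ψ : 𝓢(EuclideanSpace ℝ (Fin d), ℂ)) :
    ‖fourierVec odd t ψ‖ = ‖ψ.toLp 2‖ := by
  have h1 : ‖fourierVec odd t ψ‖ = ‖(𝓕⁻ ψ).toLp 2‖ := by
    rw [SchwartzMap.norm_toLp, Lp.norm_def, eLpNorm_congr_ae (coeFn_fourierVec odd t ψ)]
    congr 1
    exact eLpNorm_comp_measurePreserving (g := (𝓕⁻ ψ : 𝓢(EuclideanSpace ℝ (Fin d), ℂ)))
      (SchwartzMap.continuous _).aestronglyMeasurable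
      (EuclideanSpace.volume_preserving_symm_measurableEquiv_toLp (Fin d)).symm
  rw [h1, ← SchwartzMap.norm_fourier_toL2_eq, FourierTransform.fourier_fourierInv_eq]

theorem norm_fourierVec_sq (odd : Bool) (t : ℝ) (ψ : 𝓢(EuclideanSpace ℝ (Fin d), ℂ)) :
    ‖fourierVec odd t ψ‖ ^ 2 = ∫ x : Fin d → ℝ, ‖ψ (WithLp.toLp 2 x)‖ ^ 2 := by
  rw [norm_fourierVec, SchwartzMap.norm_toLp' (by simp) (by simp)]
  have h0 : 0 ≤ ∫ x, ‖ψ x‖ ^ (2 : ℝ) := integral_nonneg fun x => by positivity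
  rw [← Real.rpow_natCast, ENNReal.toReal_ofNat, ← Real.rpow_mul h0]
  norm_num
  exact ((EuclideanSpace.volume_preserving_symm_measurableEquiv_toLp (Fin d)).symm.integral_comp'
    (g := fun x => ‖ψ x‖ ^ 2)).symm

theorem expSL_of_sq_eq_zero {X : sl d} (hX : X.1 * X.1 = 0) : (expSL X).1 = 1 + X.1 := by
  change NormedSpace.exp X.1 = _
  rw [NormedSpace.exp_eq_tsum ℝ]
  have h : ∀ n : ℕ, X.1 ^ (n + 2) = 0 := fun n => by rw [pow_add, sq, hX, mul_zero]
  simp only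
  rw [tsum_eq_sum (s := Finset.range 2)]
  · simp [Finset.sum_range_succ]
  · intro n hn
    obtain ⟨m, rfl⟩ : ∃ m, n = m + 2 := ⟨n - 2, by simp at hn; omega⟩
    rw [h, smul_zero]

/-- A lower unipotent element acts on the Fourier side by a multiplication operator. -/
theorem inducedRep_expSL_fourierVec (odd : Bool) (t c : ℝ) (k : Fin d) {X : sl d}
    (hX : X.1 = c • Matrix.single k.succ 0 1)
    {ψ φ : 𝓢(EuclideanSpace ℝ (Fin d), ℂ)}
    (hφ : ∀ ξ, φ ξ = Complex.exp (-(2 * Real.pi * c * ξ k * I)) * ψ ξ) :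
    inducedRep d odd t (expSL X) (fourierVec odd t ψ) = fourierVec odd t φ := by
  have hinv : ((expSL X)⁻¹).1 = 1 - X.1 := by
    have h : expSL X * expSL (-X) = 1 := by
      apply Subtype.ext
      rw [Matrix.SpecialLinearGroup.coe_mul]
      change NormedSpace.exp (X.1) * NormedSpace.exp (-X.1) = 1
      rw [← Matrix.exp_add_of_commute _ _ (Commute.refl X.1).neg_right, add_neg_cancel,
        NormedSpace.exp_zero]
    rw [inv_eq_of_mul_eq_one_right h, expSL_of_sq_eq_zero]
    · rw [sub_eq_add_neg]; rfl
    · change -X.1 * -X.1 = 0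
      rw [hX]
      simp [Matrix.single_mul_single_of_ne, (Fin.succ_ne_zero k).symm]
  apply Lp.ext
  refine (coeFn_translateLp odd t _ _).trans ?_
  refine (translate_congr odd t _ (coeFn_fourierVec odd t ψ)).trans ?_
  refine Filter.EventuallyEq.trans ?_ (coeFn_fourierVec odd t φ).symm
  refine Filter.Eventually.of_forall fun x => ?_
  have hcol (i : Fin (d + 1)) : ((expSL X)⁻¹ * lowerUnipotent x) i 0
      = column x i - (if i = k.succ then c else 0) := by
    rw [← mulVec_column, hinv, Matrix.sub_mulVec, Matrix.one_mulVec, hX, Pi.sub_apply,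
      Matrix.smul_mulVec, Pi.smul_apply, Matrix.single_mulVec]
    simp [column, Function.update_apply]
  have hd : denom (expSL X)⁻¹ x = 1 := by
    rw [denom, hcol, if_neg (Fin.succ_ne_zero k).symm]
    simp [column]
  rw [translate_apply _ _ _ _ _ (by rw [hd]; exact one_ne_zero), hd]
  have hm : WithLp.toLp 2 (moved (expSL X)⁻¹ x) = WithLp.toLp 2 x - c • coordVec k := by
    ext i
    simp only [moved, hd, hcol, column, Fin.cons_succ, Fin.succ_inj, div_one]
    simp [coordVec]
  have h1 : (charValue odd t 1 * (modulus d 1 : ℂ))⁻¹ = 1 := by simp [charValue, modulus]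
  change _ = (𝓕⁻ φ) (WithLp.toLp 2 x)
  rw [h1, one_mul, hm, SchwartzMap.fourierInv_coe, SchwartzMap.fourierInv_coe, Real.fourierInv_eq,
    Real.fourierInv_eq]
  refine integral_congr_ae (Filter.Eventually.of_forall fun ξ => ?_)
  simp only [hφ, inner_sub_right, Circle.smul_def, Real.fourierChar_apply, smul_eq_mul]
  rw [← mul_assoc, ← Complex.exp_add]
  congr 2
  simp only [inner_smul_right, coordVec, EuclideanSpace.inner_single_right]
  push_cast
  simp
  ring

end Fourier

/-! ### Waves whose phase is a function of the logarithm of one frequency. -/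

section PositiveFrequency

variable {d : ℕ}

/-- Smooth functions with compact support in the half space `0 < ξ k₀`. -/
def posFreq (k₀ : Fin d) : Submodule ℂ 𝓢(EuclideanSpace ℝ (Fin d), ℂ) where
  carrier := {ψ | HasCompactSupport ψ ∧ tsupport ψ ⊆ {ξ | 0 < ξ k₀}}
  zero_mem' := by
    have h : tsupport ((0 : 𝓢(EuclideanSpace ℝ (Fin d), ℂ)) : EuclideanSpace ℝ (Fin d) → ℂ) = ∅ :=
      tsupport_eq_empty_iff.2 rfl
    exact ⟨by rw [HasCompactSupport, h]; exact isCompact_empty, by rw [h]; exact Set.empty_subset _⟩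
  add_mem' {ψ φ} hψ hφ :=
    ⟨hψ.1.add hφ.1, (tsupport_add ψ φ).trans (Set.union_subset hψ.2 hφ.2)⟩
  smul_mem' c ψ hψ :=
    ⟨hψ.1.smul_left (f := fun _ => c), (tsupport_smul_subset_right (fun _ => c) ψ).trans hψ.2⟩

theorem mem_posFreq_of_tsupport_subset {k₀ : Fin d} {ψ φ : 𝓢(EuclideanSpace ℝ (Fin d), ℂ)}
    (hψ : ψ ∈ posFreq k₀) (h : tsupport φ ⊆ tsupport ψ) : φ ∈ posFreq k₀ :=
  ⟨hψ.1.of_isClosed_subset (isClosed_tsupport _) h, h.trans hψ.2⟩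

theorem freqCoord_mem {k₀ : Fin d} (k : Fin d) {ψ : 𝓢(EuclideanSpace ℝ (Fin d), ℂ)}
    (hψ : ψ ∈ posFreq k₀) : freqCoord k ψ ∈ posFreq k₀ :=
  Submodule.smul_mem _ _ (mem_posFreq_of_tsupport_subset hψ
    (SchwartzMap.tsupport_lineDerivOp_subset (coordVec k) ψ))

theorem freqDeriv_mem {k₀ : Fin d} (k : Fin d) {ψ : 𝓢(EuclideanSpace ℝ (Fin d), ℂ)}
    (hψ : ψ ∈ posFreq k₀) : freqDeriv k ψ ∈ posFreq k₀ :=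
  Submodule.smul_mem _ _ (mem_posFreq_of_tsupport_subset hψ
    ((SchwartzMap.tsupport_smulLeftCLM_subset _ ψ).trans Set.inter_subset_left))

theorem freqEuler_mem {k₀ : Fin d} (c : ℂ) {ψ : 𝓢(EuclideanSpace ℝ (Fin d), ℂ)}
    (hψ : ψ ∈ posFreq k₀) : freqEuler c ψ ∈ posFreq k₀ := by
  simp only [freqEuler, LinearMap.add_apply, LinearMap.sum_apply, LinearMap.comp_apply,
    LinearMap.smul_apply, LinearMap.id_apply]
  exact Submodule.add_mem _ (Submodule.sum_mem _ fun k _ => freqCoord_mem k (freqDeriv_mem k hψ))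
    (Submodule.smul_mem _ _ hψ)

/-- Functions on the line that are smooth on the positive half line. -/
abbrev SmoothPos : Type := {m : ℝ → ℂ // ContDiffOn ℝ ∞ m (Set.Ioi 0)}

/-- Nothing is known about `m` on the nonpositive half line, but the product vanishes near every
point outside the support of `ψ`. -/
theorem contDiff_radial_mul {k₀ : Fin d} (m : SmoothPos) (ψ : posFreq k₀) :
    ContDiff ℝ ∞ fun ξ : EuclideanSpace ℝ (Fin d) => m.1 (ξ k₀) * ψ.1 ξ := by
  refine contDiff_iff_contDiffAt.2 fun ξ => ?_
  by_cases hξ : ξ ∈ tsupport fun ξ : EuclideanSpace ℝ (Fin d) => m.1 (ξ k₀) * ψ.1 ξ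
  swap
  · exact contDiffAt_const.congr_of_eventuallyEq (notMem_tsupport_iff_eventuallyEq.1 hξ)
  have hpos : 0 < ξ k₀ := ψ.2.2 (tsupport_mul_subset_right hξ)
  have h1 : ContDiffAt ℝ ∞ m.1 (ξ k₀) := m.2.contDiffAt (isOpen_Ioi.mem_nhds hpos)
  have h2 : ContDiffAt ℝ ∞ (fun ξ : EuclideanSpace ℝ (Fin d) => ξ k₀) ξ :=
    (EuclideanSpace.proj k₀ : EuclideanSpace ℝ (Fin d) →L[ℝ] ℝ).contDiff.contDiffAt
  exact (h1.comp ξ h2).mul ψ.1.smooth'.contDiffAt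

/-- The product of `ψ` by a function of the coordinate `ξ k₀`. -/
noncomputable def radialMul {k₀ : Fin d} (m : SmoothPos) (ψ : posFreq k₀) : posFreq k₀ :=
  ⟨HasCompactSupport.toSchwartzMap (f := fun ξ : EuclideanSpace ℝ (Fin d) => m.1 (ξ k₀) * ψ.1 ξ)
      (ψ.2.1.mul_left) (contDiff_radial_mul m ψ),
    mem_posFreq_of_tsupport_subset ψ.2 tsupport_mul_subset_right⟩

theorem radialMul_apply {k₀ : Fin d} (m : SmoothPos) (ψ : posFreq k₀)
    (ξ : EuclideanSpace ℝ (Fin d)) : (radialMul m ψ).1 ξ = m.1 (ξ k₀) * ψ.1 ξ := rfl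

theorem eq_zero_of_nonpos {k₀ : Fin d} (ψ : posFreq k₀) {ξ : EuclideanSpace ℝ (Fin d)}
    (h : ¬ 0 < ξ k₀) : ψ.1 ξ = 0 := by
  by_contra hne
  exact h (ψ.2.2 (subset_tsupport _ hne))

theorem freqDeriv_radialMul {k₀ : Fin d} (k : Fin d) (m : SmoothPos) (ψ : posFreq k₀) :
    freqDeriv k (radialMul m ψ).1 = (radialMul m ⟨freqDeriv k ψ.1, freqDeriv_mem k ψ.2⟩).1 := by
  ext ξ
  simp only [freqDeriv, LinearMap.smul_apply, smul_apply, mulCoord_apply, radialMul_apply, smul_eq_mul]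
  ring

theorem freqCoord_radialMul {k₀ : Fin d} (k : Fin d) (m m' : SmoothPos)
    (hm : ∀ r, 0 < r → HasDerivAt m.1 (m'.1 r) r) (ψ : posFreq k₀) :
    freqCoord k (radialMul m ψ).1 = (radialMul m ⟨freqCoord k ψ.1, freqCoord_mem k ψ.2⟩).1
      + (if k = k₀ then I / (2 * Real.pi) else 0) • (radialMul m' ψ).1 := by
  ext ξ
  simp only [freqCoord, LinearMap.smul_apply, smul_apply, add_apply, radialMul_apply, smul_eq_mul]
  rw [partialDeriv_apply, partialDeriv_apply]
  by_cases hξ : ξ ∈ tsupport ψ.1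
  · have hpos : 0 < ξ k₀ := ψ.2.2 hξ
    have h2 : HasFDerivAt (fun ξ : EuclideanSpace ℝ (Fin d) => ξ k₀)
        (EuclideanSpace.proj k₀ : EuclideanSpace ℝ (Fin d) →L[ℝ] ℝ) ξ :=
      (EuclideanSpace.proj k₀ : EuclideanSpace ℝ (Fin d) →L[ℝ] ℝ).hasFDerivAt
    have h3 := ((hm _ hpos).hasFDerivAt.comp ξ h2).mul (ψ.1.differentiableAt (x := ξ)).hasFDerivAt
    have h4 : fderiv ℝ (radialMul m ψ).1 ξ = _ := h3.fderiv
    rw [h4]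
    simp only [add_apply, smul_apply, ContinuousLinearMap.comp_apply, Function.comp_apply,
      ContinuousLinearMap.toSpanSingleton_apply, smul_eq_mul, Complex.real_smul]
    have h5 : (EuclideanSpace.proj k₀ : EuclideanSpace ℝ (Fin d) →L[ℝ] ℝ) (coordVec k)
        = if k = k₀ then 1 else 0 := by
      simp [coordVec, eq_comm]
    rw [h5]
    split_ifs
    · push_cast; ring
    · push_cast; ring
  · have h1 : ψ.1 ξ = 0 := image_eq_zero_of_notMem_tsupport hξ
    have h2 : ξ ∉ tsupport (radialMul m ψ).1 := fun h => hξ (tsupport_mul_subset_right h)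
    have h3 : fderiv ℝ ψ.1 ξ = 0 := by
      by_contra hne; exact hξ (support_fderiv_subset ℝ hne)
    have h4 : fderiv ℝ (radialMul m ψ).1 ξ = 0 := by
      by_contra hne; exact h2 (support_fderiv_subset ℝ hne)
    rw [h3, h4, h1]
    simp

/-- Division by the coordinate `ξ k₀`. -/
noncomputable def divFreq {k₀ : Fin d} (ψ : posFreq k₀) : posFreq k₀ :=
  radialMul ⟨fun r => ((r⁻¹ : ℝ) : ℂ), by
    refine Complex.ofRealCLM.contDiff.comp_contDiffOn (contDiffOn_id.inv fun r hr => ?_)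
    exact (Set.mem_Ioi.1 hr).ne'⟩ ψ

/-- A family of functions `J_q` that depends linearly on the polynomial `q`, with
`J_q' = i J_{X q}`. -/
structure PhaseFamily where
  toFun : Polynomial ℂ →ₗ[ℂ] (ℝ → ℂ)
  hasDerivAt' : ∀ q z, HasDerivAt (toFun q) (I * toFun (Polynomial.X * q) z) z

theorem PhaseFamily.contDiff (J : PhaseFamily) (q : Polynomial ℂ) : ContDiff ℝ ∞ (J.toFun q) := by
  rw [contDiff_infty]
  intro n
  induction n generalizing q with
  | zero =>
    rw [Nat.cast_zero, contDiff_zero]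
    exact continuous_iff_continuousAt.2 fun z => (J.hasDerivAt' q z).continuousAt
  | succ n ih =>
    rw [Nat.cast_add, Nat.cast_one, contDiff_succ_iff_deriv]
    refine ⟨fun z => (J.hasDerivAt' q z).differentiableAt, by simp, ?_⟩
    have : deriv (J.toFun q) = fun z => I * J.toFun (Polynomial.X * q) z :=
      funext fun z => (J.hasDerivAt' q z).deriv
    rw [this]
    exact contDiff_const.mul (ih _)

/-- The function `r ↦ J_q(t (log r + b))`. -/
noncomputable def PhaseFamily.radial (J : PhaseFamily) (b t : ℝ) (q : Polynomial ℂ) : SmoothPos :=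
  ⟨fun r => J.toFun q (t * (Real.log r + b)), by
    refine (J.contDiff q).comp_contDiffOn (contDiffOn_const.mul (ContDiffOn.add ?_ contDiffOn_const))
    exact contDiffOn_id.log fun r hr => (Set.mem_Ioi.1 hr).ne'⟩

/-- The function `J_q(t (log ξ_{k₀} + b)) ψ(ξ)`. -/
noncomputable def wave {k₀ : Fin d} (J : PhaseFamily) (b t : ℝ) (q : Polynomial ℂ)
    (ψ : posFreq k₀) : 𝓢(EuclideanSpace ℝ (Fin d), ℂ) := (radialMul (J.radial b t q) ψ).1

variable {k₀ : Fin d} {J : PhaseFamily} {b : ℝ}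

theorem wave_apply (t : ℝ) (q : Polynomial ℂ) (ψ : posFreq k₀) (ξ : EuclideanSpace ℝ (Fin d)) :
    wave J b t q ψ ξ = J.toFun q (t * (Real.log (ξ k₀) + b)) * ψ.1 ξ := rfl

theorem wave_sub_left (t : ℝ) (q q' : Polynomial ℂ) (ψ : posFreq k₀) :
    wave J b t (q - q') ψ = wave J b t q ψ - wave J b t q' ψ := by
  ext ξ
  simp only [wave_apply, map_sub, Pi.sub_apply, sub_apply, sub_mul]

theorem freqDeriv_wave (k : Fin d) (t : ℝ) (q : Polynomial ℂ) (ψ : posFreq k₀) :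
    freqDeriv k (wave J b t q ψ) = wave J b t q ⟨freqDeriv k ψ.1, freqDeriv_mem k ψ.2⟩ :=
  freqDeriv_radialMul k _ ψ

/-- The argument `t(log ξ + b)` has derivative `t/ξ` in the coordinate `k₀` only. The scalar is
`(i/2π) · i = -1/(2π)`, the second `i` coming from `J_q' = i J_{Xq}`. -/
theorem freqCoord_wave (k : Fin d) (t : ℝ) (q : Polynomial ℂ) (ψ : posFreq k₀) :
    freqCoord k (wave J b t q ψ) = wave J b t q ⟨freqCoord k ψ.1, freqCoord_mem k ψ.2⟩
      + ((t : ℂ) * if k = k₀ then -(1 / (2 * Real.pi) : ℂ) else 0) •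
        wave J b t (Polynomial.X * q) (divFreq ψ) := by
  have hder : ∀ r, 0 < r → HasDerivAt (J.radial b t q).1
      (I * J.toFun (Polynomial.X * q) (t * (Real.log r + b)) * (t * r⁻¹ : ℝ)) r := by
    intro r hr
    have h1 : HasDerivAt (fun r => t * (Real.log r + b)) (t * r⁻¹) r :=
      ((Real.hasDerivAt_log hr.ne').add_const b).const_mul t
    have := (J.hasDerivAt' q _).scomp r h1
    rw [Complex.real_smul, mul_comm] at this
    exact this
  let m' : SmoothPos := ⟨fun r => I * J.toFun (Polynomial.X * q) (t * (Real.log r + b)) *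
      (t * r⁻¹ : ℝ), by
    refine (contDiffOn_const.mul (J.radial b t (Polynomial.X * q)).2).mul ?_
    refine Complex.ofRealCLM.contDiff.comp_contDiffOn
      (contDiffOn_const.mul (contDiffOn_id.inv fun r hr => ?_))
    exact (Set.mem_Ioi.1 hr).ne'⟩
  rw [wave, freqCoord_radialMul k _ m' hder]
  congr 1
  ext ξ
  simp only [smul_apply, radialMul_apply, wave_apply, divFreq, smul_eq_mul, m']
  have hpi : (Real.pi : ℂ) ≠ 0 := by exact_mod_cast Real.pi_ne_zero
  split_ifs
  · push_cast
    field_simp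
    rw [I_sq]
    ring
  · simp

theorem freqDeriv_divFreq (ψ : posFreq k₀) :
    freqDeriv k₀ (divFreq ψ).1 = (2 * Real.pi * I : ℂ) • ψ.1 := by
  ext ξ
  simp only [freqDeriv, LinearMap.smul_apply, smul_apply, mulCoord_apply, divFreq, radialMul_apply,
    smul_eq_mul]
  by_cases h : 0 < ξ k₀
  · have : ((ξ k₀ : ℝ) : ℂ) ≠ 0 := by exact_mod_cast h.ne'
    push_cast
    field_simp
  · rw [eq_zero_of_nonpos ψ h]; ring

theorem divFreq_freqDeriv (ψ : posFreq k₀) :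
    (divFreq ⟨freqDeriv k₀ ψ.1, freqDeriv_mem k₀ ψ.2⟩).1 = (2 * Real.pi * I : ℂ) • ψ.1 := by
  rw [← freqDeriv_divFreq, divFreq, divFreq, freqDeriv_radialMul]

theorem wave_congr_smul (t : ℝ) (q : Polynomial ℂ) {ψ φ : posFreq k₀} {c : ℂ}
    (h : ψ.1 = c • φ.1) : wave J b t q ψ = c • wave J b t q φ := by
  ext ξ
  simp only [wave_apply, h, smul_apply, smul_eq_mul]
  ring

/-- On the Fourier side `∑ x_k ∂_k` becomes `-∑ ∂_k ξ_k`. On the phase this gives `-ξ · (it/ξ)`, so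
the division by `ξ` is undone and `-it X` remains. -/
theorem freqEuler_wave (c : ℂ) (t : ℝ) (q : Polynomial ℂ) (ψ : posFreq k₀) :
    freqEuler c (wave J b t q ψ) = wave J b t q ⟨freqEuler c ψ.1, freqEuler_mem c ψ.2⟩
      - ((t : ℂ) * I) • wave J b t (Polynomial.X * q) ψ := by
  have h1 : ∀ k, freqCoord k (freqDeriv k (wave J b t q ψ))
      = wave J b t q ⟨freqCoord k (freqDeriv k ψ.1), freqCoord_mem k (freqDeriv_mem k ψ.2)⟩
        - (if k = k₀ then (t : ℂ) * I else 0) • wave J b t (Polynomial.X * q) ψ := by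
    intro k
    rw [freqDeriv_wave, freqCoord_wave]
    split_ifs with hk
    · subst hk
      rw [wave_congr_smul t _ (divFreq_freqDeriv ψ), smul_smul, sub_eq_add_neg, ← neg_smul]
      congr 2
      have hpi : (Real.pi : ℂ) ≠ 0 := by exact_mod_cast Real.pi_ne_zero
      field_simp
    · simp
  simp only [freqEuler, LinearMap.add_apply, LinearMap.sum_apply, LinearMap.comp_apply,
    LinearMap.smul_apply, LinearMap.id_apply, h1, Finset.sum_sub_distrib]
  rw [← Finset.sum_smul, Finset.sum_ite_eq']
  simp only [Finset.mem_univ, if_true]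
  have h2 : wave J b t q ⟨∑ k, freqCoord k (freqDeriv k ψ.1) + c • ψ.1, Submodule.add_mem _
      (Submodule.sum_mem _ fun k _ => freqCoord_mem k (freqDeriv_mem k ψ.2))
      (Submodule.smul_mem _ _ ψ.2)⟩
      = ∑ k, wave J b t q ⟨freqCoord k (freqDeriv k ψ.1), freqCoord_mem k (freqDeriv_mem k ψ.2)⟩
        + c • wave J b t q ψ := by
    ext ξ
    simp only [wave_apply, add_apply, sum_apply, smul_apply, smul_eq_mul, mul_add, Finset.mul_sum]
    ring
  rw [h2]
  abel

/-- The character contributes `+it` and the Euler field `-it X`. Their sum `it(1 - X)` vanishes on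
the phase `τ = 1`. -/
theorem freqEuler_homExponent_wave (t : ℝ) (q : Polynomial ℂ) (ψ : posFreq k₀) :
    freqEuler (-homExponent d t) (wave J b t q ψ)
      = wave J b t q ⟨freqEuler (-homExponent d 0) ψ.1, freqEuler_mem _ ψ.2⟩
      + ((t : ℂ) * I) • wave J b t ((1 - Polynomial.X) * q) ψ := by
  rw [freqEuler_wave, sub_mul, one_mul, wave_sub_left, smul_sub]
  have : wave J b t q ⟨freqEuler (-homExponent d t) ψ.1, freqEuler_mem _ ψ.2⟩
      = wave J b t q ⟨freqEuler (-homExponent d 0) ψ.1, freqEuler_mem _ ψ.2⟩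
        + ((t : ℂ) * I) • wave J b t q ψ := by
    ext ξ
    simp only [wave_apply, add_apply, smul_apply, smul_eq_mul, freqEuler, LinearMap.add_apply,
      LinearMap.smul_apply, LinearMap.id_apply, homExponent]
    push_cast
    ring
  rw [this]
  abel

end PositiveFrequency

/-! ### Orders of growth in `t` under the derived representation. -/

section WaveFamily

variable {d : ℕ}

/-- The span of the families `t ↦ t ^ j J_q(t (log ξ_{k₀} + b)) ψ(ξ)` with `j ≤ m`. -/
noncomputable def waveFamily (k₀ : Fin d) (J : PhaseFamily) (b : ℝ) (m : ℕ) :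
    Submodule ℂ (ℝ → 𝓢(EuclideanSpace ℝ (Fin d), ℂ)) :=
  Submodule.span ℂ {Ψ | ∃ j ≤ m, ∃ (q : Polynomial ℂ) (ψ : posFreq k₀),
    Ψ = fun t : ℝ => (t : ℂ) ^ j • wave J b t q ψ}

variable {k₀ : Fin d} {J : PhaseFamily} {b : ℝ}

theorem waveFamily_mono {m m' : ℕ} (h : m ≤ m') : waveFamily k₀ J b m ≤ waveFamily k₀ J b m' :=
  Submodule.span_mono fun _ ⟨j, hj, hΨ⟩ => ⟨j, hj.trans h, hΨ⟩

theorem wave_mem_waveFamily (q : Polynomial ℂ) (ψ : posFreq k₀) :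
    (fun t => wave J b t q ψ) ∈ waveFamily k₀ J b 0 :=
  Submodule.subset_span ⟨0, le_rfl, q, ψ, by simp⟩

/-- An operator that depends on `t` and maps waves to families of order `e` raises the order of
families by `e`. -/
theorem map_mem_waveFamily {e m : ℕ}
    (A : ℝ → 𝓢(EuclideanSpace ℝ (Fin d), ℂ) →ₗ[ℂ] 𝓢(EuclideanSpace ℝ (Fin d), ℂ))
    (hA : ∀ (q : Polynomial ℂ) (ψ : posFreq k₀),
      (fun t => A t (wave J b t q ψ)) ∈ waveFamily k₀ J b e)
    {Ψ : ℝ → 𝓢(EuclideanSpace ℝ (Fin d), ℂ)} (hΨ : Ψ ∈ waveFamily k₀ J b m) :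
    (fun t => A t (Ψ t)) ∈ waveFamily k₀ J b (m + e) := by
  have hpow : ∀ (j : ℕ) (Φ : ℝ → 𝓢(EuclideanSpace ℝ (Fin d), ℂ)), j ≤ m → Φ ∈ waveFamily k₀ J b e →
      (fun t : ℝ => (t : ℂ) ^ j • Φ t) ∈ waveFamily k₀ J b (m + e) := by
    intro j Φ hj hΦ
    induction hΦ using Submodule.span_induction with
    | mem Φ hΦ =>
      obtain ⟨i, hi, q, ψ, rfl⟩ := hΦ
      refine Submodule.subset_span ⟨j + i, add_le_add hj hi, q, ψ, ?_⟩
      funext t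
      rw [smul_smul, pow_add]
    | zero =>
      convert Submodule.zero_mem (waveFamily k₀ J b (m + e)) using 1
      funext t; simp
    | add Φ Φ' _ _ h h' =>
      convert Submodule.add_mem _ h h' using 1
      funext t; simp
    | smul c Φ _ h =>
      convert Submodule.smul_mem _ c h using 1
      funext t; simp [smul_comm c]
  induction hΨ using Submodule.span_induction with
  | mem Ψ hΨ =>
    obtain ⟨j, hj, q, ψ, rfl⟩ := hΨ
    simp only [map_smul]
    exact hpow j _ hj (hA q ψ)
  | zero =>
    convert Submodule.zero_mem (waveFamily k₀ J b (m + e)) using 1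
    funext t; simp
  | add Φ Φ' _ _ h h' =>
    convert Submodule.add_mem _ h h' using 1
    funext t; simp
  | smul c Φ _ h =>
    convert Submodule.smul_mem _ c h using 1
    funext t; simp

theorem smul_mem_waveFamily {m : ℕ} {Ψ : ℝ → 𝓢(EuclideanSpace ℝ (Fin d), ℂ)}
    (hΨ : Ψ ∈ waveFamily k₀ J b m) (c : ℂ) :
    (fun t : ℝ => ((t : ℂ) * c) • Ψ t) ∈ waveFamily k₀ J b (m + 1) := by
  refine map_mem_waveFamily (fun t : ℝ => ((t : ℂ) * c) •
    (LinearMap.id : 𝓢(EuclideanSpace ℝ (Fin d), ℂ) →ₗ[ℂ] 𝓢(EuclideanSpace ℝ (Fin d), ℂ))) (fun q ψ => ?_) hΨ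
  have : (fun t : ℝ => (((t : ℂ) * c) • (LinearMap.id :
      𝓢(EuclideanSpace ℝ (Fin d), ℂ) →ₗ[ℂ] 𝓢(EuclideanSpace ℝ (Fin d), ℂ))) (wave J b t q ψ))
      = c • fun t : ℝ => (t : ℂ) ^ 1 • wave J b t q ψ := by
    funext t
    rw [LinearMap.smul_apply, LinearMap.id_apply, Pi.smul_apply, pow_one, smul_smul, mul_comm]
  rw [this]
  exact Submodule.smul_mem _ _ (Submodule.subset_span ⟨1, le_rfl, q, ψ, rfl⟩)

theorem freqDeriv_mem_waveFamily (k : Fin d) {m : ℕ} {Ψ : ℝ → 𝓢(EuclideanSpace ℝ (Fin d), ℂ)}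
    (hΨ : Ψ ∈ waveFamily k₀ J b m) : (fun t => freqDeriv k (Ψ t)) ∈ waveFamily k₀ J b m := by
  refine map_mem_waveFamily (e := 0) (fun _ => freqDeriv k) (fun q ψ => ?_) hΨ
  simp only [freqDeriv_wave]
  exact wave_mem_waveFamily _ _

theorem freqCoord_mem_waveFamily (k : Fin d) {m : ℕ} {Ψ : ℝ → 𝓢(EuclideanSpace ℝ (Fin d), ℂ)}
    (hΨ : Ψ ∈ waveFamily k₀ J b m) : (fun t => freqCoord k (Ψ t)) ∈ waveFamily k₀ J b (m + 1) := by
  refine map_mem_waveFamily (fun _ => freqCoord k) (fun q ψ => ?_) hΨ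
  simp only [freqCoord_wave]
  exact Submodule.add_mem _ (waveFamily_mono zero_le_one (wave_mem_waveFamily _ _))
    (smul_mem_waveFamily (wave_mem_waveFamily _ _) _)

theorem freqEuler_mem_waveFamily {m : ℕ} {Ψ : ℝ → 𝓢(EuclideanSpace ℝ (Fin d), ℂ)}
    (hΨ : Ψ ∈ waveFamily k₀ J b m) :
    (fun t => freqEuler (-homExponent d t) (Ψ t)) ∈ waveFamily k₀ J b (m + 1) := by
  refine map_mem_waveFamily (fun t => freqEuler (-homExponent d t)) (fun q ψ => ?_) hΨ
  simp only [freqEuler_homExponent_wave]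
  exact Submodule.add_mem _ (waveFamily_mono zero_le_one (wave_mem_waveFamily _ _))
    (smul_mem_waveFamily (wave_mem_waveFamily _ _) _)

/-- The only contribution of second order to the derived representation. -/
theorem freqCoord_freqEuler_wave_mem (k : Fin d) (q : Polynomial ℂ) (ψ : posFreq k₀) :
    (fun t => freqCoord k (freqEuler (-homExponent d t) (wave J b t q ψ))
      + ((t : ℂ) ^ 2 * (if k = k₀ then I / (2 * Real.pi) else 0)) •
        wave J b t (Polynomial.X * ((1 - Polynomial.X) * q)) (divFreq ψ)) ∈
      waveFamily k₀ J b 1 := by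
  have e : (fun t => freqCoord k (freqEuler (-homExponent d t) (wave J b t q ψ))
      + ((t : ℂ) ^ 2 * (if k = k₀ then I / (2 * Real.pi) else 0)) •
        wave J b t (Polynomial.X * ((1 - Polynomial.X) * q)) (divFreq ψ))
      = (fun t => freqCoord k (wave J b t q ⟨freqEuler (-homExponent d 0) ψ.1, freqEuler_mem _ ψ.2⟩))
        + fun t : ℝ => ((t : ℂ) * I) • wave J b t ((1 - Polynomial.X) * q)
            ⟨freqCoord k ψ.1, freqCoord_mem k ψ.2⟩ := by
    funext t
    rw [Pi.add_apply, freqEuler_homExponent_wave, map_add, map_smul, freqCoord_wave k t _ ψ,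
      smul_add, smul_smul]
    rw [add_assoc, add_assoc, ← add_smul]
    have : (t : ℂ) * I * ((t : ℂ) * if k = k₀ then -(1 / (2 * Real.pi) : ℂ) else 0)
        + (t : ℂ) ^ 2 * (if k = k₀ then I / (2 * Real.pi) else 0) = 0 := by
      split_ifs <;> ring
    rw [this, zero_smul, add_zero]
  rw [e]
  exact Submodule.add_mem _ (freqCoord_mem_waveFamily k (wave_mem_waveFamily _ _))
    (smul_mem_waveFamily (wave_mem_waveFamily _ _) _)

/-- The order of the derived representation on the families of `J`: it is `1` if `J` vanishes on
the multiples of `X (1 - X)`, and `2` in general. -/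
def PhaseFamily.HasOrder (J : PhaseFamily) (e : ℕ) : Prop :=
  2 ≤ e ∨ (1 ≤ e ∧ ∀ q, J.toFun (Polynomial.X * ((1 - Polynomial.X) * q)) = 0)

/-- Each of the two factors costs at most one power of `t`. If `J` annihilates the multiples of `X(1
- X)`, the `t²` term disappears and the composition costs only one. -/
theorem freqCoord_freqEuler_mem_waveFamily {e : ℕ} (he : J.HasOrder e) (k : Fin d) {m : ℕ}
    {Ψ : ℝ → 𝓢(EuclideanSpace ℝ (Fin d), ℂ)} (hΨ : Ψ ∈ waveFamily k₀ J b m) :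
    (fun t => freqCoord k (freqEuler (-homExponent d t) (Ψ t))) ∈ waveFamily k₀ J b (m + e) := by
  rcases he with he | ⟨he, h0⟩
  · refine waveFamily_mono ?_ (freqCoord_mem_waveFamily k (freqEuler_mem_waveFamily hΨ))
    omega
  · refine map_mem_waveFamily (fun t => freqCoord k ∘ₗ freqEuler (-homExponent d t)) (fun q ψ => ?_) hΨ
    have h := freqCoord_freqEuler_wave_mem (J := J) (b := b) k q ψ
    have hz : ∀ t, wave J b t (Polynomial.X * ((1 - Polynomial.X) * q)) (divFreq ψ) = 0 := by
      intro t; ext ξ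
      rw [wave_apply, h0, Pi.zero_apply, zero_mul]; rfl
    simp only [hz, smul_zero, add_zero] at h
    exact waveFamily_mono he h

/-- Only the entries `X 0 k.succ` involve the operator of order `e`; all other entries contribute
order at most one. -/
theorem freqGenerator_mem_waveFamily {e : ℕ} (he : J.HasOrder e)
    (X : Matrix (Fin (d + 1)) (Fin (d + 1)) ℝ) {m : ℕ}
    {Ψ : ℝ → 𝓢(EuclideanSpace ℝ (Fin d), ℂ)} (hΨ : Ψ ∈ waveFamily k₀ J b m) :
    (fun t => freqGenerator t X (Ψ t)) ∈ waveFamily k₀ J b (m + e) := by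
  have he1 : 1 ≤ e := by rcases he with h | h <;> omega
  have e1 : (fun t => freqGenerator t X (Ψ t))
      = (X 0 0 : ℂ) • (fun t => freqEuler (-homExponent d t) (Ψ t))
        + ∑ k : Fin d, (X 0 k.succ : ℂ) • (fun t => freqCoord k (freqEuler (-homExponent d t) (Ψ t)))
        - ∑ i : Fin d, (X i.succ 0 : ℂ) • (fun t => freqDeriv i (Ψ t))
        - ∑ i : Fin d, ∑ k : Fin d, (X i.succ k.succ : ℂ) • (fun t => freqCoord k (freqDeriv i (Ψ t))) := by
    funext t
    simp only [freqGenerator, LinearMap.add_apply, LinearMap.sub_apply, LinearMap.sum_apply,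
      LinearMap.smul_apply, LinearMap.comp_apply, Pi.add_apply, Pi.sub_apply, Finset.sum_apply,
      Pi.smul_apply]
  rw [e1]
  refine Submodule.sub_mem _ (Submodule.sub_mem _ (Submodule.add_mem _ ?_ ?_) ?_) ?_
  · exact Submodule.smul_mem _ _ (waveFamily_mono (by omega) (freqEuler_mem_waveFamily hΨ))
  · exact Submodule.sum_mem _ fun k _ => Submodule.smul_mem _ _
      (freqCoord_freqEuler_mem_waveFamily he k hΨ)
  · exact Submodule.sum_mem _ fun k _ => Submodule.smul_mem _ _
      (waveFamily_mono (by omega) (freqDeriv_mem_waveFamily k hΨ))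
  · exact Submodule.sum_mem _ fun i _ => Submodule.sum_mem _ fun k _ => Submodule.smul_mem _ _
      (waveFamily_mono (by omega) (freqCoord_mem_waveFamily k (freqDeriv_mem_waveFamily i hΨ)))

/-- The operator `I - ∑ dπ(Z_k)²` on the Fourier side. -/
noncomputable def freqBessel {ι : Type*} [Fintype ι] (t : ℝ) (Z : ι → sl d)
    (ψ : 𝓢(EuclideanSpace ℝ (Fin d), ℂ)) : 𝓢(EuclideanSpace ℝ (Fin d), ℂ) :=
  ψ - ∑ k, freqGenerator t (Z k).1 (freqGenerator t (Z k).1 ψ)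

theorem freqBessel_mem_waveFamily {ι : Type*} [Fintype ι] {e : ℕ} (he : J.HasOrder e)
    (Z : ι → sl d) {m : ℕ} {Ψ : ℝ → 𝓢(EuclideanSpace ℝ (Fin d), ℂ)}
    (hΨ : Ψ ∈ waveFamily k₀ J b m) :
    (fun t => freqBessel t Z (Ψ t)) ∈ waveFamily k₀ J b (m + 2 * e) := by
  have e1 : (fun t => freqBessel t Z (Ψ t))
      = Ψ - ∑ k, fun t => freqGenerator t (Z k).1 (freqGenerator t (Z k).1 (Ψ t)) := by
    funext t
    simp only [freqBessel, Pi.sub_apply, Finset.sum_apply]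
  rw [e1]
  refine Submodule.sub_mem _ (waveFamily_mono (by omega) hΨ) (Submodule.sum_mem _ fun k _ => ?_)
  have := freqGenerator_mem_waveFamily he (Z k).1 (freqGenerator_mem_waveFamily he (Z k).1 hΨ)
  rwa [show m + 2 * e = m + e + e by ring]

theorem iterate_freqBessel_mem_waveFamily {ι : Type*} [Fintype ι] {e : ℕ} (he : J.HasOrder e)
    (Z : ι → sl d) {m : ℕ} {Ψ : ℝ → 𝓢(EuclideanSpace ℝ (Fin d), ℂ)}
    (hΨ : Ψ ∈ waveFamily k₀ J b m) (n : ℕ) :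
    (fun t => (freqBessel t Z)^[n] (Ψ t)) ∈ waveFamily k₀ J b (m + n * (2 * e)) := by
  induction n with
  | zero => simpa using hΨ
  | succ n ih =>
    have := freqBessel_mem_waveFamily he Z ih
    simp only [Function.iterate_succ', Function.comp_apply]
    rwa [show m + (n + 1) * (2 * e) = m + n * (2 * e) + 2 * e by ring]

/-- A bound of waves extends to families. -/
theorem exists_norm_le_of_mem_waveFamily {κ : ℝ}
    (hJ : ∀ (q : Polynomial ℂ) (ψ : posFreq k₀), ∃ C, ∀ (odd : Bool) (t : ℝ), 1 ≤ |t| →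
      ‖fourierVec odd t (wave J b t q ψ)‖ ≤ C * |t| ^ (-κ))
    {m : ℕ} {Ψ : ℝ → 𝓢(EuclideanSpace ℝ (Fin d), ℂ)} (hΨ : Ψ ∈ waveFamily k₀ J b m) :
    ∃ C, ∀ (odd : Bool) (t : ℝ), 1 ≤ |t| → ‖fourierVec odd t (Ψ t)‖ ≤ C * |t| ^ ((m : ℝ) - κ) := by
  induction hΨ using Submodule.span_induction with
  | mem Ψ hΨ =>
    obtain ⟨j, hj, q, ψ, rfl⟩ := hΨ
    obtain ⟨C, hC⟩ := hJ q ψ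
    refine ⟨C, fun odd t ht => ?_⟩
    have hpos : 0 < |t| := by linarith
    have hC0 : 0 ≤ C * |t| ^ (-κ) := (norm_nonneg _).trans (hC odd t ht)
    rw [map_smul, norm_smul, norm_pow, Complex.norm_real, Real.norm_eq_abs, sub_eq_add_neg,
      Real.rpow_add hpos, Real.rpow_natCast]
    calc |t| ^ j * ‖fourierVec odd t (wave J b t q ψ)‖ ≤ |t| ^ m * (C * |t| ^ (-κ)) := by
          gcongr
          exact hC odd t ht
      _ = _ := by ring
  | zero => exact ⟨0, fun odd t ht => by simp⟩
  | add Φ Φ' _ _ h h' =>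
    obtain ⟨C, hC⟩ := h
    obtain ⟨C', hC'⟩ := h'
    refine ⟨C + C', fun odd t ht => ?_⟩
    rw [Pi.add_apply, map_add, add_mul]
    exact (norm_add_le _ _).trans (add_le_add (hC odd t ht) (hC' odd t ht))
  | smul c Φ _ h =>
    obtain ⟨C, hC⟩ := h
    refine ⟨‖c‖ * C, fun odd t ht => ?_⟩
    rw [Pi.smul_apply, map_smul, norm_smul, mul_assoc]
    gcongr
    exact hC odd t ht

end WaveFamily

/-! ### Transport by a group element. -/

section Conjugation

variable {d : ℕ} {odd : Bool} {t : ℝ}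

/-- The element `w⁻¹ X w` of the Lie algebra. -/
def conjLie (w : SL d) (X : sl d) : sl d :=
  ⟨(w⁻¹).1 * X.1 * w.1, by
    rw [LinearMap.mem_ker, Matrix.traceLinearMap_apply, Matrix.trace_mul_comm, ← mul_assoc,
      ← Matrix.SpecialLinearGroup.coe_mul, mul_inv_cancel, Matrix.SpecialLinearGroup.coe_one, one_mul]
    exact LinearMap.mem_ker.1 X.2⟩

/-- This is `dπ(X) π(w) = π(w) dπ(w⁻¹Xw)`, obtained from the chain rule for `y ↦ F(w⁻¹ y)`. -/
theorem generator_inducedRep_lineVec (w : SL d) (X : sl d) (F : homFun d odd t) :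
    generator (inducedRep d odd t) X (inducedRep d odd t w (lineVec F))
      = inducedRep d odd t w (generator (inducedRep d odd t) (conjLie w X) (lineVec F)) := by
  rw [inducedRep_lineVec, generator_lineVec, generator_lineVec, map_neg, inducedRep_lineVec]
  congr 2
  apply Subtype.ext
  funext y
  change fderiv ℝ (fun y => F.1 ((w⁻¹).1 *ᵥ y)) y (X.1 *ᵥ y)
    = fderiv ℝ F.1 ((w⁻¹).1 *ᵥ y) (((w⁻¹).1 * X.1 * w.1) *ᵥ ((w⁻¹).1 *ᵥ y))
  rcases eq_or_ne y 0 with rfl | hy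
  · simp only [Matrix.mulVec_zero, map_zero]
  · have hww : w.1 *ᵥ ((w⁻¹).1 *ᵥ y) = y := by
      rw [Matrix.mulVec_mulVec, ← Matrix.SpecialLinearGroup.coe_mul, mul_inv_cancel,
        Matrix.SpecialLinearGroup.coe_one, Matrix.one_mulVec]
    have hy' : (w⁻¹).1 *ᵥ y ≠ 0 := by
      intro h; rw [h, Matrix.mulVec_zero] at hww; exact hy hww.symm
    have h1 := (differentiableAt_of_mem_homFun F.2 hy').hasFDerivAt.comp y
      (LinearMap.toContinuousLinearMap (Matrix.mulVecLin (w⁻¹).1)).hasFDerivAt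
    have h2 : fderiv ℝ (fun y => F.1 ((w⁻¹).1 *ᵥ y)) y = _ := h1.fderiv
    rw [h2, ← Matrix.mulVec_mulVec, ← Matrix.mulVec_mulVec, hww]
    rfl

/-- The vectors `π(w) v` for `v` with Fourier transform `ψ`. -/
noncomputable def movedVec (w : SL d) (odd : Bool) (t : ℝ) (ψ : 𝓢(EuclideanSpace ℝ (Fin d), ℂ)) :
    LineModel d := inducedRep d odd t w (fourierVec odd t ψ)

theorem movedVec_eq_lineVec (w : SL d) (odd : Bool) (t : ℝ)
    (ψ : 𝓢(EuclideanSpace ℝ (Fin d), ℂ)) : ∃ F : homFun d odd t, movedVec w odd t ψ = lineVec F := by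
  obtain ⟨F, hF⟩ := fourierVec_eq_lineVec odd t ψ
  exact ⟨_, by rw [movedVec, hF, inducedRep_lineVec]⟩

theorem isSmoothVector_movedVec (w : SL d) (odd : Bool) (t : ℝ)
    (ψ : 𝓢(EuclideanSpace ℝ (Fin d), ℂ)) : IsSmoothVector (inducedRep d odd t) (movedVec w odd t ψ) := by
  obtain ⟨F, hF⟩ := movedVec_eq_lineVec w odd t ψ
  rw [hF]
  exact isSmoothVector_lineVec F

theorem norm_movedVec (w : SL d) (odd : Bool) (t : ℝ) (ψ : 𝓢(EuclideanSpace ℝ (Fin d), ℂ)) :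
    ‖movedVec w odd t ψ‖ = ‖fourierVec odd t ψ‖ := LinearIsometryEquiv.norm_map _ _

theorem generator_movedVec (w : SL d) (odd : Bool) (t : ℝ) (X : sl d)
    (ψ : 𝓢(EuclideanSpace ℝ (Fin d), ℂ)) :
    generator (inducedRep d odd t) X (movedVec w odd t ψ)
      = movedVec w odd t (freqGenerator t (conjLie w X).1 ψ) := by
  obtain ⟨F, hF⟩ := fourierVec_eq_lineVec odd t ψ
  rw [movedVec, movedVec, hF, generator_inducedRep_lineVec, ← hF, generator_fourierVec]

theorem besselInverse_movedVec {ι : Type*} [Fintype ι] (w : SL d) (odd : Bool) (t : ℝ)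
    (Z : ι → sl d) (ψ : 𝓢(EuclideanSpace ℝ (Fin d), ℂ)) :
    besselInverse (inducedRep d odd t) Z
      (movedVec w odd t (freqBessel t (fun k => conjLie w (Z k)) ψ)) = movedVec w odd t ψ := by
  obtain ⟨F, hF⟩ := movedVec_eq_lineVec w odd t ψ
  have h := besselInverse_lineVec Z F
  rw [← hF] at h
  simp only [generator_movedVec] at h
  convert h using 2
  simp only [movedVec, freqBessel, map_sub, map_sum]

/-- It exhibits explicit preimages under powers of the bounded inverse, so that Sobolev norms can be
computed without an unbounded functional calculus. -/
theorem besselInverse_pow_movedVec {ι : Type*} [Fintype ι] (w : SL d) (odd : Bool) (t : ℝ)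
    (Z : ι → sl d) (ψ : 𝓢(EuclideanSpace ℝ (Fin d), ℂ)) (n : ℕ) :
    (besselInverse (inducedRep d odd t) Z ^ n)
      (movedVec w odd t ((freqBessel t fun k => conjLie w (Z k))^[n] ψ)) = movedVec w odd t ψ := by
  induction n with
  | zero => simp
  | succ n ih =>
    rw [pow_succ, mul_apply_eq_comp, Function.iterate_succ', Function.comp_apply,
      besselInverse_movedVec, ih]

end Conjugation

/-! ### Pure phases and their average over `[0, 1]`. -/

section Phases

/-- The phases `q(τ) e ^ (i τ z)`. -/
noncomputable def evalPhase (τ : ℝ) : PhaseFamily where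
  toFun :=
    { toFun := fun q z => q.eval (τ : ℂ) * exp (I * τ * z)
      map_add' := fun q q' => by funext z; simp [add_mul]
      map_smul' := fun c q => by funext z; simp [mul_assoc] }
  hasDerivAt' q z := by
    have h : HasDerivAt (fun z : ℝ => exp (I * τ * z)) (exp (I * τ * z) * (I * τ * 1)) z :=
      (Complex.ofRealCLM.hasDerivAt.const_mul (I * (τ : ℂ))).cexp
    refine (h.const_mul _).congr_deriv ?_
    simp only [LinearMap.coe_mk, AddHom.coe_mk, Polynomial.eval_mul, Polynomial.eval_X]
    ring

theorem evalPhase_apply (τ : ℝ) (q : Polynomial ℂ) (z : ℝ) :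
    (evalPhase τ).toFun q z = q.eval (τ : ℂ) * exp (I * τ * z) := rfl

theorem norm_evalPhase (τ : ℝ) (q : Polynomial ℂ) (z : ℝ) :
    ‖(evalPhase τ).toFun q z‖ = ‖q.eval (τ : ℂ)‖ := by
  rw [evalPhase_apply, norm_mul, show I * (τ : ℂ) * z = ((τ * z : ℝ) : ℂ) * I by push_cast; ring,
    Complex.norm_exp_ofReal_mul_I, mul_one]

/-- `τ(1 - τ) = 0` at the two endpoints. This makes the Sobolev norms of the coboundary small
compared with those of the solution. -/
theorem hasOrder_evalPhase {τ : ℝ} (h : τ = 0 ∨ τ = 1) : (evalPhase τ).HasOrder 1 := by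
  refine Or.inr ⟨le_rfl, fun q => ?_⟩
  funext z
  rcases h with rfl | rfl <;> simp [evalPhase_apply]

theorem continuous_phase_integrand (q : Polynomial ℂ) (z : ℝ) :
    Continuous fun τ : ℝ => q.eval (τ : ℂ) * exp (I * τ * z) := by
  have := q.continuous.comp Complex.continuous_ofReal
  simp only [Function.comp_def] at this
  fun_prop

/-- The integrals `∫₀¹ q(τ) e ^ (i τ z) dτ` as a function of `q`. -/
noncomputable def intervalPhaseMap : Polynomial ℂ →ₗ[ℂ] (ℝ → ℂ) where
  toFun q z := ∫ τ in (0 : ℝ)..1, q.eval (τ : ℂ) * exp (I * τ * z)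
  map_add' q q' := by
    funext z
    simp only [Polynomial.eval_add, add_mul, Pi.add_apply]
    exact intervalIntegral.integral_add
      ((continuous_phase_integrand q z).intervalIntegrable _ _)
      ((continuous_phase_integrand q' z).intervalIntegrable _ _)
  map_smul' c q := by
    funext z
    simp only [Polynomial.eval_smul, smul_eq_mul, mul_assoc, Pi.smul_apply, RingHom.id_apply]
    exact intervalIntegral.integral_const_mul _ _

theorem hasDerivAt_intervalPhaseMap (q : Polynomial ℂ) (z : ℝ) :
    HasDerivAt (fun z : ℝ => ∫ τ in (0 : ℝ)..1, q.eval (τ : ℂ) * exp (I * τ * z))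
      (I * ∫ τ in (0 : ℝ)..1, (Polynomial.X * q).eval (τ : ℂ) * exp (I * τ * z)) z := by
  obtain ⟨M, hM⟩ := (isCompact_Icc (a := (0 : ℝ)) (b := 1)).exists_bound_of_continuousOn
    ((Polynomial.X * q).continuous.comp Complex.continuous_ofReal).continuousOn
  have hd : ∀ τ z : ℝ, HasDerivAt (fun z : ℝ => q.eval (τ : ℂ) * exp (I * τ * z))
      (I * ((Polynomial.X * q).eval (τ : ℂ) * exp (I * τ * z))) z :=
    fun τ z => (evalPhase τ).hasDerivAt' q z
  have hb : ∀ τ z : ℝ, τ ∈ Set.Icc (0 : ℝ) 1 →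
      ‖I * ((Polynomial.X * q).eval (τ : ℂ) * exp (I * τ * z))‖ ≤ M := by
    intro τ z hτ
    have e := norm_evalPhase τ (Polynomial.X * q) z
    rw [evalPhase_apply] at e
    rw [norm_mul, Complex.norm_I, one_mul, e]
    exact hM τ hτ
  generalize Polynomial.X * q = q' at *
  have h := intervalIntegral.hasDerivAt_integral_of_dominated_loc_of_deriv_le (μ := volume)
    (F := fun (z : ℝ) (τ : ℝ) => q.eval (τ : ℂ) * exp (I * τ * z))
    (F' := fun (z : ℝ) (τ : ℝ) => I * (q'.eval (τ : ℂ) * exp (I * τ * z)))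
    (x₀ := z) (s := Set.univ) (a := 0) (b := 1) (bound := fun _ => M) Filter.univ_mem
    (Filter.Eventually.of_forall fun z => (continuous_phase_integrand q z).aestronglyMeasurable)
    ((continuous_phase_integrand q z).intervalIntegrable _ _)
    ((continuous_phase_integrand q' z).const_mul I).aestronglyMeasurable
    (Filter.Eventually.of_forall fun τ hτ x _ => by
      rw [Set.uIoc_of_le zero_le_one] at hτ
      exact hb τ x ⟨hτ.1.le, hτ.2⟩)
    (intervalIntegrable_const)
    (Filter.Eventually.of_forall fun τ _ x _ => hd τ x)
  rw [← intervalIntegral.integral_const_mul]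
  exact h.2

/-- The phases `∫₀¹ q(τ) e ^ (i τ z) dτ`. -/
noncomputable def intervalPhase : PhaseFamily where
  toFun := intervalPhaseMap
  hasDerivAt' q z := hasDerivAt_intervalPhaseMap q z

theorem intervalPhase_apply (q : Polynomial ℂ) (z : ℝ) :
    intervalPhase.toFun q z = ∫ τ in (0 : ℝ)..1, q.eval (τ : ℂ) * exp (I * τ * z) := rfl

/-- Integration by parts in `τ`. For `q = 1` it is `izJ = e^(iz) - 1`, the source of the coboundary
equation; for general `q` it yields decay like `1/|z|`. -/
theorem mul_intervalPhase (q : Polynomial ℂ) (z : ℝ) :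
    I * z * intervalPhase.toFun q z = q.eval 1 * exp (I * z) - q.eval 0
      - intervalPhase.toFun (Polynomial.derivative q) z := by
  have hd : ∀ τ : ℝ, HasDerivAt (fun τ : ℝ => q.eval (τ : ℂ) * exp (I * τ * z))
      ((Polynomial.derivative q).eval (τ : ℂ) * exp (I * τ * z)
        + I * z * (q.eval (τ : ℂ) * exp (I * τ * z))) τ := by
    intro τ
    have h1 : HasDerivAt (fun τ : ℝ => q.eval (τ : ℂ)) ((Polynomial.derivative q).eval (τ : ℂ)) τ :=
      (q.hasDerivAt (τ : ℂ)).comp_ofReal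
    have h2 : HasDerivAt (fun τ : ℝ => exp (I * τ * z)) (exp (I * τ * z) * (I * 1 * z)) τ :=
      ((Complex.ofRealCLM.hasDerivAt.const_mul I).mul_const (z : ℂ)).cexp
    refine (h1.mul h2).congr_deriv ?_
    ring
  have h := intervalIntegral.integral_eq_sub_of_hasDerivAt (a := 0) (b := 1) (fun τ _ => hd τ)
    (((continuous_phase_integrand _ z).add
      ((continuous_phase_integrand q z).const_mul (I * (z : ℂ)))).intervalIntegrable _ _)
  rw [intervalIntegral.integral_add ((continuous_phase_integrand _ z).intervalIntegrable _ _)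
    (((continuous_phase_integrand q z).const_mul (I * (z : ℂ))).intervalIntegrable _ _),
    intervalIntegral.integral_const_mul, ← intervalPhase_apply, ← intervalPhase_apply] at h
  simp only [Complex.ofReal_one, mul_one, Complex.ofReal_zero, mul_zero, zero_mul,
    Complex.exp_zero] at h
  linear_combination h

theorem exists_norm_intervalPhase_le (q : Polynomial ℂ) :
    ∃ M, ∀ z : ℝ, ‖intervalPhase.toFun q z‖ ≤ M := by
  obtain ⟨M, hM⟩ := (isCompact_Icc (a := (0 : ℝ)) (b := 1)).exists_bound_of_continuousOn
    (q.continuous.comp Complex.continuous_ofReal).continuousOn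
  refine ⟨M, fun z => ?_⟩
  have h := intervalIntegral.norm_integral_le_of_norm_le_const (a := 0) (b := 1) (C := M)
    (f := fun τ : ℝ => q.eval (τ : ℂ) * exp (I * τ * z)) fun τ hτ => by
      rw [Set.uIoc_of_le zero_le_one] at hτ
      have e := norm_evalPhase τ q z
      rw [evalPhase_apply] at e
      rw [e]
      exact hM τ ⟨hτ.1.le, hτ.2⟩
  simpa [intervalPhase_apply] using h

theorem exists_norm_intervalPhase_sq_le (q : Polynomial ℂ) :
    ∃ A, 0 ≤ A ∧ ∀ z, ‖intervalPhase.toFun q z‖ ^ 2 ≤ A * (1 + z ^ 2)⁻¹ := by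
  obtain ⟨M, hM⟩ := exists_norm_intervalPhase_le q
  obtain ⟨M', hM'⟩ := exists_norm_intervalPhase_le (Polynomial.derivative q)
  set N := ‖q.eval 1‖ + ‖q.eval 0‖ + M' with hN
  refine ⟨M ^ 2 + N ^ 2, by positivity, fun z => ?_⟩
  have h1 : |z| * ‖intervalPhase.toFun q z‖ ≤ N := by
    have e : |z| * ‖intervalPhase.toFun q z‖ = ‖I * z * intervalPhase.toFun q z‖ := by
      simp
    rw [e, mul_intervalPhase, hN]
    refine (norm_sub_le _ _).trans (add_le_add ((norm_sub_le _ _).trans (add_le_add ?_ le_rfl)) (hM' z))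
    rw [norm_mul, mul_comm I, Complex.norm_exp_ofReal_mul_I, mul_one]
  have h2 : (|z| * ‖intervalPhase.toFun q z‖) ^ 2 ≤ N ^ 2 := by gcongr
  have h3 : ‖intervalPhase.toFun q z‖ ^ 2 ≤ M ^ 2 := by gcongr; exact hM z
  rw [mul_pow, sq_abs] at h2
  rw [← div_eq_mul_inv, le_div_iff₀ (by positivity)]
  linarith

end Phases

/-! ### Upper and lower `L²` bounds of waves. -/

section WaveBounds

variable {d : ℕ} {k₀ : Fin d} {J : PhaseFamily} {b : ℝ}

theorem exists_support_bound (ψ : posFreq k₀) : ∃ R, 0 < R ∧ ∃ M, 0 ≤ M ∧ ∀ x : Fin d → ℝ,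
    ‖ψ.1 (WithLp.toLp 2 x)‖ ≤ M ∧ (ψ.1 (WithLp.toLp 2 x) ≠ 0 → 0 < x k₀ ∧ ∀ k, x k ∈ Set.Icc (-R) R) := by
  obtain ⟨R, hR, hR'⟩ := ψ.2.1.isCompact.isBounded.exists_pos_norm_le
  obtain ⟨M, hM⟩ := ψ.2.1.exists_bound_of_continuous ψ.1.continuous
  refine ⟨R, hR, M, (norm_nonneg _).trans (hM 0), fun x => ⟨hM _, fun hx => ?_⟩⟩
  have hx' := subset_tsupport _ (Function.mem_support.2 hx)
  refine ⟨ψ.2.2 hx', fun k => abs_le.1 ?_⟩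
  exact (PiLp.norm_apply_le (WithLp.toLp 2 x) k).trans (hR' _ hx')

theorem norm_fourierVec_le_of_bound {ψ : 𝓢(EuclideanSpace ℝ (Fin d), ℂ)} (odd : Bool) (t : ℝ)
    {h : Fin d → ℝ → ℝ} (hi : ∀ k, Integrable (h k))
    (hψ : ∀ x : Fin d → ℝ, ‖ψ (WithLp.toLp 2 x)‖ ^ 2 ≤ ∏ k, h k (x k)) :
    ‖fourierVec odd t ψ‖ ^ 2 ≤ ∏ k, ∫ y, h k y := by
  rw [norm_fourierVec_sq, ← integral_fintype_prod_volume_eq_prod]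
  exact integral_mono_of_nonneg (Filter.Eventually.of_forall fun x => by positivity)
    (Integrable.fintype_prod hi) (Filter.Eventually.of_forall hψ)

theorem integrable_indicator_Icc (R : ℝ) :
    Integrable ((Set.Icc (-R) R).indicator fun _ => (1 : ℝ)) :=
  (integrable_indicator_iff measurableSet_Icc).2 (integrableOn_const (by simp))

theorem integral_indicator_Icc {R : ℝ} (hR : 0 < R) :
    ∫ y, (Set.Icc (-R) R).indicator (fun _ => (1 : ℝ)) y = 2 * R := by
  rw [integral_indicator_const _ measurableSet_Icc, smul_eq_mul, mul_one, Real.volume_real_Icc]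
  rw [max_eq_left (by linarith)]; ring

/-- The factor `|t| ^ (-0)` is `1`; this form fits `exists_norm_le_of_mem_waveFamily` with `κ = 0`.
-/
theorem exists_norm_wave_le_of_bound (q : Polynomial ℂ) (ψ : posFreq k₀) {M : ℝ}
    (hM : ∀ z, ‖J.toFun q z‖ ≤ M) :
    ∃ C, ∀ (odd : Bool) (t : ℝ), 1 ≤ |t| → ‖fourierVec odd t (wave J b t q ψ)‖ ≤ C * |t| ^ (-(0 : ℝ)) := by
  obtain ⟨R, hR, N, hN, hψ⟩ := exists_support_bound ψ
  have hM0 : 0 ≤ M := (norm_nonneg _).trans (hM 0)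
  refine ⟨‖fourierVec false 0 ψ.1‖ * M, fun odd t _ => ?_⟩
  have h1 : ‖fourierVec odd t (wave J b t q ψ)‖ ^ 2 ≤ (‖fourierVec false 0 ψ.1‖ * M) ^ 2 := by
    rw [mul_pow, norm_fourierVec_sq, norm_fourierVec_sq, ← integral_mul_const]
    have hi : Integrable fun x : Fin d → ℝ => ‖ψ.1 (WithLp.toLp 2 x)‖ ^ 2 := by
      refine Continuous.integrable_of_hasCompactSupport ?_ ?_
      · exact ((ψ.1.continuous.comp (PiLp.continuous_toLp 2 _)).norm.pow 2)
      · have h0 : HasCompactSupport fun x : Fin d → ℝ => ψ.1 (WithLp.toLp 2 x) :=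
          ψ.2.1.comp_homeomorph (PiLp.homeomorph 2 (fun _ : Fin d => ℝ)).symm
        exact h0.comp_left (g := fun y => ‖y‖ ^ 2) (by simp)
    refine integral_mono_of_nonneg (Filter.Eventually.of_forall fun x => by positivity)
      (hi.mul_const _) (Filter.Eventually.of_forall fun x => ?_)
    simp only [wave_apply, norm_mul, mul_pow]
    rw [mul_comm]
    gcongr
    exact hM _
  rw [neg_zero, Real.rpow_zero, mul_one]
  exact abs_le_of_sq_le_sq' h1 (by positivity) |>.2

/-- The logarithm has slope at least `1/K` on `(0, K]`; concretely, `log(r/r₀) ≥ 1 - r₀/r`. -/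
theorem div_le_abs_log_sub {r r₀ K : ℝ} (hr : 0 < r) (hr₀ : 0 < r₀) (hrK : r ≤ K) (hr₀K : r₀ ≤ K) :
    |r - r₀| / K ≤ |Real.log r - Real.log r₀| := by
  wlog h : r₀ ≤ r generalizing r r₀
  · rw [abs_sub_comm, abs_sub_comm (Real.log r)]
    exact this hr₀ hr hr₀K hrK (le_of_not_ge h)
  rw [abs_of_nonneg (sub_nonneg.2 h), abs_of_nonneg (sub_nonneg.2 (Real.log_le_log hr₀ h)),
    ← Real.log_div hr.ne' hr₀.ne']
  refine le_trans ?_ (Real.one_sub_inv_le_log_of_pos (div_pos hr hr₀))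
  rw [inv_div, one_sub_div hr.ne']
  exact div_le_div_of_nonneg_left (sub_nonneg.2 h) hr hrK

/-- On the support `|t(log ξ + b)|` is at least `|t| |ξ - r₀|/K`, where `r₀ = e^(-b)`. The squared
wave is thus dominated by a constant times `(1 + (t(ξ - r₀)/K)²)⁻¹`, whose integral is `πK/|t|`. -/
theorem exists_norm_wave_le_of_decay (q : Polynomial ℂ) (ψ : posFreq k₀) {A : ℝ} (hA : 0 ≤ A)
    (hJ : ∀ z, ‖J.toFun q z‖ ^ 2 ≤ A * (1 + z ^ 2)⁻¹) :
    ∃ C, ∀ (odd : Bool) (t : ℝ), 1 ≤ |t| →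
      ‖fourierVec odd t (wave J b t q ψ)‖ ≤ C * |t| ^ (-(1 / 2) : ℝ) := by
  obtain ⟨R, hR, N, hN, hψ⟩ := exists_support_bound ψ
  set r₀ := Real.exp (-b) with hr₀
  have hr₀pos : 0 < r₀ := Real.exp_pos _
  -- `K` bounds both the resonance and the frequencies in the support.
  set K := r₀ + R with hK
  have hKpos : 0 < K := by positivity
  set D := A * N ^ 2 * (Real.pi * K) * ∏ _k ∈ Finset.univ.erase k₀, (2 * R) with hD
  have hD0 : 0 ≤ D := by
    have : 0 ≤ ∏ _k ∈ Finset.univ.erase k₀, (2 * R) := Finset.prod_nonneg fun _ _ => by positivity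
    have := Real.pi_pos
    positivity
  refine ⟨√D, fun odd t ht => ?_⟩
  have htpos : 0 < |t| := by linarith
  have ht0 : t ≠ 0 := abs_pos.1 htpos
  let h : Fin d → ℝ → ℝ := fun k => if k = k₀ then
    fun y => A * N ^ 2 * (1 + ((t / K) * (y - r₀)) ^ 2)⁻¹
    else (Set.Icc (-R) R).indicator fun _ => 1
  have hi0 : Integrable fun y : ℝ => (1 + ((t / K) * (y - r₀)) ^ 2)⁻¹ := by
    have h1 := integrable_inv_one_add_sq.comp_mul_left' (R := t / K) (by positivity)
    exact h1.comp_sub_right r₀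
  have hi : ∀ k, Integrable (h k) := by
    intro k
    by_cases hk : k = k₀
    · simp only [h, hk, if_true]
      exact hi0.const_mul _
    · simp only [h, hk, if_false]
      exact integrable_indicator_Icc R
  have hprod : ∀ x : Fin d → ℝ, ∏ k, h k (x k) = A * N ^ 2 * (1 + ((t / K) * (x k₀ - r₀)) ^ 2)⁻¹ *
      ∏ k ∈ Finset.univ.erase k₀, (Set.Icc (-R) R).indicator (fun _ => (1 : ℝ)) (x k) := by
    intro x
    rw [← Finset.mul_prod_erase _ _ (Finset.mem_univ k₀)]
    congr 1
    · simp [h]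
    · refine Finset.prod_congr rfl fun k hk => ?_
      simp only [h, Finset.ne_of_mem_erase hk, if_false]
  have hbound : ‖fourierVec odd t (wave J b t q ψ)‖ ^ 2 ≤ ∏ k, ∫ y, h k y := by
    refine norm_fourierVec_le_of_bound odd t hi fun x => ?_
    rw [hprod, wave_apply, norm_mul, mul_pow]
    by_cases hx : ψ.1 (WithLp.toLp 2 x) = 0
    · rw [hx, norm_zero]
      have : 0 ≤ ∏ k ∈ Finset.univ.erase k₀, (Set.Icc (-R) R).indicator (fun _ => (1 : ℝ)) (x k) :=
        Finset.prod_nonneg fun k _ => Set.indicator_nonneg (fun _ _ => zero_le_one) _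
      simp only [ne_eq, OfNat.ofNat_ne_zero, not_false_eq_true, zero_pow, mul_zero]
      positivity
    · obtain ⟨hpos, hbox⟩ := (hψ x).2 hx
      rw [Finset.prod_congr rfl fun k _ => Set.indicator_of_mem (hbox k) _, Finset.prod_const_one,
        mul_one]
      have hz : ((t / K) * (x k₀ - r₀)) ^ 2 ≤ (t * (Real.log (x k₀) + b)) ^ 2 := by
        have h1 := div_le_abs_log_sub hpos hr₀pos (K := K)
          (by have := (hbox k₀).2; linarith) (by linarith)
        rw [hr₀, Real.log_exp, sub_neg_eq_add, ← hr₀] at h1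
        rw [div_mul_eq_mul_div, mul_div_assoc, mul_pow, mul_pow]
        refine mul_le_mul_of_nonneg_left ?_ (sq_nonneg t)
        rw [← sq_abs, ← sq_abs (Real.log _ + b), abs_div, abs_of_pos hKpos]
        gcongr
      calc ‖J.toFun q (t * (Real.log (x k₀) + b))‖ ^ 2 * ‖ψ.1 (WithLp.toLp 2 x)‖ ^ 2
          ≤ (A * (1 + (t * (Real.log (x k₀) + b)) ^ 2)⁻¹) * N ^ 2 := by
            gcongr
            · exact hJ _
            · exact (hψ x).1
        _ ≤ (A * (1 + ((t / K) * (x k₀ - r₀)) ^ 2)⁻¹) * N ^ 2 := by gcongr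
        _ = _ := by ring
  have hint : ∏ k, ∫ y, h k y = D * |t|⁻¹ := by
    rw [← Finset.mul_prod_erase _ _ (Finset.mem_univ k₀)]
    have h1 : ∫ y, h k₀ y = A * N ^ 2 * (Real.pi * K) * |t|⁻¹ := by
      simp only [h, if_true]
      rw [integral_const_mul, integral_sub_right_eq_self (μ := volume)
        (fun y : ℝ => (1 + ((t / K) * y) ^ 2)⁻¹) r₀,
        Measure.integral_comp_mul_left (fun y : ℝ => (1 + y ^ 2)⁻¹), integral_univ_inv_one_add_sq,
        smul_eq_mul, inv_div, abs_div, abs_of_pos hKpos]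
      ring
    have h2 : ∀ k ∈ Finset.univ.erase k₀, ∫ y, h k y = 2 * R := by
      intro k hk
      simp only [h, Finset.ne_of_mem_erase hk, if_false]
      exact integral_indicator_Icc hR
    rw [h1, Finset.prod_congr rfl h2, hD]
    ring
  rw [hint] at hbound
  have hle := Real.le_sqrt_of_sq_le hbound
  rw [Real.sqrt_mul hD0] at hle
  rwa [Real.rpow_neg htpos.le, ← Real.sqrt_eq_rpow, ← Real.sqrt_inv]

/-- At the resonance the argument of the phase is `0`. On a box with one side of length proportional
to `1/|t|` it stays so small that the wave is bounded below there. -/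
theorem exists_le_norm_wave (q : Polynomial ℂ) (hq : J.toFun q 0 ≠ 0) (ψ : posFreq k₀)
    {p : Fin d → ℝ} (hp : p k₀ = Real.exp (-b)) (hψ : ψ.1 (WithLp.toLp 2 p) ≠ 0) :
    ∃ c, 0 < c ∧ ∀ (odd : Bool) (t : ℝ), 1 ≤ |t| →
      c * |t|⁻¹ ≤ ‖fourierVec odd t (wave J b t q ψ)‖ ^ 2 := by
  have hJc : Continuous fun z => ‖J.toFun q z‖ := (J.contDiff q).continuous.norm
  have hψc : Continuous fun x : Fin d → ℝ => ‖ψ.1 (WithLp.toLp 2 x)‖ :=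
    (ψ.1.continuous.comp (PiLp.continuous_toLp 2 _)).norm
  have hm : 0 < ‖J.toFun q 0‖ / 2 := by positivity
  have hm' : 0 < ‖ψ.1 (WithLp.toLp 2 p)‖ / 2 := by positivity
  obtain ⟨η, hη, hηJ⟩ := Metric.eventually_nhds_iff_ball.1 (hJc.continuousAt.eventually
    (lt_mem_nhds (half_lt_self (norm_pos_iff.2 hq))))
  obtain ⟨ρ, hρ, hρψ⟩ := Metric.eventually_nhds_iff_ball.1 (hψc.continuousAt.eventually
    (lt_mem_nhds (half_lt_self (norm_pos_iff.2 hψ))))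
  set m := ‖J.toFun q 0‖ / 2
  set m' := ‖ψ.1 (WithLp.toLp 2 p)‖ / 2
  set r₀ := Real.exp (-b) with hr₀
  have hr₀pos : 0 < r₀ := Real.exp_pos _
  -- The second bound gives `log(x/r₀) ≤ x/r₀ - 1 ≤ (η/2)/|t|` on the box; the first keeps the box
  -- inside the ball where `ψ` is bounded below.
  set ρ' := min (ρ / 2) (r₀ * (η / 2)) with hρ'
  have hρ'pos : 0 < ρ' := by positivity
  refine ⟨(m * m') ^ 2 * (ρ' * ∏ _k ∈ Finset.univ.erase k₀, (ρ / 2)), ?_, fun odd t ht => ?_⟩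
  · have : 0 < ∏ _k ∈ Finset.univ.erase k₀, (ρ / 2) := Finset.prod_pos fun _ _ => by positivity
    positivity
  have htpos : 0 < |t| := by linarith
  let u : Fin d → ℝ := fun k => p k + if k = k₀ then ρ' * |t|⁻¹ else ρ / 2
  have hinv : |t|⁻¹ ≤ 1 := inv_le_one_of_one_le₀ ht
  have hu : p ≤ u := by
    intro k
    simp only [u]
    split_ifs
    · have : 0 ≤ ρ' * |t|⁻¹ := by positivity
      linarith
    · linarith
  have hvol : (volume (Set.Icc p u)).toReal = |t|⁻¹ * (ρ' * ∏ _k ∈ Finset.univ.erase k₀, (ρ / 2)) := by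
    rw [Real.volume_Icc_pi_toReal hu, ← Finset.mul_prod_erase _ _ (Finset.mem_univ k₀)]
    have h2 : ∀ k ∈ Finset.univ.erase k₀, u k - p k = ρ / 2 := by
      intro k hk
      simp only [u, Finset.ne_of_mem_erase hk, if_false]
      ring
    rw [Finset.prod_congr rfl h2]
    simp only [u, if_true]
    ring
  have hlow : ∀ x ∈ Set.Icc p u, (m * m') ^ 2 ≤ ‖wave J b t q ψ (WithLp.toLp 2 x)‖ ^ 2 := by
    intro x hx
    rw [wave_apply, norm_mul]
    have hx1 : r₀ ≤ x k₀ := by rw [← hp]; exact hx.1 k₀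
    have hx2 : x k₀ ≤ r₀ + ρ' * |t|⁻¹ := by
      have := hx.2 k₀
      simp only [u, if_true, hp] at this
      exact this
    have hxpos : 0 < x k₀ := hr₀pos.trans_le hx1
    have h1 : |t * (Real.log (x k₀) + b)| < η := by
      have e : Real.log (x k₀) + b = Real.log (x k₀ / r₀) := by
        rw [Real.log_div hxpos.ne' hr₀pos.ne', hr₀, Real.log_exp]; ring
      have h0 : 0 ≤ Real.log (x k₀ / r₀) := Real.log_nonneg ((one_le_div hr₀pos).2 hx1)
      have h3 : Real.log (x k₀ / r₀) ≤ (η / 2) * |t|⁻¹ := by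
        refine (Real.log_le_sub_one_of_pos (div_pos hxpos hr₀pos)).trans ?_
        rw [div_sub_one hr₀pos.ne', div_le_iff₀ hr₀pos]
        have : ρ' * |t|⁻¹ ≤ r₀ * (η / 2) * |t|⁻¹ := by gcongr; exact min_le_right _ _
        linarith
      rw [e, abs_mul, abs_of_nonneg h0]
      calc |t| * Real.log (x k₀ / r₀) ≤ |t| * ((η / 2) * |t|⁻¹) := by gcongr
        _ = η / 2 := by field_simp
        _ < η := by linarith
    have h2 : dist x p < ρ := by
      rw [dist_pi_lt_iff hρ]
      intro k
      have hk1 := hx.1 k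
      have hk2 := hx.2 k
      rw [Real.dist_eq, abs_of_nonneg (by linarith)]
      have : ρ' * |t|⁻¹ ≤ ρ / 2 := by
        calc ρ' * |t|⁻¹ ≤ ρ' * 1 := by gcongr
          _ ≤ ρ / 2 := by rw [mul_one]; exact min_le_left _ _
      simp only [u] at hk2
      split_ifs at hk2 <;> linarith
    have h3 := hηJ (t * (Real.log (x k₀) + b)) (by simpa using h1)
    have h4 := hρψ x h2
    gcongr
  have hint : Integrable fun x : Fin d → ℝ => ‖wave J b t q ψ (WithLp.toLp 2 x)‖ ^ 2 := by
    have hw := (radialMul (J.radial b t q) ψ).2.1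
    refine Continuous.integrable_of_hasCompactSupport ?_ ?_
    · exact (((wave J b t q ψ).continuous.comp (PiLp.continuous_toLp 2 _)).norm.pow 2)
    · have h0 : HasCompactSupport fun x : Fin d → ℝ => wave J b t q ψ (WithLp.toLp 2 x) :=
        hw.comp_homeomorph (PiLp.homeomorph 2 (fun _ : Fin d => ℝ)).symm
      exact h0.comp_left (g := fun y => ‖y‖ ^ 2) (by simp)
  rw [norm_fourierVec_sq]
  calc (m * m') ^ 2 * (ρ' * ∏ _k ∈ Finset.univ.erase k₀, (ρ / 2)) * |t|⁻¹
      = (m * m') ^ 2 * (volume (Set.Icc p u)).toReal := by rw [hvol]; ring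
    _ ≤ ∫ x in Set.Icc p u, ‖wave J b t q ψ (WithLp.toLp 2 x)‖ ^ 2 :=
        setIntegral_ge_of_const_le_real measurableSet_Icc
          (isCompact_Icc.measure_lt_top.ne) hlow hint.integrableOn
    _ ≤ _ := setIntegral_le_integral hint (Filter.Eventually.of_forall fun x => by positivity)

end WaveBounds

/-! ### Root vectors and Weyl elements. -/

section RootVectors

variable {d : ℕ}

/-- Test against `h = e_i - e_j`: the difference `h k - h l` equals `2` only for `(k, l) = (i, j)`,
so every other entry vanishes. -/
theorem eq_smul_single_of_mem_rootSpace {i j : Fin (d + 1)} (hij : i ≠ j) {X : sl d}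
    (hX : X ∈ rootSpace i j) : X.1 = X.1 i j • Matrix.single i j 1 := by
  set h : Fin (d + 1) → ℝ := Pi.single i 1 - Pi.single j 1 with hh
  have hsum : ∑ k, h k = 0 := by
    simp [hh, Finset.sum_sub_distrib]
  ext k l
  have e := congrFun (congrFun (hX h hsum) k) l
  rw [Matrix.sub_apply, Matrix.diagonal_mul, Matrix.mul_diagonal, Matrix.smul_apply, smul_eq_mul] at e
  rw [Matrix.smul_apply, smul_eq_mul, Matrix.single_apply]
  by_cases hkl : i = k ∧ j = l
  · rw [if_pos hkl, mul_one, hkl.1, hkl.2]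
  · rw [if_neg hkl, mul_zero]
    have e2 : (h k - h l - 2) * X.1 k l = 0 := by
      have : h i - h j = 2 := by simp [hh, hij, hij.symm]; norm_num
      rw [this] at e
      linear_combination e
    refine (mul_eq_zero.1 e2).resolve_left ?_
    simp only [hh, Pi.sub_apply, Pi.single_apply]
    rcases not_and_or.1 hkl with h | h
    · simp only [if_neg (Ne.symm h)]
      split_ifs <;> norm_num
    · simp only [if_neg (Ne.symm h)]
      split_ifs <;> norm_num

/-- The root space is a line, so there are at most two unit vectors `±X`. With finitely many roots
this makes one threshold `δ` serve all of them. -/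
theorem finite_unit_rootSpace {i j : Fin (d + 1)} (hij : i ≠ j) (ip : LinearMap.BilinForm ℝ (sl d)) :
    {X | X ∈ rootSpace i j ∧ ip X X = 1}.Finite := by
  rcases Set.eq_empty_or_nonempty {X | X ∈ rootSpace i j ∧ ip X X = 1} with h | ⟨X, hX, hX1⟩
  · rw [h]; exact Set.finite_empty
  refine (Set.toFinite {X, -X}).subset ?_
  rintro Z ⟨hZ, hZ1⟩
  have h0 : X.1 i j ≠ 0 := by
    intro h0
    have : X = 0 := by
      apply Subtype.ext
      rw [eq_smul_single_of_mem_rootSpace hij hX, h0, zero_smul]; rfl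
    rw [this] at hX1
    simp at hX1
  have e : Z = (Z.1 i j / X.1 i j) • X := by
    apply Subtype.ext
    calc Z.1 = Z.1 i j • Matrix.single i j 1 := eq_smul_single_of_mem_rootSpace hij hZ
      _ = (Z.1 i j / X.1 i j) • (X.1 i j • Matrix.single i j 1) := by
        rw [smul_smul, div_mul_cancel₀ _ h0]
      _ = (Z.1 i j / X.1 i j) • X.1 := by rw [← eq_smul_single_of_mem_rootSpace hij hX]
  rw [e] at hZ1
  simp only [map_smul, LinearMap.smul_apply, hX1, smul_eq_mul, mul_one] at hZ1
  rcases mul_self_eq_one_iff.1 hZ1 with h | h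
  · left; rw [e, h, one_smul]
  · right; rw [Set.mem_singleton_iff, e, h]; exact neg_one_smul ℝ X

theorem exists_perm {n : Type*} [DecidableEq n] {k l i j : n} (hkl : k ≠ l) (hij : i ≠ j) :
    ∃ σ : Equiv.Perm n, σ k = i ∧ σ l = j := by
  have h : Equiv.swap l j k ≠ j := by
    intro h
    have := (Equiv.swap l j).injective (h.trans (Equiv.swap_apply_left l j).symm)
    exact hkl this
  refine ⟨Equiv.swap (Equiv.swap l j k) i * Equiv.swap l j, ?_, ?_⟩
  · rw [Equiv.Perm.mul_apply, Equiv.swap_apply_left]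
  · rw [Equiv.Perm.mul_apply, Equiv.swap_apply_left, Equiv.swap_apply_of_ne_of_ne h.symm hij.symm]

theorem conjLie_eq_of_mul_eq {w : SL d} {X : sl d} {A : Matrix (Fin (d + 1)) (Fin (d + 1)) ℝ}
    (h : X.1 * w.1 = w.1 * A) : (conjLie w X).1 = A := by
  change (w⁻¹).1 * X.1 * w.1 = A
  rw [mul_assoc, h, ← mul_assoc, ← Matrix.SpecialLinearGroup.coe_mul, inv_mul_cancel,
    Matrix.SpecialLinearGroup.coe_one, one_mul]

/-- Some element of the group carries the root vectors of `(i, j)` and `(j, i)` to those of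
`(k, 0)` and `(0, k)`. -/
theorem exists_conjLie {k i j : Fin (d + 1)} (hk : k ≠ 0) (hij : i ≠ j) :
    ∃ (w : SL d) (r : ℝ), r ≠ 0 ∧
      (∀ X : sl d, ∀ c : ℝ, X.1 = c • Matrix.single i j 1 →
        (conjLie w X).1 = (c * r) • Matrix.single k 0 1) ∧
      (∀ X : sl d, ∀ c : ℝ, X.1 = c • Matrix.single j i 1 →
        (conjLie w X).1 = (c * r⁻¹) • Matrix.single 0 k 1) := by
  obtain ⟨σ, hσk, hσ0⟩ := exists_perm hk hij
  -- A permutation matrix may have determinant `-1`; scaling one column by the sign brings it into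
  -- `SL`.
  let r : ℝ := ((Equiv.Perm.sign σ : ℤ) : ℝ)
  have hrr : r * r = 1 := by
    rcases Int.units_eq_one_or (Equiv.Perm.sign σ) with h | h <;> simp [r, h]
  have hr : r ≠ 0 := by
    intro h; rw [h, mul_zero] at hrr; exact zero_ne_one hrr
  let u : Fin (d + 1) → ℝ := Function.update 1 0 r
  let W : Matrix (Fin (d + 1)) (Fin (d + 1)) ℝ := (σ⁻¹).permMatrix ℝ * Matrix.diagonal u
  have hW : ∀ p m, W p m = if p = σ m then u m else 0 := by
    intro p m
    simp only [W, Matrix.mul_diagonal, Equiv.Perm.permMatrix, PEquiv.toMatrix_apply,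
      Equiv.toPEquiv_apply, Option.mem_def, Option.some.injEq, Equiv.Perm.inv_eq_iff_eq]
    split_ifs <;> simp
  have hdet : W.det = 1 := by
    simp only [W, Matrix.det_mul, Matrix.det_permutation, Matrix.det_diagonal, Equiv.Perm.sign_inv]
    rw [Finset.prod_update_of_mem (Finset.mem_univ _)]
    simpa using hrr
  have hmul : ∀ (m l : Fin (d + 1)) (c : ℝ), u m ≠ 0 →
      (c • Matrix.single (σ m) (σ l) 1) * W = W * ((c * (u l * (u m)⁻¹)) • Matrix.single m l 1) := by
    intro m l c hm
    ext p q
    rw [smul_mul_assoc, mul_smul_comm, Matrix.smul_apply, Matrix.smul_apply]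
    by_cases hp : p = σ m
    · subst hp
      rw [Matrix.single_mul_apply_same, hW]
      by_cases hq : q = l
      · subst hq
        rw [Matrix.mul_single_apply_same, hW, if_pos rfl, if_pos rfl]
        simp only [smul_eq_mul]
        field_simp
      · rw [Matrix.mul_single_apply_of_ne _ _ _ _ _ hq,
          if_neg (fun h => hq (σ.injective h).symm)]
        simp
    · rw [Matrix.single_mul_apply_of_ne _ _ _ _ _ hp]
      by_cases hq : q = l
      · subst hq
        rw [Matrix.mul_single_apply_same, hW, if_neg hp]
        simp
      · rw [Matrix.mul_single_apply_of_ne _ _ _ _ _ hq]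
        simp
  have hu0 : u 0 = r := Function.update_self _ _ _
  have huk : u k = 1 := Function.update_of_ne hk _ _
  refine ⟨⟨W, hdet⟩, r, hr, fun X c hX => conjLie_eq_of_mul_eq ?_, fun X c hX => conjLie_eq_of_mul_eq ?_⟩
  · have := hmul k 0 c (by rw [huk]; exact one_ne_zero)
    rw [hσk, hσ0, ← hX, hu0, huk, inv_one, mul_one] at this
    exact this
  · have := hmul 0 k c (by rw [hu0]; exact hr)
    rw [hσk, hσ0, ← hX, hu0, huk, one_mul] at this
    exact this

theorem expSL_mul_eq (w : SL d) {X : sl d} (hX : X.1 * X.1 = 0) :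
    expSL X * w = w * expSL (conjLie w X) := by
  have hc : w.1 * (conjLie w X).1 = X.1 * w.1 := by
    change w.1 * ((w⁻¹).1 * X.1 * w.1) = _
    rw [mul_assoc, ← mul_assoc, ← Matrix.SpecialLinearGroup.coe_mul, mul_inv_cancel,
      Matrix.SpecialLinearGroup.coe_one, one_mul]
  have hc2 : (conjLie w X).1 * (conjLie w X).1 = 0 := by
    have h1 : (conjLie w X).1 * (conjLie w X).1 = (w⁻¹).1 * X.1 * (w.1 * (conjLie w X).1) := by
      rw [← mul_assoc]; rfl
    rw [h1, hc, mul_assoc, ← mul_assoc X.1, hX, zero_mul, mul_zero]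
  apply Subtype.ext
  rw [Matrix.SpecialLinearGroup.coe_mul, Matrix.SpecialLinearGroup.coe_mul, expSL_of_sq_eq_zero hX,
    expSL_of_sq_eq_zero hc2, add_mul, mul_add, hc, one_mul, mul_one]

end RootVectors

/-! ### From three moments to all Sobolev orders. -/

section Asymptotics

variable {H : Type*} [NormedAddCommGroup H] [InnerProductSpace ℂ H] [CompleteSpace H]

/-- When `B` is injective, let `μ` be the spectral measure of `λ = B⁻¹` at `f = B^k w`. The
hypotheses are `∫ λ dμ ≥ cτ⁵`, `∫ λ² dμ ≤ Cτ⁹` and `μ ≤ Cτ`. The parts `λ ≪ τ⁴` and `λ ≫ τ⁴` cannot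
carry the first moment, so the middle part has mass of order `τ`, whence `∫ λ^s dμ ≳ τ^(4s+1)`. -/
theorem exists_le_moment {c C s : ℝ} (hc : 0 < c) (hC : 0 ≤ C) (hs : 0 ≤ s) {k : ℕ} (hk : 1 ≤ k)
    (hsk : s ≤ 2 * k) : ∃ c', 0 < c' ∧ ∀ (B : H →L[ℂ] H), 0 ≤ B → ∀ (w : H) (τ : ℝ), 0 < τ →
      c * τ ^ 5 ≤ moment B w (2 * k - 1) → moment B w (2 * (k - 1 : ℕ)) ≤ C * τ ^ 9 →
      ‖(B ^ k) w‖ ^ 2 ≤ C * τ → c' * τ ^ (4 * s + 1) ≤ moment B w (2 * k - s) := by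
  -- The two error terms are at most `εCτ` each; this `ε` makes them together at most half of the
  -- main term `cτ`.
  obtain ⟨ε, hε, hε1, hεC⟩ : ∃ ε : ℝ, 0 < ε ∧ ε ≤ 1 ∧ 2 * ε * C ≤ c / 2 := by
    refine ⟨min 1 (c / (4 * (C + 1))), by positivity, min_le_left _ _, ?_⟩
    calc 2 * min 1 (c / (4 * (C + 1))) * C ≤ 2 * (c / (4 * (C + 1))) * (C + 1) := by
          gcongr
          · exact min_le_right _ _
          · linarith
      _ = c / 2 := by field_simp; norm_num
  have hK : 0 < ε ^ s * ε := by positivity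
  refine ⟨c / 2 * (ε ^ s * ε), by positivity, fun B hB w τ hτ h1 h2 h3 => ?_⟩
  have h := moment_le_add_small hB w k hk hs hsk (T := τ ^ 4) (by positivity) hε hε1
  have e1 : c * τ ≤ moment B w (2 * k - 1) / τ ^ 4 := by
    rw [le_div_iff₀ (by positivity)]
    calc c * τ * τ ^ 4 = c * τ ^ 5 := by ring
      _ ≤ _ := h1
  have e2 : ε / (τ ^ 4) ^ 2 * moment B w (2 * (k - 1 : ℕ)) ≤ ε * C * τ := by
    rw [div_mul_eq_mul_div, div_le_iff₀ (by positivity)]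
    calc ε * moment B w (2 * (k - 1 : ℕ)) ≤ ε * (C * τ ^ 9) := by gcongr
      _ = ε * C * τ * (τ ^ 4) ^ 2 := by ring
  have e3 : ε * ‖(B ^ k) w‖ ^ 2 ≤ ε * C * τ := by
    rw [mul_assoc]; gcongr
  have e4 : (τ ^ 4) ^ s = τ ^ (4 * s) := by
    rw [← Real.rpow_natCast, ← Real.rpow_mul hτ.le]; norm_num
  rw [e4] at h
  have e5 : c / 2 * τ ≤ (ε ^ s * ε)⁻¹ / τ ^ (4 * s) * moment B w (2 * k - s) := by
    have : 2 * ε * C * τ ≤ c / 2 * τ := by gcongr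
    linarith
  rw [Real.rpow_add hτ, Real.rpow_one]
  have hp : 0 < τ ^ (4 * s) := Real.rpow_pos_of_pos hτ _
  rw [inv_eq_one_div, div_div, one_div_mul_eq_div, le_div_iff₀ (by positivity)] at e5
  linarith

/-- Interpolation at the scale `T = τ²`, which balances the two endpoint bounds. -/
theorem moment_le_of_bounds {B : H →L[ℂ] H} (hB : 0 ≤ B) (w : H) {C r : ℝ} (hr : 0 ≤ r) {k : ℕ}
    (hrk : r ≤ 2 * k) {τ : ℝ} (hτ : 0 < τ) (h0 : ‖(B ^ k) w‖ ^ 2 ≤ C)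
    (h1 : ‖w‖ ^ 2 ≤ C * τ ^ (4 * k)) : moment B w (2 * k - r) ≤ 2 * C * τ ^ (2 * r) := by
  have h := moment_le_add hB w k hr hrk (T := τ ^ 2) (by positivity)
  have e : ∀ x : ℝ, (τ ^ 2) ^ x = τ ^ (2 * x) := fun x => by
    rw [← Real.rpow_natCast, ← Real.rpow_mul hτ.le]; norm_num
  rw [e, e] at h
  have e2 : τ ^ (2 * (r - 2 * k)) * τ ^ (4 * k) = τ ^ (2 * r) := by
    rw [← Real.rpow_natCast τ (4 * k), ← Real.rpow_add hτ]
    congr 1; push_cast; ring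
  calc moment B w (2 * k - r) ≤ _ := h
    _ ≤ τ ^ (2 * r) * C + τ ^ (2 * (r - 2 * k)) * (C * τ ^ (4 * k)) := by gcongr
    _ = 2 * C * τ ^ (2 * r) := by linear_combination C * e2

/-- On the range of `B^k` the power `B^(-r/2)` is realized by `B^(k - r/2)`, which involves only a
nonnegative exponent. -/
theorem exists_rpow_apply_eq {B : H →L[ℂ] H} (hB : 0 ≤ B) {k : ℕ} {r : ℝ} (hr : 0 ≤ r)
    (hrk : r ≤ 2 * k) (w : H) :
    ∃ F : H, CFC.rpow B (r / 2) F = (B ^ k) w ∧ ‖F‖ ^ 2 = moment B w (2 * k - r) := by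
  refine ⟨CFC.rpow B ((2 * k - r) / 2) w, ?_, rfl⟩
  rw [← rpow_natCast_eq hB, ← mul_apply_eq_comp, ← rpow_add_of_nonneg B (by linarith) (by linarith)]
  congr 2; ring

end Asymptotics

/-! ### The coboundary equation and the size of its solution. -/

section Cocycle

variable {d : ℕ} {k₀ : Fin d}

/-- The divided difference has a removable singularity at `a`, as its power series there is the
shifted one. It makes the quotient of the multiplier by `log ξ + b` smooth at the resonance. -/
theorem contDiff_dslope {f : ℝ → ℂ} (hf : ∀ x, AnalyticAt ℝ f x) (a : ℝ) :
    ContDiff ℝ ∞ (dslope f a) := by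
  refine contDiff_iff_contDiffAt.2 fun x => ?_
  rcases eq_or_ne x a with rfl | hx
  · obtain ⟨p, hp⟩ := hf x
    exact hp.has_fpower_series_dslope_fslope.analyticAt.contDiffAt
  · have h : ContDiffAt ℝ ∞ (slope f a) x := by
      have h1 : ContDiffAt ℝ ∞ (fun y : ℝ => (y - a)⁻¹) x :=
        (contDiffAt_id.sub contDiffAt_const).inv (sub_ne_zero.2 hx)
      exact h1.smul ((hf x).contDiffAt.sub contDiffAt_const)
    refine h.congr_of_eventuallyEq ?_
    filter_upwards [isOpen_ne.mem_nhds hx] with y hy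
    exact dslope_of_ne _ hy

/-- The function `y ↦ exp(-2 π i κ e ^ y)`. -/
noncomputable def expPhase (κ y : ℝ) : ℂ := exp (-(2 * Real.pi * κ * (Real.exp y : ℝ) * I))

theorem analyticAt_expPhase (κ y : ℝ) : AnalyticAt ℝ (expPhase κ) y := by
  have h1 : AnalyticAt ℝ (fun y : ℝ => ((Real.exp y : ℝ) : ℂ)) y :=
    (Complex.ofRealCLM.analyticAt _).comp (f := Real.exp) _root_.analyticAt_rexp
  have h2 : AnalyticAt ℝ exp (-(2 * Real.pi * κ * (Real.exp y : ℝ) * I)) :=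
    _root_.analyticAt_cexp.restrictScalars
  exact h2.comp (f := fun y : ℝ => -(2 * Real.pi * κ * (Real.exp y : ℝ) * I))
    (((analyticAt_const.mul h1).mul analyticAt_const).neg)

/-- The function `y ↦ (exp(-2 π i κ e ^ y) - exp(-2 π i κ)) / y`, taken at `y = log r + b`. -/
noncomputable def slopeFactor (κ b : ℝ) : SmoothPos :=
  ⟨fun r => dslope (expPhase κ) 0 (Real.log r + b), by
    refine (contDiff_dslope (analyticAt_expPhase κ) 0).comp_contDiffOn
      (ContDiffOn.add ?_ contDiffOn_const)
    exact contDiffOn_id.log fun r hr => (Set.mem_Ioi.1 hr).ne'⟩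

/-- For `κ = ±1` the value of `expPhase κ` at `0` is `e^(∓2πi) = 1`: the multiplier is trivial
exactly at the resonance `r = e^(-b)`. -/
theorem mul_slopeFactor {κ : ℝ} (hκ : κ = 1 ∨ κ = -1) (b : ℝ) {r : ℝ} (hr : 0 < r) :
    ((Real.log r + b : ℝ) : ℂ) * (slopeFactor κ b).1 r
      = exp (-(2 * Real.pi * (κ * Real.exp b : ℝ) * r * I)) - 1 := by
  have h0 : expPhase κ 0 = 1 := by
    rw [expPhase, Real.exp_zero]
    rcases hκ with rfl | rfl
    · have := Complex.exp_neg (2 * Real.pi * I)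
      rw [Complex.exp_two_pi_mul_I, inv_one] at this
      rw [← this]; congr 1; push_cast; ring
    · rw [← Complex.exp_two_pi_mul_I]; congr 1; push_cast; ring
  have h := sub_smul_dslope (expPhase κ) 0 (Real.log r + b)
  rw [sub_zero, Complex.real_smul, h0, expPhase, Real.exp_add, Real.exp_log hr] at h
  change ((Real.log r + b : ℝ) : ℂ) * dslope (expPhase κ) 0 (Real.log r + b) = _
  rw [h]
  congr 2
  push_cast; ring

/-- The Fourier transform of the solution of the coboundary equation. -/
noncomputable def solution (b : ℝ) (χ : posFreq k₀) (t : ℝ) : 𝓢(EuclideanSpace ℝ (Fin d), ℂ) :=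
  (t : ℂ) • wave intervalPhase b t 1 χ

/-- The Fourier transform of the coboundary of `solution`. -/
noncomputable def coboundary (κ b : ℝ) (χ : posFreq k₀) (t : ℝ) :
    𝓢(EuclideanSpace ℝ (Fin d), ℂ) :=
  (-I) • (wave (evalPhase 1) b t 1 (radialMul (slopeFactor κ b) χ)
    - wave (evalPhase 0) b t 1 (radialMul (slopeFactor κ b) χ))

/-- The multiplier minus one is `(log ξ + b)` times the slope factor. The first factor turns `t J`
into `-i(e^(it(log ξ + b)) - 1)`, a difference of the phases `τ = 1` and `τ = 0`. -/
theorem coboundary_eq {κ : ℝ} (hκ : κ = 1 ∨ κ = -1) (b : ℝ) (χ : posFreq k₀) (odd : Bool) (t : ℝ)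
    {X : sl d} (hX : X.1 = (κ * Real.exp b) • Matrix.single k₀.succ 0 1) :
    inducedRep d odd t (expSL X) (fourierVec odd t (solution b χ t))
      = fourierVec odd t (solution b χ t) + fourierVec odd t (coboundary κ b χ t) := by
  rw [← map_add]
  refine inducedRep_expSL_fourierVec odd t _ k₀ hX fun ξ => ?_
  simp only [solution, coboundary, add_apply, smul_apply, sub_apply, wave_apply, smul_eq_mul,
    radialMul_apply]
  by_cases hξ : 0 < ξ k₀
  · have h1 := mul_slopeFactor hκ b hξ
    have h2 := mul_intervalPhase 1 (t * (Real.log (ξ k₀) + b))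
    simp only [Polynomial.eval_one, one_mul, Polynomial.derivative_one, map_zero, Pi.zero_apply,
      sub_zero] at h2
    simp only [evalPhase_apply, Polynomial.eval_one, one_mul, Complex.ofReal_one, mul_one,
      Complex.ofReal_zero, mul_zero, zero_mul, Complex.exp_zero]
    set J := intervalPhase.toFun 1 (t * (Real.log (ξ k₀) + b))
    set S := (slopeFactor κ b).1 (ξ k₀)
    set e := exp (I * ((t * (Real.log (ξ k₀) + b) : ℝ) : ℂ))
    push_cast at h1 h2 ⊢
    linear_combination ((t : ℂ) * J * χ.1 ξ) * h1 + I * S * χ.1 ξ * h2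
      - (t : ℂ) * (Real.log (ξ k₀) + b) * J * S * χ.1 ξ * I_sq
  · rw [eq_zero_of_nonpos χ hξ]
    ring

theorem solution_mem_waveFamily (b : ℝ) (χ : posFreq k₀) :
    solution b χ ∈ waveFamily k₀ intervalPhase b 1 := by
  have := smul_mem_waveFamily (wave_mem_waveFamily (J := intervalPhase) (b := b) 1 χ) 1
  simp only [mul_one] at this
  exact this

theorem exists_norm_interval_family_le {b : ℝ} {m : ℕ} {Ψ : ℝ → 𝓢(EuclideanSpace ℝ (Fin d), ℂ)}
    (hΨ : Ψ ∈ waveFamily k₀ intervalPhase b m) : ∃ C, ∀ (odd : Bool) (t : ℝ), 1 ≤ |t| →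
      ‖fourierVec odd t (Ψ t)‖ ≤ C * |t| ^ ((m : ℝ) - 1 / 2) := by
  refine exists_norm_le_of_mem_waveFamily (fun q ψ => ?_) hΨ
  obtain ⟨A, hA, hA'⟩ := exists_norm_intervalPhase_sq_le q
  exact exists_norm_wave_le_of_decay q ψ hA hA'

theorem exists_norm_eval_family_le {τ b : ℝ} {m : ℕ} {Ψ : ℝ → 𝓢(EuclideanSpace ℝ (Fin d), ℂ)}
    (hΨ : Ψ ∈ waveFamily k₀ (evalPhase τ) b m) : ∃ C, ∀ (odd : Bool) (t : ℝ), 1 ≤ |t| →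
      ‖fourierVec odd t (Ψ t)‖ ≤ C * |t| ^ m := by
  obtain ⟨C, hC⟩ := exists_norm_le_of_mem_waveFamily (κ := 0) (fun q ψ =>
    exists_norm_wave_le_of_bound q ψ fun z => (norm_evalPhase τ q z).le) hΨ
  refine ⟨C, fun odd t ht => ?_⟩
  have := hC odd t ht
  rwa [sub_zero, Real.rpow_natCast] at this

theorem iterate_freqBessel_smul_sub {ι : Type*} [Fintype ι] (t : ℝ) (Z : ι → sl d) (n : ℕ) (c : ℂ)
    (ψ φ : 𝓢(EuclideanSpace ℝ (Fin d), ℂ)) :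
    (freqBessel t Z)^[n] (c • (ψ - φ)) = c • ((freqBessel t Z)^[n] ψ - (freqBessel t Z)^[n] φ) := by
  induction n generalizing ψ φ with
  | zero => rfl
  | succ n ih =>
    have h : freqBessel t Z (c • (ψ - φ)) = c • (freqBessel t Z ψ - freqBessel t Z φ) := by
      simp only [freqBessel, map_smul, map_sub, smul_sub, Finset.smul_sum, Finset.sum_sub_distrib]
      abel
    rw [Function.iterate_succ_apply, Function.iterate_succ_apply, Function.iterate_succ_apply, h, ih]

/-- Both phases of the coboundary have order one, so each application of `I - ∑ Z_k²` costs `t²`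
instead of `t⁴`. -/
theorem exists_norm_iterate_coboundary_le {ι : Type*} [Fintype ι] (κ b : ℝ) (χ : posFreq k₀)
    (Z : ι → sl d) (n : ℕ) : ∃ C, ∀ (odd : Bool) (t : ℝ), 1 ≤ |t| →
      ‖fourierVec odd t ((freqBessel t Z)^[n] (coboundary κ b χ t))‖ ≤ C * |t| ^ (2 * n) := by
  set φ := radialMul (slopeFactor κ b) χ
  obtain ⟨C₁, h₁⟩ := exists_norm_eval_family_le (iterate_freqBessel_mem_waveFamily
    (hasOrder_evalPhase (Or.inr rfl)) Z (wave_mem_waveFamily (b := b) 1 φ) n)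
  obtain ⟨C₀, h₀⟩ := exists_norm_eval_family_le (iterate_freqBessel_mem_waveFamily
    (hasOrder_evalPhase (Or.inl rfl)) Z (wave_mem_waveFamily (b := b) 1 φ) n)
  refine ⟨C₁ + C₀, fun odd t ht => ?_⟩
  rw [coboundary, iterate_freqBessel_smul_sub, map_smul, norm_smul, norm_neg, Complex.norm_I, one_mul, map_sub, add_mul]
  have e : 0 + n * (2 * 1) = 2 * n := by ring
  rw [e] at h₁ h₀
  exact (norm_sub_le _ _).trans (add_le_add (h₁ odd t ht) (h₀ odd t ht))

theorem exists_norm_solution_le (b : ℝ) (χ : posFreq k₀) : ∃ C, ∀ (odd : Bool) (t : ℝ), 1 ≤ |t| →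
    ‖fourierVec odd t (solution b χ t)‖ ^ 2 ≤ C * |t| := by
  obtain ⟨C, hC⟩ := exists_norm_interval_family_le (solution_mem_waveFamily b χ)
  refine ⟨C ^ 2, fun odd t ht => ?_⟩
  have h := pow_le_pow_left₀ (norm_nonneg _) (hC odd t ht) 2
  rw [mul_pow, ← Real.rpow_mul_natCast (abs_nonneg t)] at h
  norm_num at h
  exact h

/-- The solution has order `1`, two generators add `4`, and the width of the layer gives `-1/2`: the
norm is `O(|t|^(9/2))`. -/
theorem exists_norm_freqBessel_solution_le {ι : Type*} [Fintype ι] (b : ℝ) (χ : posFreq k₀)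
    (Z : ι → sl d) : ∃ C, ∀ (odd : Bool) (t : ℝ), 1 ≤ |t| →
    ‖fourierVec odd t (freqBessel t Z (solution b χ t))‖ ^ 2 ≤ C * |t| ^ 9 := by
  obtain ⟨C, hC⟩ := exists_norm_interval_family_le (freqBessel_mem_waveFamily (e := 2)
    (Or.inl le_rfl) Z (solution_mem_waveFamily b χ))
  refine ⟨C ^ 2, fun odd t ht => ?_⟩
  have h := pow_le_pow_left₀ (norm_nonneg _) (hC odd t ht) 2
  rw [mul_pow, ← Real.rpow_mul_natCast (abs_nonneg t)] at h
  norm_num at h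
  exact_mod_cast h

theorem intervalPhase_zero_ne : intervalPhase.toFun
    (Polynomial.X * ((1 - Polynomial.X) * 1)) 0 ≠ 0 := by
  have h : intervalPhase.toFun (Polynomial.X * ((1 - Polynomial.X) * 1)) 0
      = ((∫ τ in (0 : ℝ)..1, (τ - τ ^ 2) : ℝ) : ℂ) := by
    rw [intervalPhase_apply, ← intervalIntegral.integral_ofReal]
    refine intervalIntegral.integral_congr fun τ _ => ?_
    simp
    ring
  rw [h, intervalIntegral.integral_sub (by simp) (by simp), integral_id, integral_pow]
  norm_num

/-- The leading term is `t³` times the wave with polynomial `X(1 - X)`, whose phase function is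
`1/6` at the resonance, so it has norm at least of order `|t|^(3 - 1/2)`. The remaining terms are
smaller by a factor `|t|`. -/
theorem exists_le_norm_freqGenerator_solution (b : ℝ) (χ : posFreq k₀) {p : Fin d → ℝ}
    (hp : p k₀ = Real.exp (-b)) (hχ : χ.1 (WithLp.toLp 2 p) ≠ 0)
    {A : Matrix (Fin (d + 1)) (Fin (d + 1)) ℝ} {r : ℝ} (hr : r ≠ 0)
    (hA : A = r • Matrix.single 0 k₀.succ 1) :
    ∃ c δ : ℝ, 0 < c ∧ ∀ (odd : Bool) (t : ℝ), δ ≤ |t| →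
      c * |t| ^ 5 ≤ ‖fourierVec odd t (freqGenerator t A (solution b χ t))‖ ^ 2 := by
  set q : Polynomial ℂ := Polynomial.X * ((1 - Polynomial.X) * 1) with hq
  have hχ' : (divFreq χ).1 (WithLp.toLp 2 p) ≠ 0 := by
    rw [divFreq, radialMul_apply]
    refine mul_ne_zero ?_ hχ
    simp only [ne_eq, Complex.ofReal_eq_zero, inv_eq_zero]
    rw [hp]
    exact (Real.exp_pos _).ne'
  obtain ⟨c₀, hc₀, h₀⟩ := exists_le_norm_wave q intervalPhase_zero_ne (divFreq χ) hp hχ'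
  obtain ⟨C, hC⟩ := exists_norm_interval_family_le
    (freqCoord_freqEuler_wave_mem (J := intervalPhase) (b := b) k₀ 1 χ)
  set D := √c₀ / (2 * Real.pi) with hD
  have hDpos : 0 < D := by have := Real.pi_pos; positivity
  -- Beyond `2C/D` the remainder `C|t|^(1/2)` is at most half of the main term `D|t|^(3/2)`.
  refine ⟨(|r| * (D / 2)) ^ 2, max 1 (2 * C / D), by positivity, fun odd t ht => ?_⟩
  have ht1 : 1 ≤ |t| := (le_max_left _ _).trans ht
  have htpos : 0 < |t| := by linarith
  have htC : C ≤ D / 2 * |t| := by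
    have := (le_max_right _ _).trans ht
    rw [div_le_iff₀ hDpos] at this
    linarith
  set u := √|t| with hu
  have hupos : 0 < u := Real.sqrt_pos.2 htpos
  have hu2 : u ^ 2 = |t| := Real.sq_sqrt htpos.le
  set W := wave intervalPhase b t q (divFreq χ) with hW
  set P := freqCoord k₀ (freqEuler (-homExponent d t) (wave intervalPhase b t 1 χ)) with hP
  have e1 : freqGenerator t A (solution b χ t) = ((r : ℂ) * t) • P := by
    have hs : ∀ i j, (A i j : ℂ) = if 0 = i ∧ k₀.succ = j then (r : ℂ) else 0 := by
      intro i j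
      rw [hA, Matrix.smul_apply, Matrix.single_apply]
      split_ifs <;> simp
    simp only [freqGenerator, hs, solution, LinearMap.add_apply, LinearMap.sub_apply,
      LinearMap.sum_apply, LinearMap.smul_apply, LinearMap.comp_apply, map_smul]
    simp only [Fin.succ_ne_zero, (Fin.succ_ne_zero _).symm, Fin.succ_inj, and_false, false_and,
      if_false, true_and, zero_smul, Finset.sum_const_zero, zero_add, sub_zero, ite_smul,
      Finset.sum_ite_eq, Finset.mem_univ, if_true, smul_smul]
    rw [mul_comm]
  have hWn : √c₀ / u ≤ ‖fourierVec odd t W‖ := by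
    have := Real.sqrt_le_sqrt (h₀ odd t ht1)
    rwa [Real.sqrt_sq (norm_nonneg _), Real.sqrt_mul hc₀.le, Real.sqrt_inv, ← div_eq_mul_inv] at this
  have hPn : D / 2 * u ^ 3 ≤ ‖fourierVec odd t P‖ := by
    have h1 := hC odd t ht1
    simp only [if_true] at h1
    rw [map_add, map_smul] at h1
    have h2 : ‖((t : ℂ) ^ 2 * (I / (2 * Real.pi))) • fourierVec odd t W‖
        = |t| ^ 2 / (2 * Real.pi) * ‖fourierVec odd t W‖ := by
      rw [norm_smul]
      congr 1
      simp [abs_of_pos Real.pi_pos, div_eq_mul_inv]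
    have h3 : |t| ^ (((1 : ℕ) : ℝ) - 1 / 2) = u := by
      rw [hu, Real.sqrt_eq_rpow]; norm_num
    rw [h3] at h1
    have h4 := norm_sub_le_norm_add (((t : ℂ) ^ 2 * (I / (2 * Real.pi))) • fourierVec odd t W)
      (fourierVec odd t P)
    rw [add_comm, h2] at h4
    have h5 : D * u ^ 3 ≤ |t| ^ 2 / (2 * Real.pi) * ‖fourierVec odd t W‖ := by
      calc D * u ^ 3 = |t| ^ 2 / (2 * Real.pi) * (√c₀ / u) := by
            rw [hD, ← hu2]; field_simp
        _ ≤ _ := by gcongr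
    have h6 : C * u ≤ D / 2 * u ^ 3 := by
      calc C * u ≤ D / 2 * |t| * u := by gcongr
        _ = D / 2 * u ^ 3 := by rw [← hu2]; ring
    linarith
  rw [e1, map_smul, norm_smul, norm_mul, Complex.norm_real, Complex.norm_real, Real.norm_eq_abs,
    Real.norm_eq_abs]
  calc (|r| * (D / 2)) ^ 2 * |t| ^ 5 = (|r| * |t| * (D / 2 * u ^ 3)) ^ 2 := by
        rw [← hu2]; ring
    _ ≤ _ := by gcongr

theorem exists_posFreq_ne_zero {p : Fin d → ℝ} (hp : 0 < p k₀) :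
    ∃ χ : posFreq k₀, χ.1 (WithLp.toLp 2 p) ≠ 0 := by
  let β : ContDiffBump (WithLp.toLp 2 p : EuclideanSpace ℝ (Fin d)) :=
    ⟨p k₀ / 4, p k₀ / 2, by positivity, by linarith⟩
  have hβ : HasCompactSupport fun ξ => (β ξ : ℂ) := β.hasCompactSupport.comp_left Complex.ofReal_zero
  refine ⟨⟨hβ.toSchwartzMap (Complex.ofRealCLM.contDiff.comp β.contDiff), hβ, ?_⟩, ?_⟩
  · have h1 : tsupport (fun ξ => (β ξ : ℂ)) ⊆ tsupport β :=
      closure_mono (Function.support_comp_subset Complex.ofReal_zero _)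
    refine h1.trans ?_
    rw [β.tsupport_eq]
    intro ξ hξ
    rw [Metric.mem_closedBall, dist_eq_norm] at hξ
    have h2 := (PiLp.norm_apply_le (ξ - WithLp.toLp 2 p) k₀).trans hξ
    rw [PiLp.sub_apply, Real.norm_eq_abs] at h2
    have h3 := (abs_le.1 h2).1
    change -(p k₀ / 2) ≤ ξ k₀ - p k₀ at h3
    change 0 < ξ k₀
    linarith
  · change ((β (WithLp.toLp 2 p) : ℝ) : ℂ) ≠ 0
    rw [β.one_of_mem_closedBall (Metric.mem_closedBall_self β.rIn_pos.le)]
    simp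

end Cocycle

/-! ### Sobolev estimates for the solution and its coboundary. -/

section Main

variable {d : ℕ}

theorem moment_two_mul_sub_one {H : Type*} [NormedAddCommGroup H] [InnerProductSpace ℂ H]
    [CompleteSpace H] {B : H →L[ℂ] H} (hB : 0 ≤ B) (w : H) {k : ℕ} (hk : 1 ≤ k) :
    moment B w (2 * k - 1) = (inner ℂ ((B ^ k) w) ((B ^ (k - 1)) w)).re := by
  obtain ⟨m, rfl⟩ : ∃ m, k = m + 1 := ⟨k - 1, by omega⟩
  have hc : (2 * ((m + 1 : ℕ) : ℝ) - 1) = ((m + (m + 1) : ℕ) : ℝ) := by push_cast; ring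
  have hsymm : (B ^ m).IsSymmetric :=
    ContinuousLinearMap.isSelfAdjoint_iff_isSymmetric.1
      (((ContinuousLinearMap.nonneg_iff_isPositive _).1 hB).isSelfAdjoint.pow m)
  rw [hc, moment_eq_inner B w (Nat.cast_nonneg _), rpow_natCast_eq hB, pow_add, mul_apply_eq_comp]
  exact congrArg Complex.re (hsymm _ _)

/-- Since `dπ(a)` is skew on smooth vectors, `⟨f, (I - a²)f⟩ = ‖f‖² + ‖af‖²`. This converts the
lower bound for `af` into one for the first spectral moment. -/
theorem inner_sub_generator_generator (w : SL d) (odd : Bool) (t : ℝ) (a : sl d)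
    (ψ : 𝓢(EuclideanSpace ℝ (Fin d), ℂ)) :
    (inner ℂ (movedVec w odd t ψ)
      (movedVec w odd t (freqBessel t (fun _ : Unit => conjLie w a) ψ))).re
      = ‖fourierVec odd t ψ‖ ^ 2 + ‖fourierVec odd t (freqGenerator t (conjLie w a).1 ψ)‖ ^ 2 := by
  have e : movedVec w odd t (freqBessel t (fun _ : Unit => conjLie w a) ψ)
      = movedVec w odd t ψ - generator (inducedRep d odd t) a
        (generator (inducedRep d odd t) a (movedVec w odd t ψ)) := by
    rw [generator_movedVec, generator_movedVec]
    simp only [movedVec, freqBessel, Finset.univ_unique, Finset.sum_singleton, map_sub]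
  have h := inner_generator (inducedRep d odd t) a
    ((isSmoothVector_movedVec w odd t ψ).differentiableAt a)
    ((isSmoothVector_movedVec w odd t (freqGenerator t (conjLie w a).1 ψ)).differentiableAt a)
  rw [← generator_movedVec] at h
  rw [e, inner_sub_right, sub_eq_add_neg, ← h, Complex.add_re, ← norm_movedVec w, ← norm_movedVec w,
    ← generator_movedVec, ← inner_self_eq_norm_sq (𝕜 := ℂ), ← inner_self_eq_norm_sq (𝕜 := ℂ)]
  rfl

/-- The lower bound for the Sobolev norms of the solution in the direction of `a`. -/
theorem exists_besselPower_solution {k₀ : Fin d} (w : SL d) {a : sl d} {r : ℝ} (hr : r ≠ 0)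
    (ha : (conjLie w a).1 = r • Matrix.single 0 k₀.succ 1) (b : ℝ) (χ : posFreq k₀) {p : Fin d → ℝ}
    (hp : p k₀ = Real.exp (-b)) (hχ : χ.1 (WithLp.toLp 2 p) ≠ 0) {s : ℝ} (hs : 0 ≤ s) :
    ∃ c δ : ℝ, 0 < c ∧ ∀ (odd : Bool) (t : ℝ), δ ≤ |t| → ∃ F : LineModel d,
      IsBesselPower (inducedRep d odd t) (fun _ : Unit => a) s (movedVec w odd t (solution b χ t)) F ∧
      c * |t| ^ (4 * s + 1) ≤ ‖F‖ ^ 2 := by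
  obtain ⟨c₀, δ₀, hc₀, h5⟩ := exists_le_norm_freqGenerator_solution b χ hp hχ hr ha
  obtain ⟨C₁, h1⟩ := exists_norm_solution_le b χ
  obtain ⟨C₉, h9⟩ := exists_norm_freqBessel_solution_le b χ (fun _ : Unit => conjLie w a)
  -- The exponent is `k = m + 1`, not `m`: `2k ≥ s` is needed, and `k ≥ 1` so that the moment of
  -- order `2(k - 1)` is available also for `s = 0`.
  obtain ⟨m, hm⟩ := exists_nat_ge (s / 2)
  have hk : 1 ≤ m + 1 := by omega
  have hsk : s ≤ 2 * ((m + 1 : ℕ) : ℝ) := by push_cast; linarith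
  obtain ⟨c, hc, hmain⟩ := exists_le_moment (H := LineModel d) (C := |C₁| + |C₉|) hc₀ (by positivity)
    hs hk hsk
  refine ⟨c, max 1 δ₀, hc, fun odd t ht => ?_⟩
  have ht1 : 1 ≤ |t| := (le_max_left _ _).trans ht
  have htpos : 0 < |t| := by linarith
  set B := besselInverse (inducedRep d odd t) (fun _ : Unit => a) with hBdef
  have hB : 0 ≤ B := besselInverse_nonneg _ _
  -- `v = (I - a²)^k f`, so `B^k v = f` and `B^(k-1) v = (I - a²) f`.
  set v := movedVec w odd t ((freqBessel t fun _ : Unit => conjLie w a)^[m + 1] (solution b χ t))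
    with hv
  have hBv : (B ^ (m + 1)) v = movedVec w odd t (solution b χ t) :=
    besselInverse_pow_movedVec w odd t (fun _ : Unit => a) _ (m + 1)
  have hBv' : (B ^ m) v
      = movedVec w odd t (freqBessel t (fun _ : Unit => conjLie w a) (solution b χ t)) := by
    rw [hv, Function.iterate_succ_apply]
    exact besselInverse_pow_movedVec w odd t (fun _ : Unit => a) _ m
  obtain ⟨F, hF, hFn⟩ := exists_rpow_apply_eq hB hs hsk v
  refine ⟨F, hF.trans hBv, ?_⟩
  rw [hFn]
  refine hmain B hB v |t| htpos ?_ ?_ ?_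
  · rw [moment_two_mul_sub_one hB v hk, Nat.add_sub_cancel, hBv, hBv',
      inner_sub_generator_generator]
    exact (h5 odd t ((le_max_right _ _).trans ht)).trans (le_add_of_nonneg_left (by positivity))
  · rw [moment_two_mul_nat hB, Nat.add_sub_cancel, hBv', norm_movedVec]
    refine (h9 odd t ht1).trans ?_
    gcongr
    linarith [le_abs_self C₉, abs_nonneg C₁]
  · rw [hBv, norm_movedVec]
    refine (h1 odd t ht1).trans ?_
    gcongr
    linarith [le_abs_self C₁, abs_nonneg C₉]

/-- The upper bound for the Sobolev norms of the coboundary. -/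
theorem exists_besselPower_coboundary {k₀ : Fin d} {ι : Type*} [Fintype ι] (w : SL d) (Y : ι → sl d)
    (κ b : ℝ) (χ : posFreq k₀) {r : ℝ} (hr : 0 ≤ r) :
    ∃ C : ℝ, ∀ (odd : Bool) (t : ℝ), 1 ≤ |t| → ∃ G : LineModel d,
      IsBesselPower (inducedRep d odd t) Y r (movedVec w odd t (coboundary κ b χ t)) G ∧
      ‖G‖ ^ 2 ≤ C * |t| ^ (2 * r) := by
  obtain ⟨m, hm⟩ := exists_nat_ge (r / 2)
  have hrm : r ≤ 2 * (m : ℝ) := by linarith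
  obtain ⟨C₀, h0⟩ := exists_norm_iterate_coboundary_le κ b χ (fun k => conjLie w (Y k)) 0
  obtain ⟨C₁, h1⟩ := exists_norm_iterate_coboundary_le κ b χ (fun k => conjLie w (Y k)) m
  refine ⟨2 * (C₀ ^ 2 + C₁ ^ 2), fun odd t ht => ?_⟩
  have htpos : 0 < |t| := by linarith
  set B := besselInverse (inducedRep d odd t) Y with hBdef
  have hB : 0 ≤ B := besselInverse_nonneg _ _
  set v := movedVec w odd t ((freqBessel t fun k => conjLie w (Y k))^[m] (coboundary κ b χ t)) with hv
  have hBv : (B ^ m) v = movedVec w odd t (coboundary κ b χ t) :=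
    besselInverse_pow_movedVec w odd t Y _ m
  obtain ⟨G, hG, hGn⟩ := exists_rpow_apply_eq hB hr hrm v
  refine ⟨G, hG.trans hBv, ?_⟩
  rw [hGn]
  refine moment_le_of_bounds hB v hr hrm htpos ?_ ?_
  · rw [hBv, norm_movedVec]
    have h := pow_le_pow_left₀ (norm_nonneg _) (h0 odd t ht) 2
    rw [mul_zero, pow_zero, mul_one] at h
    exact h.trans (le_add_of_nonneg_right (sq_nonneg _))
  · rw [hv, norm_movedVec]
    have h := pow_le_pow_left₀ (norm_nonneg _) (h1 odd t ht) 2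
    rw [mul_pow, ← pow_mul, show 2 * m * 2 = 4 * m by ring] at h
    refine h.trans ?_
    gcongr
    exact le_add_of_nonneg_left (sq_nonneg _)

/-- The pair `f, g` is built from `v` alone, and `a` enters only through the threshold for `|t|`;
hence one pair can serve all unit vectors `a` of the opposite root space. -/
theorem exists_coboundary {ι : Type*} [Fintype ι] (hd : 1 ≤ d) (Y : ι → sl d) {s σ : ℝ} (C : ℝ)
    (hs : 0 ≤ s) (hσ : 0 ≤ σ) (hσs : σ < s + 1 / 2) (hC : 0 < C) {i j : Fin (d + 1)} (hij : i ≠ j)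
    {v : sl d} (hv : v ∈ rootSpace i j) (hv0 : v ≠ 0) :
    ∃ f g : Bool → ℝ → LineModel d,
      (∀ odd t, IsSmoothVector (inducedRep d odd t) (f odd t) ∧
        IsSmoothVector (inducedRep d odd t) (g odd t) ∧
        inducedRep d odd t (expSL v) (f odd t) - f odd t = g odd t) ∧
      ∀ a ∈ rootSpace j i, a ≠ 0 → ∀ᶠ τ in Filter.atTop, ∀ (odd : Bool) (t : ℝ), |t| = τ →
        ∃ F G : LineModel d,
          IsBesselPower (inducedRep d odd t) (fun _ : Unit => a) s (f odd t) F ∧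
          IsBesselPower (inducedRep d odd t) Y (s + σ) (g odd t) G ∧ C * ‖G‖ < ‖F‖ := by
  have entry_ne : ∀ {i j : Fin (d + 1)}, i ≠ j → ∀ {X : sl d}, X ∈ rootSpace i j → X ≠ 0 →
      X.1 i j ≠ 0 := by
    intro i j hij X hX hX0 h0
    apply hX0
    apply Subtype.ext
    rw [eq_smul_single_of_mem_rootSpace hij hX, h0, zero_smul]; rfl
  let k₀ : Fin d := ⟨0, hd⟩
  obtain ⟨w, r, hr, hw, hw'⟩ := exists_conjLie (Fin.succ_ne_zero k₀) hij
  set x := v.1 i j * r with hx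
  have hx0 : x ≠ 0 := mul_ne_zero (entry_ne hij hv hv0) hr
  -- `κ` is the sign of the translation length `x` and `b = log |x|`, which places the resonance at
  -- the positive frequency `1/|x| = e^(-b)`.
  obtain ⟨κ, hκ, hκx⟩ : ∃ κ : ℝ, (κ = 1 ∨ κ = -1) ∧ κ * Real.exp (Real.log |x|) = x := by
    rw [Real.exp_log (abs_pos.2 hx0)]
    rcases lt_or_gt_of_ne hx0 with h | h
    · exact ⟨-1, Or.inr rfl, by rw [abs_of_neg h]; ring⟩
    · exact ⟨1, Or.inl rfl, by rw [abs_of_pos h]; ring⟩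
  set b := Real.log |x|
  have hv' : (conjLie w v).1 = (κ * Real.exp b) • Matrix.single k₀.succ 0 1 := by
    rw [hκx]
    exact hw v _ (eq_smul_single_of_mem_rootSpace hij hv)
  have hvsq : v.1 * v.1 = 0 := by
    rw [eq_smul_single_of_mem_rootSpace hij hv, smul_mul_assoc, mul_smul_comm,
      Matrix.single_mul_single_of_ne _ _ _ _ hij.symm, smul_zero, smul_zero]
  -- The cutoff must not vanish at some point of the resonant hyperplane; otherwise the lower bound
  -- would be lost.
  obtain ⟨χ, hχ⟩ := exists_posFreq_ne_zero (k₀ := k₀) (p := fun _ => Real.exp (-b)) (Real.exp_pos _)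
  refine ⟨fun odd t => movedVec w odd t (solution b χ t),
    fun odd t => movedVec w odd t (coboundary κ b χ t), fun odd t =>
      ⟨isSmoothVector_movedVec _ _ _ _, isSmoothVector_movedVec _ _ _ _, ?_⟩, fun a ha ha0 => ?_⟩
  · rw [sub_eq_iff_eq_add']
    change inducedRep d odd t (expSL v) (inducedRep d odd t w (fourierVec odd t (solution b χ t)))
      = inducedRep d odd t w (fourierVec odd t (solution b χ t))
        + inducedRep d odd t w (fourierVec odd t (coboundary κ b χ t))
    rw [← map_add, ← coboundary_eq hκ b χ odd t hv']
    have h : inducedRep d odd t (expSL v * w) = inducedRep d odd t (w * expSL (conjLie w v)) := by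
      rw [expSL_mul_eq w hvsq]
    rw [map_mul, map_mul] at h
    exact congrArg (fun T => T (fourierVec odd t (solution b χ t))) h
  · obtain ⟨c, δ, hc, hF⟩ := exists_besselPower_solution w
      (mul_ne_zero (entry_ne hij.symm ha ha0) (inv_ne_zero hr))
      (hw' a _ (eq_smul_single_of_mem_rootSpace hij.symm ha)) b χ rfl hχ hs
    obtain ⟨D, hG⟩ := exists_besselPower_coboundary w Y κ b χ (add_nonneg hs hσ)
    -- The exponent is `2(s + 1/2 - σ)`; this is where `σ < s + 1/2` enters.
    have hexp : 0 < 4 * s + 1 - 2 * (s + σ) := by linarith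
    filter_upwards [Filter.eventually_ge_atTop (max 1 δ),
      (tendsto_rpow_atTop hexp).eventually_gt_atTop (C ^ 2 * D / c)] with τ hτ hτ2 odd t ht
    have hτpos : 0 < τ := zero_lt_one.trans_le ((le_max_left _ _).trans hτ)
    obtain ⟨F, hF1, hF2⟩ := hF odd t (by rw [ht]; exact (le_max_right _ _).trans hτ)
    obtain ⟨G, hG1, hG2⟩ := hG odd t (by rw [ht]; exact (le_max_left _ _).trans hτ)
    refine ⟨F, G, hF1, hG1, lt_of_pow_lt_pow_left₀ 2 (norm_nonneg _) ?_⟩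
    rw [ht] at hF2 hG2
    have hp : 0 < τ ^ (2 * (s + σ)) := Real.rpow_pos_of_pos hτpos _
    calc (C * ‖G‖) ^ 2 = C ^ 2 * ‖G‖ ^ 2 := mul_pow _ _ _
      _ ≤ C ^ 2 * (D * τ ^ (2 * (s + σ))) := by gcongr
      _ = C ^ 2 * D * τ ^ (2 * (s + σ)) := by ring
      _ < (τ ^ (4 * s + 1 - 2 * (s + σ)) * c) * τ ^ (2 * (s + σ)) :=
          mul_lt_mul_of_pos_right ((div_lt_iff₀ hc).1 hτ2) hp
      _ = c * τ ^ (4 * s + 1) := by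
          rw [mul_right_comm, ← Real.rpow_add hτpos, sub_add_cancel, mul_comm]
      _ ≤ _ := hF2

end Main

end SLRep

theorem theorem2p2
    -- `n = d + 1 ≥ 2`
    (d : ℕ) (hd : 1 ≤ d)
    -- the fixed inner product on the Lie algebra, for which unit vectors are taken
    (ip : LinearMap.BilinForm ℝ (SLRep.sl d))
    (ip_symm : ∀ X Y, ip X Y = ip Y X) (ip_pos : ∀ X, X ≠ 0 → 0 < ip X X)
    -- the fixed basis of the Lie algebra that defines the Sobolev norms
    {ι : Type*} [Fintype ι] (Y : Module.Basis ι ℝ (SLRep.sl d))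
    (s σ C : ℝ) (hs : 0 ≤ s) (hσ : 0 ≤ σ) (hσs : σ < s + 1 / 2) (hC : 0 < C) :
    ∃ δ : ℝ, 0 < δ ∧
      ∀ i j : Fin (d + 1), i ≠ j → ∀ v ∈ SLRep.rootSpace i j, ip v v = 1 →
      ∀ (odd : Bool) (t : ℝ), δ ≤ |t| →
        ∃ f g : SLRep.LineModel d,
          SLRep.IsSmoothVector (SLRep.inducedRep d odd t) f ∧
          SLRep.IsSmoothVector (SLRep.inducedRep d odd t) g ∧
          SLRep.inducedRep d odd t (SLRep.expSL v) f - f = g ∧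
          ∀ a ∈ SLRep.rootSpace j i, ip a a = 1 →
            ∃ F G : SLRep.LineModel d,
              SLRep.IsBesselPower (SLRep.inducedRep d odd t) (fun _ : Unit => a) s f F ∧
              SLRep.IsBesselPower (SLRep.inducedRep d odd t) Y (s + σ) g G ∧
              C * ‖G‖ < ‖F‖ := by
  have ne_zero : ∀ X : SLRep.sl d, ip X X = 1 → X ≠ 0 := by
    rintro X hX rfl
    simp at hX
  -- Stated as an eventual property of `τ = |t|`, the claim passes through the finite quantifiers
  -- over roots and unit vectors, and both signs of `t` are covered at once.
  suffices h : ∀ᶠ τ in Filter.atTop, ∀ i j : Fin (d + 1), i ≠ j → ∀ v ∈ SLRep.rootSpace i j,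
      ip v v = 1 → ∀ (odd : Bool) (t : ℝ), |t| = τ →
        ∃ f g : SLRep.LineModel d,
          SLRep.IsSmoothVector (SLRep.inducedRep d odd t) f ∧
          SLRep.IsSmoothVector (SLRep.inducedRep d odd t) g ∧
          SLRep.inducedRep d odd t (SLRep.expSL v) f - f = g ∧
          ∀ a ∈ SLRep.rootSpace j i, ip a a = 1 →
            ∃ F G : SLRep.LineModel d,
              SLRep.IsBesselPower (SLRep.inducedRep d odd t) (fun _ : Unit => a) s f F ∧
              SLRep.IsBesselPower (SLRep.inducedRep d odd t) Y (s + σ) g G ∧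
              C * ‖G‖ < ‖F‖ by
    obtain ⟨δ, hδ⟩ := Filter.eventually_atTop.1 h
    exact ⟨max 1 δ, by positivity, fun i j hij v hv hv1 odd t ht =>
      hδ |t| ((le_max_right _ _).trans ht) i j hij v hv hv1 odd t rfl⟩
  refine Filter.eventually_all.2 fun i => Filter.eventually_all.2 fun j => ?_
  by_cases hij : i = j
  · exact Filter.Eventually.of_forall fun τ h => absurd hij h
  have key := (Filter.eventually_all_finite (SLRep.finite_unit_rootSpace hij ip)
    (l := Filter.atTop) (p := fun (v : SLRep.sl d) (τ : ℝ) => ∀ (odd : Bool) (t : ℝ), |t| = τ →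
        ∃ f g : SLRep.LineModel d,
          SLRep.IsSmoothVector (SLRep.inducedRep d odd t) f ∧
          SLRep.IsSmoothVector (SLRep.inducedRep d odd t) g ∧
          SLRep.inducedRep d odd t (SLRep.expSL v) f - f = g ∧
          ∀ a ∈ SLRep.rootSpace j i, ip a a = 1 →
            ∃ F G : SLRep.LineModel d,
              SLRep.IsBesselPower (SLRep.inducedRep d odd t) (fun _ : Unit => a) s f F ∧
              SLRep.IsBesselPower (SLRep.inducedRep d odd t) Y (s + σ) g G ∧
              C * ‖G‖ < ‖F‖)).2 ?_
  · filter_upwards [key] with τ hτ _ v hv hv1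
    exact hτ v ⟨hv, hv1⟩
  · rintro v ⟨hv, hv1⟩
    obtain ⟨f, g, hfg, hFG⟩ := SLRep.exists_coboundary hd Y C hs hσ hσs hC hij hv (ne_zero v hv1)
    filter_upwards [(Filter.eventually_all_finite
      (SLRep.finite_unit_rootSpace (Ne.symm hij) ip)).2 fun a ha => hFG a ha.1 (ne_zero a ha.2)]
      with τ hτ odd t ht
    obtain ⟨h1, h2, h3⟩ := hfg odd t
    exact ⟨f odd t, g odd t, h1, h2, h3, fun a ha ha1 => hτ a ⟨ha, ha1⟩ odd t ht⟩
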